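/- Let $u=u(x,t)$ be real-valued, write $u_{kx}=\partial^k u/\partial x^k$, and consider a sixth-order evolution equation $$u_t=\Psi(x,t,u,u_x,\ldots,u_{6x}),$$ where $\Psi$ is a smooth real function on an open set of jets and $\partial\Psi/\partial u_{6x}$ does not vanish identically on any nonempty open part of that set. Suppose that the equation (as a subset of jet space) is invariant under the projective transformations $$\mathcal M_1:\quad \bar x=\frac{\gamma_1x+\delta_1}{\gamma_2x+\delta_2},\qquad \bar t=t+\epsilon,\qquad v(\bar x,\bar t)=\frac{\alpha_1u(x,t)+\beta_1}{\alpha_2u(x,t)+\beta_2},$$ for all real $\epsilon$ and all $\begin{pmatrix}\alpha_1&\beta_1\\ \alpha_2&\beta_2\end{pmatrix},\begin{pmatrix}\gamma_1&\delta_1\\ \gamma_2&\delta_2\end{pmatrix}\in SL(2,\mathbb R)$, wherever these are defined and stay in the domain of the equation. Then the equation admits no Lie–Bäcklund symmetry of order $n\ge 7$: there is no smooth function $Q(x,t,u,u_x,\ldots,u_{nx})$, $n\geq 7$, with $\partial Q/\partial u_{nx}\not\equiv0$, on any open set of jets over the domain of $\Psi$, such that $D_tQ=\sum_{k=0}^{6}\frac{\partial\Psi}{\partial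 u_{kx}}D_x^kQ$ when $u_t=\Psi$ (here $D_x$ and $D_t$ denote total derivatives). In particular the equation is not symmetry-integrable, that is, on no open set of jets does it have a recursion operator $R=\sum_i G_iD_x^i+\sum_l A_lD_x^{-1}\circ B_l$ (finite sums, with coefficients depending on $x,t,u$ and finitely many $x$-derivatives of $u$) that generates Lie–Bäcklund symmetries of arbitrarily high order. -/

import Mathlib

open scoped ContDiff

noncomputable section

/-- Finite jets `(x, t, (u, u_x, …, u_{nx}))` of functions `u(x, t)`; only `x`-derivatives occur. -/
abbrev Jet (n : ℕ) : Type := ℝ × ℝ × (Fin (n + 1) → ℝ)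

/-- Infinite jets `(x, t, (u, u_x, u_{xx}, …))`, with the product topology. -/
abbrev JetInf : Type := ℝ × ℝ × (ℕ → ℝ)

/-- The projection of an infinite jet to its `n`-jet. -/
def trunc (n : ℕ) (j : JetInf) : Jet n := (j.1, j.2.1, fun i => j.2.2 i)

/-! ### Calculus of differential functions -/

/-- On the set `Ω` of jets, `f` is a smooth function of `x, t, u, u_x, …, u_{nx}` only. -/
def IsDiffFunction (Ω : Set JetInf) (n : ℕ) (f : JetInf → ℝ) : Prop :=
  ∃ g : Jet n → ℝ, ContDiffOn ℝ ∞ g (trunc n '' Ω) ∧ Set.EqOn f (fun j => g (trunc n j)) Ω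

/-- `∂f/∂x` (explicit dependence). -/
def partialX (f : JetInf → ℝ) (j : JetInf) : ℝ :=
  deriv (fun s => f (s, j.2.1, j.2.2)) j.1

/-- `∂f/∂t` (explicit dependence). -/
def partialT (f : JetInf → ℝ) (j : JetInf) : ℝ :=
  deriv (fun s => f (j.1, s, j.2.2)) j.2.1

/-- `∂f/∂u_{kx}`. -/
def partialU (k : ℕ) (f : JetInf → ℝ) (j : JetInf) : ℝ :=
  deriv (fun s => f (j.1, j.2.1, Function.update j.2.2 k s)) (j.2.2 k)

/-- The total `x`-derivative `D_x f = ∂f/∂x + ∑ k, u_{(k+1)x} ∂f/∂u_{kx}`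
(the sum is finite for functions of finitely many derivatives). -/
def totalX (f : JetInf → ℝ) (j : JetInf) : ℝ :=
  partialX f j + ∑ᶠ k : ℕ, j.2.2 (k + 1) * partialU k f j

/-- The linearization `∑ k, (∂f/∂u_{kx}) D_x^k h` of `f` in the direction `h`. -/
def linearization (f h : JetInf → ℝ) (j : JetInf) : ℝ :=
  ∑ᶠ k : ℕ, partialU k f j * (totalX^[k] h) j

/-- The total `t`-derivative of `f` on the solutions of `u_t = Ψ`: each `u_{kx}` has the
`t`-derivative `D_x^k Ψ`. -/
def totalT (Ψ f : JetInf → ℝ) (j : JetInf) : ℝ :=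
  partialT f j + linearization f Ψ j

/-! ### Evolution equations -/

/-- An evolution equation `u_t = Ψ(x, t, u, u_x, …, u_{px})` of order `p`, with `Ψ` smooth on an
open set of jets; it is of order `p` in the sense that `∂Ψ/∂u_{px}` does not vanish identically on
any nonempty open part of that set. -/
structure EvolutionEquation (p : ℕ) where
  dom : Set (Jet p)
  isOpen_dom : IsOpen dom
  rhs : Jet p → ℝ
  smooth_rhs : ContDiffOn ℝ ∞ rhs dom
  order_rhs : dom ⊆ closure {q ∈ dom |
    deriv (fun s => rhs (q.1, q.2.1, Function.update q.2.2 (Fin.last p) s))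
      (q.2.2 (Fin.last p)) ≠ 0}

/-! ### The projective transformation -/

/-- The fractional linear map `y ↦ (a y + b) / (c y + d)` of a matrix `(a, b; c, d)`. -/
def moebius (A : Matrix.SpecialLinearGroup (Fin 2) ℝ) (y : ℝ) : ℝ :=
  (A.1 0 0 * y + A.1 0 1) / (A.1 1 0 * y + A.1 1 1)

/-- The function `v` with `v(x', t') = A · u(x, t)`, where `x' = B · x` and `t' = t + ε`. -/
def transformed (A B : Matrix.SpecialLinearGroup (Fin 2) ℝ) (ε : ℝ) (u : ℝ → ℝ → ℝ) :
    ℝ → ℝ → ℝ :=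
  fun x' t' => moebius A (u (moebius B⁻¹ x') (t' - ε))

/-- The `n`-jet of the function `u` at `(x, t)`. -/
def jetOf (n : ℕ) (u : ℝ → ℝ → ℝ) (x t : ℝ) : Jet n :=
  (x, t, fun i => iteratedDeriv i (fun s => u s t) x)

namespace EvolutionEquation

variable {p : ℕ} (E : EvolutionEquation p)

/-- At `(x, t)` the jet of `u` lies where the equation is defined, and satisfies it. -/
def HoldsAt (u : ℝ → ℝ → ℝ) (x t : ℝ) : Prop :=
  jetOf p u x t ∈ E.dom ∧ deriv (fun s => u x s) t = E.rhs (jetOf p u x t)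

/-- Invariance of the equation (as a subset of jet space) under the projective transformations of
`u` and `x` together with the translations of `t`. -/
def IsProjectivelyInvariant : Prop :=
  ∀ (A B : Matrix.SpecialLinearGroup (Fin 2) ℝ) (ε : ℝ) (u : ℝ → ℝ → ℝ) (x t : ℝ),
    ContDiffAt ℝ ∞ (fun q : ℝ × ℝ => u q.1 q.2) (x, t) →
    B.1 1 0 * x + B.1 1 1 ≠ 0 →
    A.1 1 0 * u x t + A.1 1 1 ≠ 0 →
    E.HoldsAt u x t →
    jetOf p (transformed A B ε u) (moebius B x) (t + ε) ∈ E.dom →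
    E.HoldsAt (transformed A B ε u) (moebius B x) (t + ε)

/-! ### Symmetries -/

/-- The right-hand side as a function on infinite jets. -/
def rhsInf (j : JetInf) : ℝ := E.rhs (trunc p j)

/-- `Q ∂/∂u` is a Lie–Bäcklund symmetry on the open set `Ω` of jets: there `Q` is a smooth function
of `x`, `t`, `u` and finitely many `x`-derivatives, and `D_t Q = ∑ k, (∂Ψ/∂u_{kx}) D_x^k Q` holds on
the solutions of `u_t = Ψ`. -/
structure IsLieBacklundSymmetry (Ω : Set JetInf) (Q : JetInf → ℝ) : Prop where
  isOpen : IsOpen Ω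
  subset_dom : ∀ j ∈ Ω, trunc p j ∈ E.dom
  isDiffFunction : ∃ n, IsDiffFunction Ω n Q
  invariance : ∀ j ∈ Ω, totalT E.rhsInf Q j = linearization E.rhsInf Q j

/-- A Lie–Bäcklund symmetry of order `n`: moreover `Q = Q(x, t, u, …, u_{nx})` on `Ω`, with
`∂Q/∂u_{nx}` not identically zero. -/
def IsLieBacklundSymmetryOfOrder (Ω : Set JetInf) (n : ℕ) (Q : JetInf → ℝ) : Prop :=
  E.IsLieBacklundSymmetry Ω Q ∧ IsDiffFunction Ω n Q ∧ ∃ j ∈ Ω, partialU n Q j ≠ 0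

end EvolutionEquation

/-- An integro-differential operator `∑ i ≤ r, G_i D_x^i + ∑ l < m, A_l D_x⁻¹ ∘ B_l` whose
coefficients are differential functions on `Ω`. -/
structure IntegroDiffOperator (Ω : Set JetInf) where
  r : ℕ
  G : ℕ → JetInf → ℝ
  m : ℕ
  A : ℕ → JetInf → ℝ
  B : ℕ → JetInf → ℝ
  isDiffFunction_G : ∀ i, ∃ n, IsDiffFunction Ω n (G i)
  isDiffFunction_A : ∀ l, ∃ n, IsDiffFunction Ω n (A l)
  isDiffFunction_B : ∀ l, ∃ n, IsDiffFunction Ω n (B l)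

/-- `P = R Q` on `Ω`, for some choice of the differential functions `σ_l = D_x⁻¹ (B_l Q)`. -/
def IntegroDiffOperator.Maps {Ω : Set JetInf} (R : IntegroDiffOperator Ω) (Q P : JetInf → ℝ) :
    Prop :=
  ∃ σ : ℕ → JetInf → ℝ,
    (∀ l < R.m, (∃ n, IsDiffFunction Ω n (σ l)) ∧ ∀ j ∈ Ω, totalX (σ l) j = R.B l j * Q j) ∧
    ∀ j ∈ Ω, P j = ∑ i ∈ Finset.range (R.r + 1), R.G i j * (totalX^[i] Q) j +
      ∑ l ∈ Finset.range R.m, R.A l j * σ l j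

namespace EvolutionEquation

variable {p : ℕ} (E : EvolutionEquation p)

/-- `R` is a recursion operator: it maps symmetries to symmetries, for a suitable choice of the
integrals `D_x⁻¹ (B_l Q)`, whenever these exist as differential functions. -/
def IsRecursionOperator {Ω : Set JetInf} (R : IntegroDiffOperator Ω) : Prop :=
  ∀ Q, E.IsLieBacklundSymmetry Ω Q → (∃ P, R.Maps Q P) →
    ∃ P, R.Maps Q P ∧ E.IsLieBacklundSymmetry Ω P

/-- Symmetry-integrability: on some open set of jets, the equation has a recursion operator that
generates Lie–Bäcklund symmetries of arbitrarily high order. -/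
def IsSymmetryIntegrable : Prop :=
  ∃ (Ω : Set JetInf) (R : IntegroDiffOperator Ω) (Q : ℕ → JetInf → ℝ),
    E.IsRecursionOperator R ∧
    (∀ i, E.IsLieBacklundSymmetry Ω (Q i)) ∧
    (∀ i, R.Maps (Q i) (Q (i + 1))) ∧
    ∀ N : ℕ, ∃ n > N, ∃ i, E.IsLieBacklundSymmetryOfOrder Ω n (Q i)

end EvolutionEquation

end

/-! A symmetry Q of u_t = Ψ forces the linearizations L of Ψ and M of Q to satisfy the zero
curvature equation [D_t - L, D_Q - M] = 0, where D_Q is the flow of Q. If M has order n ≥ 7, this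
imposes conservation laws on the leading coefficients of L, like the canonical densities of an
integrable equation. They appear when both operators act on a formal exponential (WKB) eigenfunction
of L and the result is expanded in the small parameter z: `WKB.conserved_leading` concerns the power
-1/6 of the leading coefficient, `WKB.conserved_second` and `WKB.conserved_third` the next two
coefficients. With a single symmetry, the densities are conserved only up to terms and factors
annihilated by the spatial derivation.

Projective invariance makes these densities explicit. Let T be twice the Schwarzian derivative of u
and let p be proportional to |T|^(-1/2). Then ds = dx/p is an invariant arc length, the invariant of
lowest order is a curvature k of order five, and q = dk/ds has order six. By `ProjFrame.exists_inv`
the equation is u_t = u_x p F(k, q).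

The contradiction rests on one principle: a total derivative is affine in its highest derivative
(`du_du_eq_zero`), so a product of two factors with the same highest derivative, plus lower terms,
is not a total derivative unless the product of the two top coefficients vanishes
(`mul_top_eq_zero`). Integration by parts brings each conservation law into that shape.

The leading density is f ds with f = |F_q|^(-1/6), and its conservation forces f = α(k) q
(`eq_q_mul_of_conserved`). That density is α(k) dk, which gives no further obstruction, but it
allows k to be used as the independent variable. With e = α q and θ = (p/e) D, the flows corrected
by multiples of θ so as to annihilate k (`WKB.freeze`) commute with θ and with each other, and the
leading coefficient of the linearized equation becomes constant. In a suitable gauge the second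
coefficient is a numerical multiple of Γ(k) e^5, which is conserved only if Γ = 0
(`eq_zero_of_conserved`). The third is then a constant multiple of an explicit density whose
conservation is impossible (`not_conserved_T`).

The algebra is done in an abstract `JetAlgebra` in which the relevant functions are units. For a
given symmetry this is achieved by shrinking the open set of jets until u_x, the Schwarzian, the
separant and ∂Q/∂u_n have no zeros. The infinitesimal form of the invariance comes from
differentiating the finite one along one-parameter subgroups, on polynomial test functions. -/

noncomputable section

open Polynomial

/-! ### Symbols of differential operators, formal exponentials and conserved densities. -/

namespace WKB

variable {K : Type*} [CommRing K] [Algebra ℝ K]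

/-- The coefficientwise extension of a derivation to polynomials. -/
def coeffDer (d : Derivation ℝ K K) : Derivation ℝ K[X] K[X] :=
  (PolynomialModule.equivPolynomialSelf (R := K)).toLinearMap.compDer d.mapCoeffs

@[simp]
lemma coeff_coeffDer (d : Derivation ℝ K K) (p : K[X]) (i : ℕ) :
    (coeffDer d p).coeff i = d (p.coeff i) := rfl

@[simp]
lemma coeffDer_C (d : Derivation ℝ K K) (a : K) : coeffDer d (C a) = C (d a) := by
  ext i
  simp [coeff_C, apply_ite d]

@[simp]
lemma coeffDer_X (d : Derivation ℝ K K) : coeffDer d X = 0 := by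
  ext i
  simp [coeff_X, apply_ite d]

@[simp]
lemma coeffDer_X_pow (d : Derivation ℝ K K) (n : ℕ) : coeffDer d (X ^ n) = 0 := by
  simp [Derivation.leibniz_pow]

lemma coeffDer_monomial (d : Derivation ℝ K K) (i : ℕ) (c : K) :
    coeffDer d (monomial i c) = monomial i (d c) := by
  ext j
  simp [coeff_monomial, apply_ite d]

lemma natDegree_coeffDer_le (d : Derivation ℝ K K) {p : K[X]} {n : ℕ} (h : p.natDegree ≤ n) :
    (coeffDer d p).natDegree ≤ n := by
  rw [natDegree_le_iff_coeff_eq_zero] at h ⊢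
  intro i hi
  simp [h i hi]

/-! ### Evaluation of symbols -/

section ev

variable {W : Type*} [AddCommGroup W] [Module ℝ W] [Module K W]

/-- The operator `∑ i, a i Δ ^ i` with symbol `a`. -/
def ev (Δ : Module.End ℝ W) : K[X] →ₗ[K] (W → W) :=
  Polynomial.lsum fun i => LinearMap.toSpanSingleton K (W → W) (fun w => (Δ ^ i) w)

set_option linter.unusedSectionVars false in
lemma ev_monomial (Δ : Module.End ℝ W) (i : ℕ) (c : K) (w : W) :
    ev Δ (monomial i c) w = c • (Δ ^ i) w := by
  simp [ev, Polynomial.lsum_apply]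

lemma ev_eq_sum (Δ : Module.End ℝ W) {a : K[X]} {n : ℕ} (h : a.natDegree ≤ n) (w : W) :
    ev Δ a w = ∑ i ∈ Finset.range (n + 1), a.coeff i • (Δ ^ i) w := by
  conv_lhs => rw [as_sum_range' a (n + 1) (by omega)]
  simp [ev_monomial]

end ev

/-- Left multiplication by the derivation `θ` on symbols. -/
def symbolOp (θ : Derivation ℝ K K) : Module.End ℝ K[X] :=
  (coeffDer θ : K[X] →ₗ[ℝ] K[X]) + LinearMap.mulLeft ℝ X

lemma symbolOp_apply (θ : Derivation ℝ K K) (p : K[X]) :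
    symbolOp θ p = coeffDer θ p + X * p := rfl

/-- The composition of differential operators, on the level of symbols. -/
def star (θ : Derivation ℝ K K) (a b : K[X]) : K[X] := ev (symbolOp θ) a b

lemma natDegree_symbolOp_le (θ : Derivation ℝ K K) {b : K[X]} {n : ℕ} (h : b.natDegree ≤ n) :
    (symbolOp θ b).natDegree ≤ n + 1 := by
  rw [symbolOp_apply]
  refine (natDegree_add_le _ _).trans (max_le ((natDegree_coeffDer_le θ h).trans (by omega)) ?_)
  refine natDegree_mul_le.trans ?_
  have := natDegree_X_le (R := K)
  omega

lemma natDegree_symbolOp_pow_le (θ : Derivation ℝ K K) {b : K[X]} {n : ℕ} (h : b.natDegree ≤ n)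
    (i : ℕ) : ((symbolOp θ ^ i) b).natDegree ≤ n + i := by
  induction i with
  | zero => simpa using h
  | succ i ih =>
    rw [pow_succ', Module.End.mul_apply]
    exact natDegree_symbolOp_le θ ih

section evstar

variable {W : Type*} [AddCommGroup W] [Module ℝ W] [Module K W]

lemma ev_symbolOp (θ : Derivation ℝ K K) (Δ : Module.End ℝ W)
    (hΔ : ∀ (c : K) (w : W), Δ (c • w) = c • Δ w + θ c • w) (b : K[X]) (w : W) :
    ev Δ (symbolOp θ b) w = Δ (ev Δ b w) := by
  induction b using Polynomial.induction_on' with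
  | add p q hp hq => simp [map_add, hp, hq]
  | monomial i c =>
    rw [symbolOp_apply, coeffDer_monomial, X_mul_monomial, map_add, Pi.add_apply, ev_monomial,
      ev_monomial, ev_monomial, hΔ, pow_succ', Module.End.mul_apply, add_comm]

lemma ev_star (θ : Derivation ℝ K K) (Δ : Module.End ℝ W)
    (hΔ : ∀ (c : K) (w : W), Δ (c • w) = c • Δ w + θ c • w) (a b : K[X]) (w : W) :
    ev Δ (star θ a b) w = ev Δ a (ev Δ b w) := by
  have key : ∀ i, ev Δ ((symbolOp θ ^ i) b) w = (Δ ^ i) (ev Δ b w) := by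
    intro i
    induction i with
    | zero => simp
    | succ i ih =>
      rw [pow_succ', pow_succ', Module.End.mul_apply, Module.End.mul_apply, ev_symbolOp θ Δ hΔ, ih]
  rw [star]
  induction a using Polynomial.induction_on' with
  | add p q hp hq => simp [map_add, hp, hq]
  | monomial i c =>
    rw [ev_monomial, ev_monomial, map_smul, Pi.smul_apply, key]

end evstar

/-! ### Operators acting on formal exponentials -/

variable (θ : Derivation ℝ K K) (P : K[X])

/-- The operator `z θ + P` on polynomials in `z`: this is `z θ` conjugated by a formal
exponential. -/
def expOp : Module.End ℝ K[X] :=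
  LinearMap.mulLeft ℝ X * (coeffDer θ : K[X] →ₗ[ℝ] K[X]) + LinearMap.mulLeft ℝ P

lemma expOp_apply (h : K[X]) : expOp θ P h = X * coeffDer θ h + P * h := rfl

lemma expOp_pow_succ (i : ℕ) (h : K[X]) :
    (expOp θ P ^ (i + 1)) h = X * coeffDer θ ((expOp θ P ^ i) h) + P * (expOp θ P ^ i) h := by
  rw [pow_succ', Module.End.mul_apply, expOp_apply]

/-- The homogenization `∑ i ≤ N, a i z ^ (N - i) (z θ + P) ^ i`. -/
def hom (N : ℕ) (a : K[X]) (h : K[X]) : K[X] :=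
  ∑ i ∈ Finset.range (N + 1), C (a.coeff i) * X ^ (N - i) * (expOp θ P ^ i) h

lemma hom_add_left (N : ℕ) (a b h : K[X]) :
    hom θ P N (a + b) h = hom θ P N a h + hom θ P N b h := by
  simp [hom, add_mul, Finset.sum_add_distrib]

lemma hom_sub_left (N : ℕ) (a b h : K[X]) :
    hom θ P N (a - b) h = hom θ P N a h - hom θ P N b h := by
  simp [hom, sub_mul, Finset.sum_sub_distrib]

lemma hom_add_right (N : ℕ) (a h g : K[X]) :
    hom θ P N a (h + g) = hom θ P N a h + hom θ P N a g := by
  simp [hom, mul_add, Finset.sum_add_distrib]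

lemma hom_C_mul_left (N : ℕ) (c : K) (a h : K[X]) :
    hom θ P N (C c * a) h = C c * hom θ P N a h := by
  simp [hom, Finset.mul_sum, mul_assoc]

lemma expOp_X_pow_mul (j : ℕ) (h : K[X]) : expOp θ P (X ^ j * h) = X ^ j * expOp θ P h := by
  simp only [expOp_apply, Derivation.leibniz, coeffDer_X_pow, smul_eq_mul, mul_zero, add_zero]
  ring

lemma expOp_pow_X_pow_mul (i j : ℕ) (h : K[X]) :
    (expOp θ P ^ i) (X ^ j * h) = X ^ j * (expOp θ P ^ i) h := by
  induction i with
  | zero => simp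
  | succ i ih => rw [pow_succ', Module.End.mul_apply, ih, expOp_X_pow_mul, Module.End.mul_apply]

lemma hom_X_pow_mul (N j : ℕ) (a h : K[X]) :
    hom θ P N a (X ^ j * h) = X ^ j * hom θ P N a h := by
  simp only [hom, expOp_pow_X_pow_mul, Finset.mul_sum]
  exact Finset.sum_congr rfl fun _ _ => by ring

/-- The degree bound is what makes the truncated exponents N - i harmless: every coefficient that
could be affected is zero. -/
lemma hom_add_degree {N : ℕ} (M : ℕ) {a : K[X]} (ha : a.natDegree ≤ N) (h : K[X]) :
    hom θ P (N + M) a h = X ^ M * hom θ P N a h := by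
  rw [hom, hom, Finset.mul_sum]
  symm
  refine Finset.sum_subset_zero_on_sdiff (Finset.range_mono (by omega)) ?_ ?_
  · intro i hi
    have : N < i := by simp at hi; omega
    rw [coeff_eq_zero_of_natDegree_lt (by omega)]
    simp
  · intro i hi
    have : i ≤ N := by simp at hi; omega
    rw [show N + M - i = M + (N - i) by omega, pow_add]
    ring

lemma hom_monomial {N i : ℕ} (hi : i ≤ N) (c : K) (h : K[X]) :
    hom θ P N (monomial i c) h = C c * X ^ (N - i) * (expOp θ P ^ i) h := by
  rw [hom, Finset.sum_eq_single i]
  · simp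
  · intro j _ hj
    simp [coeff_monomial, Ne.symm hj]
  · intro h'
    simp at h'
    omega

lemma hom_sum {ι : Type*} (s : Finset ι) (N : ℕ) (a : ι → K[X]) (h : K[X]) :
    hom θ P N (∑ i ∈ s, a i) h = ∑ i ∈ s, hom θ P N (a i) h := by
  classical
  induction s using Finset.induction_on with
  | empty => simp [hom]
  | insert i s hi ih => rw [Finset.sum_insert hi, Finset.sum_insert hi, hom_add_left, ih]

lemma hom_symbolOp {M : ℕ} {b : K[X]} (hb : b.natDegree ≤ M) (h : K[X]) :
    hom θ P (M + 1) (symbolOp θ b) h = expOp θ P (hom θ P M b h) := by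
  conv_lhs => rw [as_sum_range' b (M + 1) (by omega)]
  rw [map_sum, hom_sum, hom, map_sum]
  refine Finset.sum_congr rfl fun i hi => ?_
  have hi : i ≤ M := by simp at hi; omega
  rw [symbolOp_apply, coeffDer_monomial, X_mul_monomial, hom_add_left,
    hom_monomial _ _ (by omega), hom_monomial _ _ (by omega), expOp_pow_succ]
  simp only [expOp_apply, Derivation.leibniz, coeffDer_X_pow, coeffDer_C, smul_eq_mul, mul_zero]
  rw [show M + 1 - i = M - i + 1 by omega, show M + 1 - (i + 1) = M - i by omega]
  ring

/-- `hom` is z^N times the operator conjugated by a formal exponential with logarithmic derivative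
P/z. Conjugation respects composition, and the degree bounds let the powers of z add. -/
lemma hom_star {M N : ℕ} {a b : K[X]} (ha : a.natDegree ≤ N) (hb : b.natDegree ≤ M) (h : K[X]) :
    hom θ P (N + M) (star θ a b) h = hom θ P N a (hom θ P M b h) := by
  have key : ∀ i, hom θ P (M + i) ((symbolOp θ ^ i) b) h = (expOp θ P ^ i) (hom θ P M b h) := by
    intro i
    induction i with
    | zero => simp
    | succ i ih =>
      rw [pow_succ', pow_succ', Module.End.mul_apply, Module.End.mul_apply, ← add_assoc,
        hom_symbolOp θ P (natDegree_symbolOp_pow_le θ hb i), ih]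
  rw [star, ev_eq_sum _ ha, hom_sum, hom]
  refine Finset.sum_congr rfl fun i hi => ?_
  have hi : i ≤ N := by simp at hi; omega
  rw [smul_eq_C_mul, hom_C_mul_left, show N + M = (M + i) + (N - i) by omega,
    hom_add_degree _ _ _ (natDegree_symbolOp_pow_le θ hb i), key]
  ring

/-- The commutator of an operator with the multiplication by `h`, applied to `1`. -/
def comm (N : ℕ) (a h : K[X]) : K[X] := hom θ P N a h - h * hom θ P N a 1

/-- The homogenization of the derivative of the symbol, applied to `1`. -/
def homDeriv (N : ℕ) (a : K[X]) : K[X] :=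
  ∑ i ∈ Finset.range (N + 1),
    -- The truncation of i - 1 at i = 0 does not matter, because of the factor i.
    C (a.coeff i) * X ^ (N - i) * ((i : K[X]) * (expOp θ P ^ (i - 1)) 1)

lemma comm_add (N : ℕ) (a h g : K[X]) :
    comm θ P N a (h + g) = comm θ P N a h + comm θ P N a g := by
  simp only [comm, hom_add_right]
  ring

lemma comm_X_pow_mul (N j : ℕ) (a h : K[X]) :
    comm θ P N a (X ^ j * h) = X ^ j * comm θ P N a h := by
  simp only [comm, hom_X_pow_mul]
  ring

/-- Moving h to the left through i factors zθ + P yields one term with a single derivative of h for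
each factor, and every further term carries z^2 and at least a second derivative of h. Hence the
remainder is exactly zero when h is affine along θ. -/
lemma expOp_pow_commutator (h : K[X]) (i : ℕ) :
    ∃ g, (coeffDer θ (coeffDer θ h) = 0 → g = 0) ∧
    (expOp θ P ^ i) h = h * (expOp θ P ^ i) 1 +
      X * coeffDer θ h * ((i : K[X]) * (expOp θ P ^ (i - 1)) 1) + X ^ 2 * g := by
  induction i with
  | zero => exact ⟨0, by simp⟩
  | succ i ih =>
    obtain ⟨g, hg, e⟩ := ih
    refine ⟨expOp θ P g + coeffDer θ (coeffDer θ h) * ((i : K[X]) * (expOp θ P ^ (i - 1)) 1),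
      fun h0 => by simp [hg h0, h0], ?_⟩
    rw [expOp_pow_succ, e, expOp_pow_succ θ P i 1, expOp_apply]
    have hi : (i : K[X]) * (X * coeffDer θ ((expOp θ P ^ (i - 1)) 1) +
        P * (expOp θ P ^ (i - 1)) 1) = (i : K[X]) * (expOp θ P ^ i) 1 := by
      cases i with
      | zero => simp
      | succ i => rw [expOp_pow_succ θ P i 1]; simp
    simp only [map_add, Derivation.leibniz, coeffDer_X_pow, coeffDer_X, smul_eq_mul, mul_zero,
      Derivation.map_natCast, add_zero, Nat.add_sub_cancel]
    push_cast
    linear_combination (X * coeffDer θ h) * hi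

lemma comm_eq (N : ℕ) (a h : K[X]) :
    ∃ g, (coeffDer θ (coeffDer θ h) = 0 → g = 0) ∧
    comm θ P N a h = X * coeffDer θ h * homDeriv θ P N a + X ^ 2 * g := by
  choose g hg e using expOp_pow_commutator θ P h
  refine ⟨∑ i ∈ Finset.range (N + 1), C (a.coeff i) * X ^ (N - i) * g i,
    fun h0 => by simp [hg _ h0], ?_⟩
  simp only [comm, hom, homDeriv, Finset.mul_sum, ← Finset.sum_add_distrib,
    ← Finset.sum_sub_distrib]
  refine Finset.sum_congr rfl fun i _ => ?_
  rw [e i]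
  ring

set_option linter.unusedSectionVars false in
lemma exists_low_high (h : K[X]) (j : ℕ) : ∃ p q, h = p + X ^ j * q ∧
    (∀ i, j ≤ i → p.coeff i = 0) ∧ (∀ i < j, p.coeff i = h.coeff i) := by
  refine ⟨h %ₘ (X ^ j), h /ₘ (X ^ j), (modByMonic_add_div h (X ^ j)).symm, ?_, ?_⟩
  · intro i hi
    rcases subsingleton_or_nontrivial K with hs | hn
    · exact Subsingleton.elim _ _
    · refine coeff_eq_zero_of_degree_lt ((degree_modByMonic_lt h (monic_X_pow j)).trans_le ?_)
      rw [degree_X_pow]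
      exact_mod_cast hi
  · intro i hi
    have := congrArg (fun p => coeff p i) (modByMonic_add_div h (X ^ j))
    simp only [coeff_add, coeff_X_pow_mul', if_neg (not_le.2 hi), add_zero] at this
    exact this

/-- Up to the order at which the coefficients of `h` cease to be affine along `θ`, the commutator
is given by the derivative of the symbol. -/
lemma coeff_comm (N : ℕ) (a h : K[X]) (j : ℕ) (hj : ∀ i < j, θ (θ (h.coeff i)) = 0) (i : ℕ)
    (hi : i ≤ j + 1) :
    (comm θ P N a h).coeff i = (X * coeffDer θ h * homDeriv θ P N a).coeff i := by
  -- The low part p is affine along θ, so its remainder vanishes identically; the high part carries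
  -- X^j, so its remainder starts at order j + 2.
  obtain ⟨p, q, e, hp, hp'⟩ := exists_low_high h j
  obtain ⟨g, hg, eg⟩ := comm_eq θ P N a p
  obtain ⟨g', -, eg'⟩ := comm_eq θ P N a q
  have hg0 : g = 0 := by
    refine hg ?_
    ext r
    rw [coeff_coeffDer, coeff_coeffDer]
    by_cases hr : r < j
    · rw [hp' r hr, hj r hr, coeff_zero]
    · rw [hp r (by omega)]; simp
  have : comm θ P N a h = X * coeffDer θ h * homDeriv θ P N a + X ^ (j + 2) * g' := by
    rw [e, comm_add, comm_X_pow_mul, eg, eg', hg0]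
    simp only [map_add, Derivation.leibniz, coeffDer_X_pow, smul_eq_mul, mul_zero]
    ring
  rw [this, coeff_add, coeff_X_pow_mul', if_neg (by omega), add_zero]

/-! ### The Riccati equation -/

lemma expOp_pow_coeff_zero (i : ℕ) : ((expOp θ P ^ i) 1).coeff 0 = P.coeff 0 ^ i := by
  induction i with
  | zero => simp
  | succ i ih => rw [expOp_pow_succ]; simp [ih, pow_succ']

/-- To order z^J only the value at z = 0 of the other factors is felt, since θ always comes with an
extra z. The change is therefore that of the commutative power P^i. -/
lemma expOp_pow_perturb (Q : K[X]) (J : ℕ) (hJ : 1 ≤ J) (y : K) (hQ : Q = P + X ^ J * C y)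
    (i : ℕ) : ∃ g, (expOp θ Q ^ i) 1 =
      (expOp θ P ^ i) 1 + X ^ J * C ((i : K) * y * P.coeff 0 ^ (i - 1)) + X ^ (J + 1) * g := by
  have hX : ∀ p : K[X], ∃ g, p = C (p.coeff 0) + X * g := fun p =>
    ⟨p.divX, by rw [add_comm, mul_comm]; exact (divX_mul_X_add p).symm⟩
  induction i with
  | zero => exact ⟨0, by simp⟩
  | succ i ih =>
    obtain ⟨g, e⟩ := ih
    obtain ⟨a, ha⟩ := hX P
    obtain ⟨b, hb⟩ := hX ((expOp θ P ^ i) 1)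
    rw [expOp_pow_coeff_zero] at hb
    set c := P.coeff 0 with hc
    have hi : ((i + 1 : ℕ) : K) * y * c ^ (i + 1 - 1) = y * c ^ i + c * (i * y * c ^ (i - 1)) := by
      cases i with
      | zero => simp
      | succ i => rw [Nat.add_sub_cancel, Nat.add_sub_cancel]; push_cast; ring
    obtain ⟨s, rfl⟩ := Nat.exists_eq_add_of_le' hJ
    refine ⟨C (θ ((i : K) * y * c ^ (i - 1))) + X * coeffDer θ g + C y * b
      + a * C ((i : K) * y * c ^ (i - 1)) + Q * g + X ^ s * C y * C ((i : K) * y * c ^ (i - 1)), ?_⟩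
    rw [expOp_pow_succ, expOp_pow_succ, e, hi]
    simp only [map_add, Derivation.leibniz, coeffDer_X_pow, coeffDer_C, smul_eq_mul, mul_zero,
      add_zero]
    have h1 : Q * ((expOp θ P ^ i) 1 + X ^ (s + 1) * C ((i : K) * y * c ^ (i - 1))
        + X ^ (s + 1 + 1) * g) = P * (expOp θ P ^ i) 1 + X ^ (s + 1) * C y * (C (c ^ i) + X * b) +
        (C c + X * a) * X ^ (s + 1) * C ((i : K) * y * c ^ (i - 1)) +
        X ^ (s + 1) * C y * X ^ (s + 1) * C ((i : K) * y * c ^ (i - 1))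
        + Q * X ^ (s + 1 + 1) * g := by
      rw [← hb, ← ha, hQ]
      ring
    rw [h1]
    simp only [C_mul, C_pow]
    ring

/-- The formal eigenfunction of L with eigenvalue ε z^(-6) is found order by order. By
`expOp_pow_perturb`, each correction y solves a linear equation with coefficient 6 l₆ ρ^5, which is
a unit. -/
lemma exists_riccati {l : K[X]} {ρ ε : K} (hl : IsUnit (l.coeff 6)) (hρ : IsUnit ρ)
    (hε : l.coeff 6 * ρ ^ 6 = ε) (J : ℕ) (hJ : 1 ≤ J) :
    ∃ P g : K[X], P.coeff 0 = ρ ∧ hom θ P 6 l 1 = C ε + X ^ J * g := by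
  induction J, hJ using Nat.le_induction with
  | base =>
    refine ⟨C ρ, (hom θ (C ρ) 6 l 1).divX, by simp, ?_⟩
    have : (hom θ (C ρ) 6 l 1).coeff 0 = ε := by
      simp only [hom, finsetSum_coeff, mul_assoc, coeff_C_mul]
      rw [Finset.sum_eq_single 6]
      · rw [← hε]; simp [expOp_pow_coeff_zero]
      · intro i hi h6
        have : 1 ≤ 6 - i := by simp at hi; omega
        rw [coeff_X_pow_mul', if_neg (by omega), mul_zero]
      · simp
    rw [← this, pow_one, mul_comm, add_comm]
    exact (divX_mul_X_add _).symm
  | succ J hJ ih =>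
    obtain ⟨P, g, hP, e⟩ := ih
    obtain ⟨u, hu⟩ := hl
    obtain ⟨v, hv⟩ := hρ
    obtain ⟨y, hy⟩ : ∃ y, 6 * l.coeff 6 * ρ ^ 5 * y = - g.coeff 0 := by
      refine ⟨algebraMap ℝ K (1 / 6) * (↑u⁻¹ * ↑v⁻¹ ^ 5 * (- g.coeff 0)), ?_⟩
      have h6 : (6 : K) * algebraMap ℝ K (1 / 6) = 1 := by
        rw [← map_ofNat (algebraMap ℝ K) 6, ← map_mul]; norm_num
      have h1 : l.coeff 6 * ↑u⁻¹ = 1 := by rw [← hu]; simp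
      have h2 : ρ * ↑v⁻¹ = 1 := by rw [← hv]; simp
      calc _ = (6 * algebraMap ℝ K (1 / 6)) * (l.coeff 6 * ↑u⁻¹) * (ρ * ↑v⁻¹) ^ 5
            * (- g.coeff 0) := by ring
        _ = _ := by rw [h6, h1, h2]; ring
    choose G hG using expOp_pow_perturb θ P (P + X ^ J * C y) J hJ y rfl
    have h0 : hom θ (P + X ^ J * C y) 6 l 1 = hom θ P 6 l 1 + X ^ J *
        ∑ i ∈ Finset.range 7, C (l.coeff i) * X ^ (6 - i) * (C ((i : K) * y * P.coeff 0 ^ (i - 1)) +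
          X * G i) := by
      simp only [hom, Finset.mul_sum, ← Finset.sum_add_distrib]
      refine Finset.sum_congr rfl fun i _ => ?_
      rw [hG i]
      ring
    rw [Finset.sum_range_succ, e] at h0
    have h1 : ∃ s, ∑ i ∈ Finset.range 6, C (l.coeff i) * X ^ (6 - i) *
        (C ((i : K) * y * P.coeff 0 ^ (i - 1)) + X * G i) = X * s := by
      refine Finset.dvd_sum fun i hi => ?_
      obtain ⟨r, hr⟩ : ∃ r, 6 - i = r + 1 := ⟨5 - i, by simp at hi; omega⟩
      rw [hr, pow_succ]
      exact ⟨C (l.coeff i) * X ^ r * (C ((i : K) * y * P.coeff 0 ^ (i - 1)) + X * G i), by ring⟩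
    obtain ⟨s, hs⟩ := h1
    refine ⟨P + X ^ J * C y, g.divX + s + C (l.coeff 6) * G 6, ?_, ?_⟩
    · simp [hP, coeff_X_pow, show (0 : ℕ) ≠ J by omega]
    · have hg : g = g.divX * X + C (g.coeff 0) := (divX_mul_X_add g).symm
      have h3 : C (l.coeff 6) * C (((6 : ℕ) : K) * y * P.coeff 0 ^ (6 - 1)) = - C (g.coeff 0) := by
        rw [← C_mul, ← C_neg, ← hy, hP]
        congr 1
        push_cast
        ring
      rw [h0, hs]
      simp only [Nat.sub_self, pow_zero, mul_one]
      conv_lhs => rw [hg]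
      rw [mul_add (C (l.coeff 6)), h3]
      ring

/-! ### Consequences of the zero curvature equation -/

variable {θ} {dt dQ : Derivation ℝ K K} {l m : K[X]} {n : ℕ}

lemma isUnit_natCast (r : ℕ) (hr : r ≠ 0) : IsUnit (r : K) := by
  have h : IsUnit (algebraMap ℝ K (r : ℝ)) := (IsUnit.mk0 (r : ℝ) (by exact_mod_cast hr)).map _
  simpa using h

/-- The zero curvature equation, in terms of the formal exponential solutions. -/
lemma exists_expansion (hl : l.natDegree ≤ 6) (hm : m.natDegree ≤ n)
    (hZ : coeffDer dt m - coeffDer dQ l + star θ m l - star θ l m = 0)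
    {ρ ε : K} (hl6 : IsUnit (l.coeff 6)) (hρ : IsUnit ρ) (hε : l.coeff 6 * ρ ^ 6 = ε)
    (hθε : θ ε = 0) :
    ∃ P g : K[X], P.coeff 0 = ρ ∧ (∀ i < 9, (hom θ P 6 l 1).coeff i = (C ε).coeff i) ∧
      comm θ P 6 l (hom θ P n m 1) = X ^ 6 * hom θ P n (coeffDer dt m) 1 -
        X ^ n * hom θ P 6 (coeffDer dQ l) 1 + X ^ 9 * g := by
  -- Nine orders suffice: the largest index read off later is 8.
  obtain ⟨P, g, hP, e⟩ := exists_riccati θ hl6 hρ hε 9 (by norm_num)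
  refine ⟨P, comm θ P n m g, hP, fun i hi => ?_, ?_⟩
  · rw [e, coeff_add, coeff_X_pow_mul', if_neg (by omega), add_zero]
  have h := congrArg (fun a => hom θ P (n + 6) a 1) hZ
  simp only [hom_sub_left, hom_add_left] at h
  rw [hom_star θ P hm hl, add_comm n 6, hom_star θ P hl hm,
    hom_add_degree θ P n (natDegree_coeffDer_le dQ hl), add_comm 6 n,
    hom_add_degree θ P 6 (natDegree_coeffDer_le dt hm)] at h
  have h0 : hom θ P (n + 6) (0 : K[X]) 1 = 0 := by simp [hom]
  -- The eigenvalue is constant along θ, so M commutes with multiplication by it.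
  have h1 : comm θ P n m (C ε) = 0 := by
    obtain ⟨g, hg, e⟩ := comm_eq θ P n m (C ε)
    rw [e, hg (by simp [hθε])]
    simp [hθε]
  have h2 : hom θ P n m (hom θ P 6 l 1) =
      hom θ P 6 l 1 * hom θ P n m 1 + X ^ 9 * comm θ P n m g := by
    have : comm θ P n m (hom θ P 6 l 1) = X ^ 9 * comm θ P n m g := by
      rw [e, comm_add, h1, comm_X_pow_mul, zero_add]
    rw [← this, comm]
    ring
  rw [h2, h0] at h
  rw [comm]
  linear_combination -h

lemma hom_coeff_zero (P : K[X]) (N : ℕ) (a : K[X]) :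
    (hom θ P N a 1).coeff 0 = a.coeff N * P.coeff 0 ^ N := by
  simp only [hom, finsetSum_coeff, mul_assoc, coeff_C_mul]
  rw [Finset.sum_eq_single N]
  · simp [expOp_pow_coeff_zero]
  · intro i hi h6
    have : 1 ≤ N - i := by simp at hi; omega
    rw [coeff_X_pow_mul', if_neg (by omega), mul_zero]
  · simp

lemma homDeriv_coeff_zero (P : K[X]) (N : ℕ) (a : K[X]) :
    (homDeriv θ P N a).coeff 0 = N * a.coeff N * P.coeff 0 ^ (N - 1) := by
  simp only [homDeriv, finsetSum_coeff, mul_assoc, coeff_C_mul]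
  rw [Finset.sum_eq_single N]
  · have : ((N : K[X]) * (expOp θ P ^ (N - 1)) 1).coeff 0 = N * P.coeff 0 ^ (N - 1) := by
      rw [mul_coeff_zero, expOp_pow_coeff_zero, natCast_coeff_zero]
    simp only [Nat.sub_self, pow_zero, one_mul, this]
    ring
  · intro i hi h6
    have : 1 ≤ N - i := by simp at hi; omega
    rw [coeff_X_pow_mul', if_neg (by omega), mul_zero]
  · simp

lemma coeff_X_mul_coeffDer_mul (h H : K[X]) (j : ℕ) :
    (X * coeffDer θ h * H).coeff (j + 1) =
      ∑ i ∈ Finset.range (j + 1), θ (h.coeff i) * H.coeff (j - i) := by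
  rw [mul_assoc, coeff_X_mul, coeff_mul, Finset.Nat.sum_antidiagonal_eq_sum_range_succ_mk]
  rfl

/-- If the first coefficients of the expansion satisfy the equation with vanishing right-hand side,
they are constant. -/
lemma coeff_const_of_comm {P h : K[X]} (hH : IsUnit ((homDeriv θ P 6 l).coeff 0)) (N : ℕ)
    (hc : ∀ j < N, (comm θ P 6 l h).coeff (j + 1) = 0) : ∀ i < N, θ (h.coeff i) = 0 := by
  intro i
  induction i using Nat.strong_induction_on with
  | _ i ih =>
    intro hi
    have h1 := coeff_comm θ P 6 l h i (fun r hr => by rw [ih r hr (hr.trans hi), map_zero])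
      (i + 1) le_rfl
    rw [hc i hi, coeff_X_mul_coeffDer_mul, Finset.sum_range_succ, Finset.sum_eq_zero, zero_add,
      Nat.sub_self] at h1
    · exact (hH.mul_left_eq_zero).1 h1.symm
    · intro r hr
      rw [Finset.mem_range] at hr
      rw [ih r hr (hr.trans hi), zero_mul]

-- Here n ≥ 7 is decisive: the unknown term with the Q-derivative of L carries z^n and cannot reach
-- the coefficients of index at most 6.
set_option linter.unusedSectionVars false in
lemma coeff_shift (a b g : K[X]) (hn : 7 ≤ n) (j : ℕ) (hj : j < 7) :
    (X ^ 6 * a - X ^ n * b + X ^ 9 * g).coeff j = if 6 ≤ j then a.coeff (j - 6) else 0 := by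
  rw [coeff_add, coeff_sub, coeff_X_pow_mul', coeff_X_pow_mul', coeff_X_pow_mul',
    if_neg (show ¬ n ≤ j by omega), if_neg (show ¬ 9 ≤ j by omega)]
  simp

/-- The density `ρ = l₆ ^ (-1/6)` is conserved up to a factor depending on `t`. -/
theorem conserved_leading (hn : 7 ≤ n) (hl : l.natDegree ≤ 6) (hm : m.natDegree ≤ n)
    (hZ : coeffDer dt m - coeffDer dQ l + star θ m l - star θ l m = 0)
    {ρ ε : K} (hl6 : IsUnit (l.coeff 6)) (hmn : IsUnit (m.coeff n)) (hρ : IsUnit ρ)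
    (hε : l.coeff 6 * ρ ^ 6 = ε) (hθε : θ ε = 0) :
    ∃ c w, IsUnit c ∧ θ c = 0 ∧ 6 * ε * θ w = ρ * dt c - n * c * dt ρ := by
  obtain ⟨P, g, hP, -, e⟩ := exists_expansion hl hm hZ hl6 hρ hε hθε
  set μ := hom θ P n m 1 with hμ
  have hH0 : (homDeriv θ P 6 l).coeff 0 = 6 * l.coeff 6 * ρ ^ 5 := by
    rw [homDeriv_coeff_zero, hP]; norm_num
  have hH : IsUnit ((homDeriv θ P 6 l).coeff 0) := by
    rw [hH0]
    exact ((isUnit_natCast 6 (by norm_num)).mul hl6).mul (hρ.pow 5)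
  have hconst := coeff_const_of_comm (h := μ) hH 5 fun j hj => by
    rw [e, coeff_shift _ _ _ hn _ (by omega), if_neg (by omega)]
  have h0 : μ.coeff 0 = m.coeff n * ρ ^ n := by rw [hμ, hom_coeff_zero, hP]
  -- The coefficients 0, …, 4 of μ are constant. The first nontrivial relation, at index 6, equates
  -- a multiple of the θ-derivative of the coefficient 5 with the time derivative of the leading
  -- coefficient of M.
  refine ⟨m.coeff n * ρ ^ n, μ.coeff 5, hmn.mul (hρ.pow n), ?_, ?_⟩
  · rw [← h0]; exact hconst 0 (by norm_num)
  have h1 := coeff_comm θ P 6 l μ 5 (fun i hi => by rw [hconst i hi, map_zero]) 6 le_rfl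
  rw [e, coeff_shift _ _ _ hn _ (by omega), if_pos (by omega), coeff_X_mul_coeffDer_mul,
    Finset.sum_range_succ, Finset.sum_eq_zero (fun i hi => by
      rw [hconst i (Finset.mem_range.1 hi), zero_mul]), zero_add, Nat.sub_self, hom_coeff_zero,
    hP, hH0, coeff_coeffDer] at h1
  obtain ⟨s, rfl⟩ : ∃ s, n = s + 1 := ⟨n - 1, by omega⟩
  have h2 : dt (m.coeff (s + 1) * ρ ^ (s + 1)) =
      dt (m.coeff (s + 1)) * ρ ^ (s + 1) + m.coeff (s + 1) * ((s + 1 : ℕ) * ρ ^ s * dt ρ) := by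
    rw [Derivation.leibniz, Derivation.leibniz_pow]
    simp only [smul_eq_mul, nsmul_eq_mul, Nat.add_sub_cancel]
    ring
  rw [h2, ← hε]
  linear_combination (-ρ) * h1

lemma expOp_pow_coeff_one {P : K[X]} (hP : P.coeff 0 = 1) (i : ℕ) :
    ((expOp θ P ^ i) 1).coeff 1 = i * P.coeff 1 := by
  induction i with
  | zero => simp [coeff_one]
  | succ i ih =>
    rw [expOp_pow_succ, coeff_add, show (1 : ℕ) = 0 + 1 by rfl, coeff_X_mul, coeff_coeffDer,
      coeff_mul, expOp_pow_coeff_zero, hP]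
    simp only [Finset.Nat.antidiagonal_succ, Finset.Nat.antidiagonal_zero]
    simp [ih, expOp_pow_coeff_zero, hP]
    ring

lemma expOp_pow_coeff_two {P : K[X]} (hP : P.coeff 0 = 1) (hP1 : P.coeff 1 = 0) (i : ℕ) :
    ((expOp θ P ^ i) 1).coeff 2 = i * P.coeff 2 := by
  induction i with
  | zero => simp [coeff_one]
  | succ i ih =>
    have h1 := expOp_pow_coeff_one (θ := θ) hP i
    rw [hP1, mul_zero] at h1
    rw [expOp_pow_succ, coeff_add, show (2 : ℕ) = 1 + 1 by rfl, coeff_X_mul, coeff_coeffDer,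
      coeff_mul, h1]
    simp only [Finset.Nat.antidiagonal_succ, Finset.Nat.antidiagonal_zero]
    simp [ih, expOp_pow_coeff_zero, hP, h1, hP1]
    ring

lemma hom_coeff_one {P : K[X]} (hP : P.coeff 0 = 1) (N : ℕ) (a : K[X]) :
    (hom θ P (N + 2) a 1).coeff 1 = a.coeff (N + 2) * ((N + 2 : ℕ) * P.coeff 1) +
      a.coeff (N + 1) := by
  have hz : ∀ i ∈ Finset.range (N + 1), C (a.coeff i) * X ^ (N + 2 - i) * (expOp θ P ^ i) 1 =
      X ^ 2 * (C (a.coeff i) * X ^ (N - i) * (expOp θ P ^ i) 1) := fun i hi => by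
    have : i ≤ N := by simp at hi; omega
    rw [show N + 2 - i = 2 + (N - i) by omega, pow_add]
    ring
  rw [hom, Finset.sum_range_succ, Finset.sum_range_succ, Finset.sum_congr rfl hz,
    ← Finset.mul_sum, coeff_add, coeff_add, coeff_X_pow_mul', if_neg (by omega), Nat.sub_self,
    show N + 2 - (N + 1) = 1 by omega, pow_zero, pow_one, mul_one, coeff_C_mul,
    expOp_pow_coeff_one hP, mul_assoc, coeff_C_mul, coeff_X_mul, expOp_pow_coeff_zero, hP]
  simp
  ring

lemma hom_coeff_two {P : K[X]} (hP : P.coeff 0 = 1) (hP1 : P.coeff 1 = 0) (N : ℕ) (a : K[X]) :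
    (hom θ P (N + 3) a 1).coeff 2 = a.coeff (N + 3) * ((N + 3 : ℕ) * P.coeff 2) +
      a.coeff (N + 1) := by
  have hz : ∀ i ∈ Finset.range (N + 1), C (a.coeff i) * X ^ (N + 3 - i) * (expOp θ P ^ i) 1 =
      X ^ 3 * (C (a.coeff i) * X ^ (N - i) * (expOp θ P ^ i) 1) := fun i hi => by
    have : i ≤ N := by simp at hi; omega
    rw [show N + 3 - i = 3 + (N - i) by omega, pow_add]
    ring
  rw [hom, Finset.sum_range_succ, Finset.sum_range_succ, Finset.sum_range_succ,
    Finset.sum_congr rfl hz,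
    ← Finset.mul_sum, coeff_add, coeff_add, coeff_add, coeff_X_pow_mul', if_neg (by omega),
    Nat.sub_self,
    show N + 3 - (N + 1) = 2 by omega, show N + 3 - (N + 2) = 1 by omega, pow_zero, pow_one,
    mul_one, coeff_C_mul, expOp_pow_coeff_two hP hP1, mul_assoc, coeff_C_mul, mul_assoc,
    coeff_C_mul, coeff_X_pow_mul', if_pos le_rfl, coeff_X_mul, expOp_pow_coeff_one hP, hP1]
  simp [expOp_pow_coeff_zero, hP]
  ring

/-- The derivative of the symbol is itself a symbol, of degree five, so the formulas for the
coefficients of `hom` apply to it. -/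
lemma homDeriv_eq_hom (P : K[X]) (a : K[X]) : homDeriv θ P 6 a =
    hom θ P 5 (∑ i ∈ Finset.range 6, monomial i ((i + 1 : ℕ) * a.coeff (i + 1))) 1 := by
  simp [homDeriv, hom, Finset.sum_range_succ, coeff_monomial]
  simp only [map_ofNat]
  ring

lemma homDeriv_coeff_one {P : K[X]} (hP : P.coeff 0 = 1) (a : K[X]) :
    (homDeriv θ P 6 a).coeff 1 = 30 * a.coeff 6 * P.coeff 1 + 5 * a.coeff 5 := by
  rw [homDeriv_eq_hom, hom_coeff_one hP]
  simp [Finset.sum_range_succ, coeff_monomial]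
  ring

lemma homDeriv_coeff_two {P : K[X]} (hP : P.coeff 0 = 1) (hP1 : P.coeff 1 = 0) (a : K[X]) :
    (homDeriv θ P 6 a).coeff 2 = 30 * a.coeff 6 * P.coeff 2 + 4 * a.coeff 4 := by
  rw [homDeriv_eq_hom, hom_coeff_two hP hP1]
  simp [Finset.sum_range_succ, coeff_monomial]
  ring

/-- If `l₆` is constant, then `l₅` is conserved up to constants. -/
theorem conserved_second (hn : 7 ≤ n) (hl : l.natDegree ≤ 6) (hm : m.natDegree ≤ n)
    (hZ : coeffDer dt m - coeffDer dQ l + star θ m l - star θ l m = 0)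
    (hcomm : ∀ f, θ (dt f) = dt (θ f))
    (hl6 : IsUnit (l.coeff 6)) (hmn : IsUnit (m.coeff n)) (hθ : θ (l.coeff 6) = 0)
    (hdt : dt (l.coeff 6) = 0) (hdQ : dQ (l.coeff 6) = 0) :
    ∃ c b w, IsUnit c ∧ θ c = 0 ∧ θ b = 0 ∧ c * dt (l.coeff 5) = b + θ w := by
  obtain ⟨P, g, hP, hric, e⟩ := exists_expansion (ρ := 1) hl hm hZ hl6 isUnit_one
    (by rw [one_pow, mul_one] : l.coeff 6 * 1 ^ 6 = l.coeff 6) hθ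
  set μ := hom θ P n m 1 with hμ
  obtain ⟨s, rfl⟩ : ∃ s, n = s + 2 := ⟨n - 2, by omega⟩
  have hH0 : (homDeriv θ P 6 l).coeff 0 = 6 * l.coeff 6 := by
    rw [homDeriv_coeff_zero, hP]; norm_num
  have hH : IsUnit ((homDeriv θ P 6 l).coeff 0) := by
    rw [hH0]
    exact (isUnit_natCast 6 (by norm_num)).mul hl6
  have hconst := coeff_const_of_comm (h := μ) hH 5 fun j hj => by
    rw [e, coeff_shift _ _ _ hn _ (by omega), if_neg (by omega)]
  have hμ0 : μ.coeff 0 = m.coeff (s + 2) := by rw [hμ, hom_coeff_zero, hP]; simp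
  have hμ1 := hom_coeff_one (θ := θ) hP s m
  rw [← hμ] at hμ1
  have hc0 : θ (m.coeff (s + 2)) = 0 := by rw [← hμ0]; exact hconst 0 (by norm_num)
  have h5 := coeff_comm θ P 6 l μ 5 (fun i hi => by rw [hconst i hi, map_zero]) 6 le_rfl
  rw [e, coeff_shift _ _ _ hn _ (by omega), if_pos (by omega), coeff_X_mul_coeffDer_mul,
    Finset.sum_range_succ, Finset.sum_eq_zero (fun i hi => by
      rw [hconst i (Finset.mem_range.1 hi), zero_mul]), zero_add, Nat.sub_self, hom_coeff_zero,
    hP, hH0, coeff_coeffDer, one_pow, mul_one] at h5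
  -- The coefficient 5 need not be constant, but it is affine along θ, because the time derivative
  -- of a constant is constant. This keeps `coeff_comm` applicable one order further.
  have hθθ : θ (θ (μ.coeff 5)) = 0 := by
    have h1 := congrArg θ h5
    have h6 : θ (6 : K) = 0 := by exact_mod_cast θ.map_natCast 6
    rw [hcomm, hc0, map_zero, Derivation.leibniz, Derivation.leibniz, hθ, h6, smul_zero,
      smul_zero, add_zero, smul_zero, zero_add, smul_eq_mul] at h1
    rw [hH0] at hH
    exact (hH.mul_right_eq_zero).1 h1.symm
  have h6 := coeff_comm θ P 6 l μ 6 (fun i hi => by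
    rcases (show i < 5 ∨ i = 5 by omega) with h | rfl
    · rw [hconst i h, map_zero]
    · exact hθθ) 7 le_rfl
  -- The Q-derivative of L reaches index 7 only if n = 7, and then only through the derivative of
  -- the leading coefficient, which is zero.
  have hr : (X ^ (s + 2) * hom θ P 6 (coeffDer dQ l) 1).coeff 7 = 0 := by
    rw [coeff_X_pow_mul']
    split_ifs with h
    · rw [show 7 - (s + 2) = 0 by omega, hom_coeff_zero, coeff_coeffDer, hdQ, zero_mul]
    · rfl
  have hP1 : 6 * l.coeff 6 * P.coeff 1 + l.coeff 5 = 0 := by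
    have h1 := hric 1 (by norm_num)
    rw [hom_coeff_one hP, coeff_C] at h1
    push_cast at h1
    linear_combination h1
  have hP1t : 6 * l.coeff 6 * dt (P.coeff 1) + dt (l.coeff 5) = 0 := by
    have h1 := congrArg dt hP1
    have h6 : dt (6 : K) = 0 := by exact_mod_cast dt.map_natCast 6
    rw [map_add, Derivation.leibniz, Derivation.leibniz, hdt, h6] at h1
    simpa using h1
  rw [e, coeff_add, coeff_sub, hr, coeff_X_pow_mul', if_pos (by omega), coeff_X_pow_mul',
    if_neg (by omega), coeff_X_mul_coeffDer_mul, Finset.sum_range_succ, Finset.sum_range_succ,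
    Finset.sum_eq_zero (fun i hi => by rw [hconst i (Finset.mem_range.1 hi), zero_mul]), zero_add,
    Nat.sub_self, hom_coeff_one hP, hH0, homDeriv_coeff_one hP, coeff_coeffDer, coeff_coeffDer]
    at h6
  have hμ1t := congrArg dt hμ1
  simp only [map_add, Derivation.leibniz, smul_eq_mul, Derivation.map_natCast, mul_zero,
    add_zero] at hμ1t
  obtain ⟨u, hu⟩ := hl6
  have hb : θ (dt (μ.coeff 1)) = 0 := by rw [hcomm, hconst 1 (by norm_num), map_zero]
  -- The Riccati relation 6 l₆ P₁ + l₅ = 0 kills the factor 30 l₆ P₁ + 5 l₅ of θ μ₅. Eliminating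
  -- m_{n-1} through μ₁, which is constant, and P₁ through l₅ leaves the time derivative of l₅.
  refine ⟨(s + 2 : ℕ) * m.coeff (s + 2), -(6 * l.coeff 6 * dt (μ.coeff 1)),
    36 * l.coeff 6 ^ 2 * μ.coeff 6, (isUnit_natCast _ (by omega)).mul hmn, ?_, ?_, ?_⟩
  · rw [Derivation.leibniz, hc0, Derivation.map_natCast, smul_zero, smul_zero, add_zero]
  · have h6 : θ (6 : K) = 0 := by exact_mod_cast θ.map_natCast 6
    simp [Derivation.leibniz, hb, hθ, h6]
  · have h6' : θ (36 : K) = 0 := by exact_mod_cast θ.map_natCast 36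
    have : θ (36 * l.coeff 6 ^ 2 * μ.coeff 6) = 36 * l.coeff 6 ^ 2 * θ (μ.coeff 6) := by
      simp [Derivation.leibniz, Derivation.leibniz_pow, hθ, h6']
    rw [this]
    rw [sub_zero, add_zero] at h6
    linear_combination ((s + 2 : ℕ) : K) * m.coeff (s + 2) * hP1t + 6 * l.coeff 6 * hμ1t
      + 6 * l.coeff 6 * h6 - (30 * l.coeff 6 * P.coeff 1 + 5 * l.coeff 5) * h5
      + 5 * dt (m.coeff (s + 2)) * hP1

/-- If `l₆` is constant and `l₅ = 0`, then `l₄` is conserved up to constants and a constant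
factor. -/
theorem conserved_third (hn : 7 ≤ n) (hl : l.natDegree ≤ 6) (hm : m.natDegree ≤ n)
    (hZ : coeffDer dt m - coeffDer dQ l + star θ m l - star θ l m = 0)
    (hcomm : ∀ f, θ (dt f) = dt (θ f))
    (hl6 : IsUnit (l.coeff 6)) (hmn : IsUnit (m.coeff n)) (hθ : θ (l.coeff 6) = 0)
    (hdt : dt (l.coeff 6) = 0) (hdQ : dQ (l.coeff 6) = 0) (hl5 : l.coeff 5 = 0) :
    ∃ c a b w, IsUnit c ∧ θ c = 0 ∧ θ a = 0 ∧ θ b = 0 ∧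
      c * dt (l.coeff 4) + a * l.coeff 4 = b + θ w := by
  obtain ⟨P, g, hP, hric, e⟩ := exists_expansion (ρ := 1) hl hm hZ hl6 isUnit_one
    (by rw [one_pow, mul_one] : l.coeff 6 * 1 ^ 6 = l.coeff 6) hθ
  set μ := hom θ P n m 1 with hμ
  obtain ⟨s, rfl⟩ : ∃ s, n = s + 3 := ⟨n - 3, by omega⟩
  have hH0 : (homDeriv θ P 6 l).coeff 0 = 6 * l.coeff 6 := by
    rw [homDeriv_coeff_zero, hP]; norm_num
  have hH : IsUnit ((homDeriv θ P 6 l).coeff 0) := by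
    rw [hH0]
    exact (isUnit_natCast 6 (by norm_num)).mul hl6
  have h6θ : θ (6 : K) = 0 := by exact_mod_cast θ.map_natCast 6
  have hunit : IsUnit (6 * l.coeff 6) := hH0 ▸ hH
  have hP1 : P.coeff 1 = 0 := by
    have h1 := hric 1 (by norm_num)
    rw [hom_coeff_one hP, coeff_C, hl5, add_zero, if_neg (by norm_num)] at h1
    push_cast at h1
    refine (hunit.mul_right_eq_zero).1 ?_
    linear_combination h1
  have hconst := coeff_const_of_comm (h := μ) hH 5 fun j hj => by
    rw [e, coeff_shift _ _ _ hn _ (by omega), if_neg (by omega)]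
  have hμ0 : μ.coeff 0 = m.coeff (s + 3) := by rw [hμ, hom_coeff_zero, hP]; simp
  have hμ1 := hom_coeff_one (θ := θ) hP (s + 1) m
  have hμ2 := hom_coeff_two (θ := θ) hP hP1 s m
  rw [hP1, mul_zero, mul_zero, zero_add, ← hμ] at hμ1
  rw [← hμ] at hμ2
  have hc0 : θ (m.coeff (s + 3)) = 0 := by rw [← hμ0]; exact hconst 0 (by norm_num)
  have hc1 : θ (m.coeff (s + 2)) = 0 := by
    rw [show s + 2 = s + 1 + 1 by rfl, ← hμ1]; exact hconst 1 (by norm_num)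
  have h5 := coeff_comm θ P 6 l μ 5 (fun i hi => by rw [hconst i hi, map_zero]) 6 le_rfl
  rw [e, coeff_shift _ _ _ hn _ (by omega), if_pos (by omega), coeff_X_mul_coeffDer_mul,
    Finset.sum_range_succ, Finset.sum_eq_zero (fun i hi => by
      rw [hconst i (Finset.mem_range.1 hi), zero_mul]), zero_add, Nat.sub_self, hom_coeff_zero,
    hP, hH0, coeff_coeffDer, one_pow, mul_one] at h5
  have hθθ : θ (θ (μ.coeff 5)) = 0 := by
    have h1 := congrArg θ h5
    rw [hcomm, hc0, map_zero, Derivation.leibniz, Derivation.leibniz, hθ, h6θ, smul_zero,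
      smul_zero, add_zero, smul_zero, zero_add, smul_eq_mul] at h1
    exact (hunit.mul_right_eq_zero).1 h1.symm
  have h6 := coeff_comm θ P 6 l μ 6 (fun i hi => by
    rcases (show i < 5 ∨ i = 5 by omega) with h | rfl
    · rw [hconst i h, map_zero]
    · exact hθθ) 7 le_rfl
  have hr : (X ^ (s + 3) * hom θ P 6 (coeffDer dQ l) 1).coeff 7 = 0 := by
    rw [coeff_X_pow_mul']
    split_ifs with h
    · rw [show 7 - (s + 3) = 0 by omega, hom_coeff_zero, coeff_coeffDer, hdQ, zero_mul]
    · rfl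
  rw [e, coeff_add, coeff_sub, hr, coeff_X_pow_mul', if_pos (by omega), coeff_X_pow_mul',
    if_neg (by omega), coeff_X_mul_coeffDer_mul, Finset.sum_range_succ, Finset.sum_range_succ,
    Finset.sum_eq_zero (fun i hi => by rw [hconst i (Finset.mem_range.1 hi), zero_mul]), zero_add,
    Nat.sub_self, show (hom θ P (s + 3) (coeffDer dt m) 1).coeff (7 - 6) =
      (hom θ P (s + 1 + 2) (coeffDer dt m) 1).coeff 1 from rfl, hom_coeff_one hP (s + 1), hH0,
    homDeriv_coeff_one hP, coeff_coeffDer, coeff_coeffDer, hP1, hl5] at h6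
  simp only [mul_zero, add_zero, zero_add, sub_zero] at h6
  have hθθ6 : θ (θ (μ.coeff 6)) = 0 := by
    have h1 := congrArg θ h6
    rw [hcomm, show s + 1 + 1 = s + 2 by rfl, hc1, map_zero, Derivation.leibniz,
      Derivation.leibniz, hθ, h6θ, smul_zero,
      smul_zero, add_zero, smul_zero, zero_add, smul_eq_mul] at h1
    exact (hunit.mul_right_eq_zero).1 h1.symm
  have h7 := coeff_comm θ P 6 l μ 7 (fun i hi => by
    rcases (show i < 5 ∨ i = 5 ∨ i = 6 by omega) with h | rfl | rfl
    · rw [hconst i h, map_zero]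
    · exact hθθ
    · exact hθθ6) 8 le_rfl
  have hr : (X ^ (s + 3) * hom θ P 6 (coeffDer dQ l) 1).coeff 8 = 0 := by
    rw [coeff_X_pow_mul']
    split_ifs with h
    · rcases (show 8 - (s + 3) = 0 ∨ 8 - (s + 3) = 1 by omega) with h' | h' <;> rw [h']
      · rw [hom_coeff_zero, coeff_coeffDer, hdQ, zero_mul]
      · rw [hom_coeff_one hP 4, coeff_coeffDer, coeff_coeffDer, hdQ, hl5, map_zero, zero_mul,
          zero_add]
    · rfl
  have hP2 : 6 * l.coeff 6 * P.coeff 2 + l.coeff 4 = 0 := by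
    have h1 := hric 2 (by norm_num)
    rw [hom_coeff_two hP hP1, coeff_C, if_neg (by norm_num)] at h1
    push_cast at h1
    linear_combination h1
  have hP2t : 6 * l.coeff 6 * dt (P.coeff 2) + dt (l.coeff 4) = 0 := by
    have h1 := congrArg dt hP2
    have h6 : dt (6 : K) = 0 := by exact_mod_cast dt.map_natCast 6
    rw [map_add, Derivation.leibniz, Derivation.leibniz, hdt, h6] at h1
    simpa using h1
  rw [e, coeff_add, coeff_sub, hr, coeff_X_pow_mul', if_pos (by omega), coeff_X_pow_mul',
    if_neg (by omega), coeff_X_mul_coeffDer_mul, Finset.sum_range_succ, Finset.sum_range_succ,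
    Finset.sum_range_succ,
    Finset.sum_eq_zero (fun i hi => by rw [hconst i (Finset.mem_range.1 hi), zero_mul]), zero_add,
    Nat.sub_self,
    hom_coeff_two hP hP1, hH0, homDeriv_coeff_two hP hP1,
    homDeriv_coeff_one hP, coeff_coeffDer, coeff_coeffDer, hP1, hl5] at h7
  simp only [mul_zero, add_zero, sub_zero] at h7
  have hμ2t := congrArg dt hμ2
  simp only [map_add, Derivation.leibniz, smul_eq_mul, Derivation.map_natCast, mul_zero,
    add_zero] at hμ2t
  have hb : θ (dt (μ.coeff 2)) = 0 := by rw [hcomm, hconst 2 (by norm_num), map_zero]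
  -- Now 6 l₆ P₂ = -l₄, so the factor 30 l₆ P₂ + 4 l₄ of θ μ₅ is -l₄ and does not cancel. This is
  -- the origin of the term a l₄, with a the time derivative of the leading coefficient of M.
  refine ⟨(s + 3 : ℕ) * m.coeff (s + 3), dt (m.coeff (s + 3)),
    -(6 * l.coeff 6 * dt (μ.coeff 2)), 36 * l.coeff 6 ^ 2 * μ.coeff 7,
    (isUnit_natCast _ (by omega)).mul hmn, ?_, ?_, ?_, ?_⟩
  · rw [Derivation.leibniz, hc0, Derivation.map_natCast, smul_zero, smul_zero, add_zero]
  · rw [hcomm, hc0, map_zero]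
  · simp [Derivation.leibniz, hb, hθ, h6θ]
  · have h6' : θ (36 : K) = 0 := by exact_mod_cast θ.map_natCast 36
    have : θ (36 * l.coeff 6 ^ 2 * μ.coeff 7) = 36 * l.coeff 6 ^ 2 * θ (μ.coeff 7) := by
      simp [Derivation.leibniz, Derivation.leibniz_pow, hθ, h6']
    rw [this]
    linear_combination ((s + 3 : ℕ) : K) * m.coeff (s + 3) * hP2t + 6 * l.coeff 6 * hμ2t
      + 6 * l.coeff 6 * h7 - (30 * l.coeff 6 * P.coeff 2 + 4 * l.coeff 4) * h5
      + 5 * dt (m.coeff (s + 3)) * hP2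

end WKB
end

/-! ### Jet algebras, orders of differential functions and the zero curvature equation. -/

noncomputable section

open Polynomial

/-- The independent variables and the jet coordinates `u_{kx}`. -/
inductive JetIndex where
  | x : JetIndex
  | t : JetIndex
  | u : ℕ → JetIndex

/-- An algebra of differential functions: partial derivatives with respect to `x`, `t` and the jet
coordinates, each element depending on finitely many jet coordinates only, and with real powers of
units (up to sign). -/
structure JetAlgebra (K : Type*) [CommRing K] [Algebra ℝ K] where
  d : JetIndex → Derivation ℝ K K
  u : ℕ → K
  d_comm : ∀ a b f, d a (d b f) = d b (d a f)
  dx_u : ∀ j, d .x (u j) = 0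
  dt_u : ∀ j, d .t (u j) = 0
  du_u : ∀ i j, d (.u i) (u j) = if i = j then 1 else 0
  finite : ∀ f, ∃ N, ∀ i, N ≤ i → d (.u i) f = 0
  rpow : ∀ y, IsUnit y → ∀ c : ℝ, ∃ g, IsUnit g ∧ ∀ a, y * d a g = c • (g * d a y)

namespace JetAlgebra

variable {K : Type*} [CommRing K] [Algebra ℝ K] (J : JetAlgebra K)

/-- The partial derivative with respect to `u_{ix}`. -/
abbrev du (i : ℕ) : Derivation ℝ K K := J.d (.u i)

lemma du_support_finite (c : ℕ → K) (f : K) :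
    (Function.support fun i => c i * J.du i f).Finite := by
  obtain ⟨N, hN⟩ := J.finite f
  refine (Finset.range N).finite_toSet.subset fun i hi => ?_
  by_contra h
  simp only [Finset.coe_range, Set.mem_Iio, not_lt] at h
  exact hi (by simp [hN i h])

/-- The vector field `∑ i, c i ∂/∂u_{ix}`. -/
def field (c : ℕ → K) : Derivation ℝ K K :=
  Derivation.mk'
    { toFun := fun f => ∑ᶠ i, c i * J.du i f
      map_add' := fun f g => by
        rw [← finsum_add_distrib (J.du_support_finite c f) (J.du_support_finite c g)]
        exact finsum_congr fun i => by rw [map_add, mul_add]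
      map_smul' := fun r f => by
        rw [RingHom.id_apply, smul_finsum' r (J.du_support_finite c f)]
        exact finsum_congr fun i => by rw [Derivation.map_smul, mul_smul_comm] }
    fun f g => by
      change ∑ᶠ i, c i * J.du i (f * g) = f • (∑ᶠ i, c i * J.du i g) + g • ∑ᶠ i, c i * J.du i f
      rw [smul_finsum' f (J.du_support_finite c g), smul_finsum' g (J.du_support_finite c f),
        ← finsum_add_distrib]
      · refine finsum_congr fun i => ?_
        rw [Derivation.leibniz]
        simp only [smul_eq_mul]
        ring
      · exact (J.du_support_finite c g).subset fun i hi h => hi (by simp [h])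
      · exact (J.du_support_finite c f).subset fun i hi h => hi (by simp [h])

lemma field_apply (c : ℕ → K) (f : K) : J.field c f = ∑ᶠ i, c i * J.du i f := rfl

lemma field_eq_sum (c : ℕ → K) {f : K} {N : ℕ} (hN : ∀ i, N ≤ i → J.du i f = 0) :
    J.field c f = ∑ i ∈ Finset.range N, c i * J.du i f := by
  rw [field_apply]
  refine finsum_eq_sum_of_support_subset _ fun i hi => ?_
  by_contra h
  simp only [Finset.coe_range, Set.mem_Iio, not_lt] at h
  exact hi (by simp [hN i h])

/-- The vector field `a ∂/∂x + b ∂/∂t + ∑ i, c i ∂/∂u_{ix}`. -/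
def comb (a b : K) (c : ℕ → K) : Derivation ℝ K K := a • J.d .x + b • J.d .t + J.field c

lemma comb_eq_sum (a b : K) (c : ℕ → K) {f : K} {N : ℕ} (hN : ∀ i, N ≤ i → J.du i f = 0) :
    J.comb a b c f = a * J.d .x f + b * J.d .t f + ∑ i ∈ Finset.range N, c i * J.du i f := by
  rw [← J.field_eq_sum c hN]
  rfl

@[simp]
lemma comb_u (a b : K) (c : ℕ → K) (j : ℕ) : J.comb a b c (J.u j) = c j := by
  rw [J.comb_eq_sum a b c (N := j + 1) fun i hi => by rw [J.du_u, if_neg (by omega)]]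
  simp [J.dx_u, J.dt_u, J.du_u]

lemma comb_eq_zero (a b : K) (c : ℕ → K) (ha : a = 0) (hb : b = 0) (hc : ∀ i, c i = 0) (f : K) :
    J.comb a b c f = 0 := by
  obtain ⟨N, hN⟩ := J.finite f
  rw [J.comb_eq_sum a b c hN, ha, hb]
  simp [hc]

lemma d_u_eq_comb (i : ℕ) (f : K) : J.du i f = J.comb 0 0 (fun j => if j = i then 1 else 0) f := by
  obtain ⟨N, hN⟩ := J.finite f
  rw [J.comb_eq_sum (N := N + i + 1) 0 0 _ (fun j hj => hN j (by omega))]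
  simp

/-- The commutator of two vector fields. -/
lemma comb_comm (a b : K) (c : ℕ → K) (a' b' : K) (c' : ℕ → K) (f : K) :
    J.comb a b c (J.comb a' b' c' f) - J.comb a' b' c' (J.comb a b c f) =
      J.comb (J.comb a b c a' - J.comb a' b' c' a) (J.comb a b c b' - J.comb a' b' c' b)
        (fun i => J.comb a b c (c' i) - J.comb a' b' c' (c i)) f := by
  obtain ⟨N, hN⟩ := J.finite f
  have hd : ∀ e i, N ≤ i → J.du i (J.d e f) = 0 := fun e i hi => by
    rw [J.d_comm, hN i hi, map_zero]
  have key : ∀ a b c a' b' c', J.comb a b c (J.comb a' b' c' f) =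
      (J.comb a b c a' * J.d .x f + J.comb a b c b' * J.d .t f +
        ∑ i ∈ Finset.range N, J.comb a b c (c' i) * J.du i f) +
      (a' * (a * J.d .x (J.d .x f) + b * J.d .x (J.d .t f)) +
        b' * (a * J.d .x (J.d .t f) + b * J.d .t (J.d .t f)) +
        a' * (∑ i ∈ Finset.range N, c i * J.d .x (J.du i f)) +
        a * (∑ i ∈ Finset.range N, c' i * J.d .x (J.du i f)) +
        b' * (∑ i ∈ Finset.range N, c i * J.d .t (J.du i f)) +
        b * (∑ i ∈ Finset.range N, c' i * J.d .t (J.du i f)) +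
        ∑ i ∈ Finset.range N, ∑ k ∈ Finset.range N, c' i * c k * J.du k (J.du i f)) := by
    intro a b c a' b' c'
    rw [J.comb_eq_sum a' b' c' hN, map_add, map_add, map_sum]
    simp only [Derivation.leibniz, smul_eq_mul]
    have e0 := fun i => J.comb_eq_sum a b c (hd (.u i))
    rw [J.comb_eq_sum a b c (hd .x), J.comb_eq_sum a b c (hd .t)]
    simp only [e0, Finset.sum_add_distrib, mul_add, Finset.mul_sum]
    have h1 : ∀ i, J.du i (J.d .x f) = J.d .x (J.du i f) := fun i => J.d_comm _ _ _
    have h2 : ∀ i, J.du i (J.d .t f) = J.d .t (J.du i f) := fun i => J.d_comm _ _ _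
    simp only [h1, h2, J.d_comm .t .x]
    have e1 : ∀ i, c' i * (a * J.d .x (J.du i f)) = a * (c' i * J.d .x (J.du i f)) :=
      fun i => by ring
    have e2 : ∀ i, c' i * (b * J.d .t (J.du i f)) = b * (c' i * J.d .t (J.du i f)) :=
      fun i => by ring
    have e3 : ∀ i k, c' i * (c k * J.du k (J.du i f)) = c' i * c k * J.du k (J.du i f) :=
      fun i k => by ring
    have e4 : ∀ i, J.du i f * J.comb a b c (c' i) = J.comb a b c (c' i) * J.du i f :=
      fun i => by ring
    simp only [e1, e2, e3, e4]
    ring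
  have hsymm : ∑ i ∈ Finset.range N, ∑ k ∈ Finset.range N, c' i * c k * J.du k (J.du i f) =
      ∑ i ∈ Finset.range N, ∑ k ∈ Finset.range N, c i * c' k * J.du k (J.du i f) := by
    rw [Finset.sum_comm]
    refine Finset.sum_congr rfl fun i _ => Finset.sum_congr rfl fun k _ => ?_
    rw [J.d_comm (.u i) (.u k)]
    ring
  rw [key a b c a' b' c', key a' b' c' a b c, J.comb_eq_sum _ _ _ hN, hsymm]
  simp only [sub_mul, Finset.sum_sub_distrib]
  ring

/-- Linear relations between differentials are inherited by all vector fields. -/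
lemma comb_rel {A B C f g h : K} (H : ∀ e, A * J.d e f = B * J.d e g + C * J.d e h)
    (a b : K) (c : ℕ → K) :
    A * J.comb a b c f = B * J.comb a b c g + C * J.comb a b c h := by
  obtain ⟨N₁, h₁⟩ := J.finite f
  obtain ⟨N₂, h₂⟩ := J.finite g
  obtain ⟨N₃, h₃⟩ := J.finite h
  rw [J.comb_eq_sum a b c (N := N₁ + N₂ + N₃) (fun i hi => h₁ i (by omega)),
    J.comb_eq_sum a b c (N := N₁ + N₂ + N₃) (fun i hi => h₂ i (by omega)),
    J.comb_eq_sum a b c (N := N₁ + N₂ + N₃) (fun i hi => h₃ i (by omega))]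
  have : ∑ i ∈ Finset.range (N₁ + N₂ + N₃), c i * (A * J.du i f) =
      ∑ i ∈ Finset.range (N₁ + N₂ + N₃), c i * (B * J.du i g + C * J.du i h) :=
    Finset.sum_congr rfl fun i _ => by rw [H]
  simp only [mul_add, Finset.sum_add_distrib] at this
  have e : ∀ (A : K) (g : K), ∑ i ∈ Finset.range (N₁ + N₂ + N₃), c i * (A * J.du i g) =
      A * ∑ i ∈ Finset.range (N₁ + N₂ + N₃), c i * J.du i g := fun A g => by
    rw [Finset.mul_sum]
    exact Finset.sum_congr rfl fun i _ => by ring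
  rw [e, e, e] at this
  linear_combination this + a * H .x + b * H .t

/-! ### Total derivatives -/

/-- The total `x`-derivative. -/
def D : Derivation ℝ K K := J.comb 1 0 fun i => J.u (i + 1)

/-- The evolutionary vector field `∑ i, (D ^ i h) ∂/∂u_{ix}`. -/
def evol (h : K) : Derivation ℝ K K := J.comb 0 0 fun i => (J.D^[i]) h

/-- The total `t`-derivative on solutions of `u_t = Ψ`. -/
def Dt (Ψ : K) : Derivation ℝ K K := J.comb 0 1 fun i => (J.D^[i]) Ψ

@[simp]
lemma D_u (i : ℕ) : J.D (J.u i) = J.u (i + 1) := J.comb_u _ _ _ _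

@[simp]
lemma evol_u (h : K) (i : ℕ) : J.evol h (J.u i) = (J.D^[i]) h := J.comb_u _ _ _ _

lemma Dt_eq (Ψ f : K) : J.Dt Ψ f = J.d .t f + J.evol Ψ f := by
  obtain ⟨N, hN⟩ := J.finite f
  rw [Dt, evol, J.comb_eq_sum _ _ _ hN, J.comb_eq_sum _ _ _ hN]
  ring

lemma comb_sub (a b : K) (c : ℕ → K) (a' b' : K) (c' : ℕ → K) (f : K) :
    J.comb a b c f - J.comb a' b' c' f = J.comb (a - a') (b - b') (fun i => c i - c' i) f := by
  obtain ⟨N, hN⟩ := J.finite f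
  rw [J.comb_eq_sum _ _ _ hN, J.comb_eq_sum _ _ _ hN, J.comb_eq_sum _ _ _ hN]
  simp only [sub_mul, Finset.sum_sub_distrib]
  ring

/-- The commutator of the two fields is a field without ∂_x and ∂_t parts, and the coefficients D^i
h are exactly those for which it also annihilates every u_i. -/
lemma D_evol (h f : K) : J.D (J.evol h f) = J.evol h (J.D f) := by
  rw [← sub_eq_zero, D, evol, comb_comm]
  refine J.comb_eq_zero _ _ _ (by simp [Derivation.map_one_eq_zero]) (by simp) (fun i => ?_) f
  rw [comb_u, Function.iterate_succ_apply', ← D, sub_self]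

lemma D_Dt (Ψ f : K) : J.D (J.Dt Ψ f) = J.Dt Ψ (J.D f) := by
  rw [← sub_eq_zero, D, Dt, comb_comm]
  refine J.comb_eq_zero _ _ _ (by simp [Derivation.map_one_eq_zero])
    (by simp [Derivation.map_one_eq_zero]) (fun i => ?_) f
  rw [comb_u, Function.iterate_succ_apply', ← D, sub_self]

lemma iterate_D_comm {δ : Derivation ℝ K K} (hδ : ∀ f, J.D (δ f) = δ (J.D f)) (i : ℕ) (f : K) :
    δ ((J.D^[i]) f) = (J.D^[i]) (δ f) := by
  induction i with
  | zero => rfl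
  | succ i ih => rw [Function.iterate_succ_apply', ← hδ, ih, Function.iterate_succ_apply']

lemma iterate_D_sub (i : ℕ) (f g : K) : (J.D^[i]) (f - g) = (J.D^[i]) f - (J.D^[i]) g := by
  induction i with
  | zero => rfl
  | succ i ih => simp only [Function.iterate_succ_apply', ih, map_sub]

lemma evol_comm (h k f : K) :
    J.evol h (J.evol k f) - J.evol k (J.evol h f) = J.evol (J.evol h k - J.evol k h) f := by
  have h1 := J.iterate_D_comm (J.D_evol h)
  have h2 := J.iterate_D_comm (J.D_evol k)
  conv_lhs => rw [evol, evol, comb_comm]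
  rw [← evol, ← evol]
  simp only [h1, h2, ← iterate_D_sub, map_zero, sub_zero]
  rfl

lemma Dt_evol (Ψ h f : K) :
    J.Dt Ψ (J.evol h f) - J.evol h (J.Dt Ψ f) = J.evol (J.Dt Ψ h - J.evol h Ψ) f := by
  have h1 := J.iterate_D_comm (J.D_evol h)
  have h2 := J.iterate_D_comm (J.D_Dt Ψ)
  conv_lhs => rw [evol, Dt, comb_comm]
  rw [← evol, ← Dt]
  simp only [h1, h2, ← iterate_D_sub, map_zero, sub_zero, Derivation.map_one_eq_zero]
  rfl

lemma D_d_t (f : K) : J.D (J.d .t f) = J.d .t (J.D f) := by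
  obtain ⟨N, hN⟩ := J.finite f
  rw [D, J.comb_eq_sum _ _ _ hN, J.comb_eq_sum _ _ _ (N := N)
    (fun i hi => by rw [J.d_comm, hN i hi, map_zero])]
  simp [Derivation.leibniz, J.dt_u, J.d_comm .t]

/-- The commutation rule [∂/∂u_{i+1}, D] = ∂/∂u_i underlies every order count below: D raises the
order by one and keeps the top coefficient. -/
lemma du_D (i : ℕ) (f : K) : J.du (i + 1) (J.D f) = J.D (J.du (i + 1) f) + J.du i f := by
  have h := J.comb_comm 0 0 (fun j => if j = i + 1 then 1 else 0) 1 0 (fun i => J.u (i + 1)) f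
  rw [← D, ← d_u_eq_comb, ← d_u_eq_comb] at h
  rw [← sub_eq_iff_eq_add', h, J.d_u_eq_comb i, ← sub_eq_zero, comb_sub]
  refine J.comb_eq_zero _ _ _ ?_ ?_ (fun j => ?_) f
  · rw [Derivation.map_one_eq_zero]; simp
  · simp
  · rw [comb_u]
    simp [apply_ite J.D]

lemma du_zero_D (f : K) : J.du 0 (J.D f) = J.D (J.du 0 f) := by
  have h := J.comb_comm 0 0 (fun j => if j = 0 then 1 else 0) 1 0 (fun i => J.u (i + 1)) f
  rw [← D, ← d_u_eq_comb, ← d_u_eq_comb] at h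
  rw [← sub_eq_zero, h]
  refine J.comb_eq_zero _ _ _ ?_ ?_ (fun j => ?_) f
  · rw [Derivation.map_one_eq_zero]; simp
  · simp
  · rw [comb_u]
    simp [apply_ite J.D]

lemma dx_D (f : K) : J.d .x (J.D f) = J.D (J.d .x f) := by
  obtain ⟨N, hN⟩ := J.finite f
  rw [D, J.comb_eq_sum _ _ _ hN, J.comb_eq_sum _ _ _ (N := N)
    (fun i hi => by rw [J.d_comm, hN i hi, map_zero])]
  simp [Derivation.leibniz, J.dx_u, J.d_comm .x]

/-! ### Order -/

/-- `f` does not depend on `u_{ix}` for `i > N`. -/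
def OrdLE (f : K) (N : ℕ) : Prop := ∀ i, N < i → J.du i f = 0

variable {J}

lemma OrdLE.mono {f : K} {M N : ℕ} (h : J.OrdLE f M) (hMN : M ≤ N) : J.OrdLE f N :=
  fun i hi => h i (by omega)

lemma OrdLE.add {f g : K} {N : ℕ} (hf : J.OrdLE f N) (hg : J.OrdLE g N) : J.OrdLE (f + g) N :=
  fun i hi => by rw [map_add, hf i hi, hg i hi, add_zero]

lemma OrdLE.sub {f g : K} {N : ℕ} (hf : J.OrdLE f N) (hg : J.OrdLE g N) : J.OrdLE (f - g) N :=
  fun i hi => by rw [map_sub, hf i hi, hg i hi, sub_zero]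

lemma OrdLE.neg {f : K} {N : ℕ} (hf : J.OrdLE f N) : J.OrdLE (-f) N :=
  fun i hi => by rw [map_neg, hf i hi, neg_zero]

lemma OrdLE.mul {f g : K} {N : ℕ} (hf : J.OrdLE f N) (hg : J.OrdLE g N) : J.OrdLE (f * g) N :=
  fun i hi => by rw [Derivation.leibniz, hf i hi, hg i hi, smul_zero, smul_zero, add_zero]

lemma OrdLE.pow {f : K} {N : ℕ} (hf : J.OrdLE f N) (k : ℕ) : J.OrdLE (f ^ k) N :=
  fun i hi => by rw [Derivation.leibniz_pow, hf i hi, smul_zero, smul_zero]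

lemma OrdLE.natCast (n N : ℕ) : J.OrdLE (n : K) N := fun _ _ => Derivation.map_natCast _ _

lemma OrdLE.zero (N : ℕ) : J.OrdLE (0 : K) N := fun _ _ => map_zero _

lemma OrdLE.ofNat (n N : ℕ) [n.AtLeastTwo] : J.OrdLE (ofNat(n) : K) N := OrdLE.natCast n N

lemma OrdLE.D {f : K} {N : ℕ} (hf : J.OrdLE f N) : J.OrdLE (J.D f) (N + 1) := by
  intro i hi
  obtain ⟨i, rfl⟩ : ∃ j, i = j + 1 := ⟨i - 1, by omega⟩
  rw [du_D, hf (i + 1) (by omega), hf i (by omega), map_zero, add_zero]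

lemma OrdLE.du {f : K} {N : ℕ} (hf : J.OrdLE f N) (j : ℕ) : J.OrdLE (J.du j f) N :=
  fun i hi => by rw [J.d_comm, hf i hi, map_zero]

lemma OrdLE.of_mul_eq_one {f g : K} {N : ℕ} (hf : J.OrdLE f N) (h : g * f = 1) : J.OrdLE g N := by
  intro i hi
  rw [Derivation.leibniz_of_mul_eq_one _ h, hf i hi, smul_zero]

lemma OrdLE.u (j : ℕ) : J.OrdLE (J.u j) j := fun i hi => by
  rw [J.du_u, if_neg (by omega)]

/-- Descending induction from a bound M on the order of f: once ∂f/∂u_{i+1} vanishes, `du_D`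
identifies ∂f/∂u_i with a derivative of D f. -/
lemma OrdLE.of_D {f : K} {N : ℕ} (h : J.OrdLE (J.D f) (N + 1)) : J.OrdLE f N := by
  obtain ⟨M, hM⟩ := J.finite f
  have key : ∀ k, ∀ i, N < i → M ≤ i + k → J.du i f = 0 := by
    intro k
    induction k with
    | zero => exact fun i _ hi => hM i hi
    | succ k ih =>
      intro i hi hik
      have h1 := h (i + 1) (by omega)
      rw [du_D, ih (i + 1) (by omega) (by omega), map_zero, zero_add] at h1
      exact h1
  exact fun i hi => key M i hi (by omega)

/-- The kernel of the total derivative: functions of `t` only. -/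
lemma du_eq_zero_of_D {f : K} (h : J.D f = 0) (i : ℕ) : J.du i f = 0 := by
  obtain ⟨M, hM⟩ := J.finite f
  have key : ∀ k, ∀ i, M ≤ i + k → J.du i f = 0 := by
    intro k
    induction k with
    | zero => exact fun i hi => hM i hi
    | succ k ih =>
      intro i hik
      have h1 := congrArg (J.du (i + 1)) h
      rw [du_D, ih (i + 1) (by omega), map_zero, zero_add, map_zero] at h1
      exact h1
  exact key M i (by omega)

variable (J)

/-- `f` is of order at most `N` with `∂f/∂u_{Nx} = c`. -/
def HasTop (f : K) (N : ℕ) (c : K) : Prop := J.OrdLE f N ∧ J.du N f = c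

variable {J}

lemma HasTop.congr {f : K} {N : ℕ} {c c' : K} (h : J.HasTop f N c) (hc : c = c') :
    J.HasTop f N c' := hc ▸ h

lemma HasTop.add {f g : K} {N : ℕ} {a b : K} (hf : J.HasTop f N a) (hg : J.HasTop g N b) :
    J.HasTop (f + g) N (a + b) := ⟨hf.1.add hg.1, by rw [map_add, hf.2, hg.2]⟩

lemma HasTop.sub {f g : K} {N : ℕ} {a b : K} (hf : J.HasTop f N a) (hg : J.HasTop g N b) :
    J.HasTop (f - g) N (a - b) := ⟨hf.1.sub hg.1, by rw [map_sub, hf.2, hg.2]⟩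

/-- Used to discard terms of lower order when top coefficients are added. -/
lemma OrdLE.hasTop {f : K} {N : ℕ} (hf : J.OrdLE f N) : J.HasTop f (N + 1) 0 :=
  ⟨hf.mono (by omega), hf _ (by omega)⟩

lemma HasTop.mul_left {f g : K} {N : ℕ} {a : K} (hg : J.OrdLE g N)
    (hf : J.HasTop f (N + 1) a) : J.HasTop (g * f) (N + 1) (g * a) :=
  ⟨(hg.mono (by omega)).mul hf.1, by
    rw [Derivation.leibniz, hf.2, hg _ (by omega), smul_zero, add_zero, smul_eq_mul]⟩

lemma HasTop.mul_right {f g : K} {N : ℕ} {a : K} (hg : J.OrdLE g N)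
    (hf : J.HasTop f (N + 1) a) : J.HasTop (f * g) (N + 1) (a * g) := by
  rw [mul_comm f, mul_comm a]
  exact hf.mul_left hg

lemma HasTop.D {f : K} {N : ℕ} {a : K} (hf : J.HasTop f N a) : J.HasTop (J.D f) (N + 1) a :=
  ⟨hf.1.D, by rw [du_D, hf.1 _ (by omega), map_zero, zero_add, hf.2]⟩

lemma HasTop.mul_D {f p : K} {N : ℕ} {a : K} (hp : J.OrdLE p N) (hf : J.HasTop f N a) :
    J.HasTop (p * J.D f) (N + 1) (p * a) := hf.D.mul_left hp

/-- A total derivative is affine in the derivative of highest order. -/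
lemma du_du_eq_zero {A g p : K} {N : ℕ} (hA : J.OrdLE A (N + 1)) (hp : J.OrdLE p N)
    (hpu : IsUnit p) (h : A = p * J.D g) : J.du (N + 1) (J.du (N + 1) A) = 0 := by
  obtain ⟨u, rfl⟩ := hpu
  have hu : J.OrdLE (↑u⁻¹ : K) N := hp.of_mul_eq_one (by simp)
  have e : J.D g = ↑u⁻¹ * A := by rw [h, ← mul_assoc]; simp
  -- Since D raises the order by exactly one, g has order at most N. The derivative of p D g in
  -- u_{N+1} is then p ∂g/∂u_N, which no longer contains u_{N+1}.
  have h1 : J.OrdLE g N := by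
    refine OrdLE.of_D ?_
    rw [e]
    exact (hu.mono (by omega)).mul hA
  have h3 : J.du (N + 1) (↑u * J.D g) = ↑u * J.du N g := by
    rw [Derivation.leibniz, hp _ (by omega), smul_zero, add_zero, du_D, h1 _ (by omega), map_zero,
      zero_add, smul_eq_mul]
  rw [h, h3, Derivation.leibniz, hp _ (by omega), (h1.du N) _ (by omega)]
  simp

/-- A product of two factors of the same order is not a total derivative. -/
lemma mul_top_eq_zero {A B C g p a b : K} {N : ℕ} (hA : J.HasTop A (N + 1) a)
    (hB : J.HasTop B (N + 1) b) (ha : J.OrdLE a N) (hb : J.OrdLE b N)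
    (hC : J.HasTop C (N + 1) 0) (hp : J.OrdLE p N) (hpu : IsUnit p)
    (h : A * B + C = p * J.D g) : a * b = 0 := by
  have h2 := du_du_eq_zero ((hA.1.mul hB.1).add hC.1) hp hpu h
  rw [map_add, Derivation.leibniz, hA.2, hB.2, hC.2, add_zero, map_add, smul_eq_mul, smul_eq_mul,
    Derivation.leibniz, Derivation.leibniz, hA.2, hB.2, ha _ (by omega), hb _ (by omega)] at h2
  simp only [smul_eq_mul, mul_zero, zero_add] at h2
  have h5 : (2 : K) * (a * b) = 0 := by linear_combination h2
  exact ((WKB.isUnit_natCast (K := K) 2 (by norm_num)).mul_right_eq_zero).1 (by exact_mod_cast h5)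

/-! ### Symbols and the zero curvature equation -/

variable (J)

/-- The symbol `∑ i, (∂f/∂u_{ix}) X ^ i` of the linearization of `f`. -/
def symbol (f : K) : K[X] :=
  ∑ i ∈ Finset.range (J.finite f).choose, monomial i (J.du i f)

@[simp]
lemma coeff_symbol (f : K) (i : ℕ) : (J.symbol f).coeff i = J.du i f := by
  simp only [symbol, finsetSum_coeff, coeff_monomial, Finset.sum_ite_eq', Finset.mem_range]
  split_ifs with h
  · rfl
  · exact ((J.finite f).choose_spec i (by omega)).symm

lemma natDegree_symbol_le {f : K} {N : ℕ} (h : J.OrdLE f N) : (J.symbol f).natDegree ≤ N := by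
  rw [natDegree_le_iff_coeff_eq_zero]
  intro i hi
  rw [coeff_symbol, h i hi]

lemma iterate_eq_pow (δ : Derivation ℝ K K) (i : ℕ) (f : K) :
    (δ^[i]) f = ((δ : Module.End ℝ K) ^ i) f := by
  rw [Module.End.pow_apply]
  rfl

/-- The linearization is the operator with the given symbol. -/
lemma ev_symbol (f h : K) : WKB.ev (J.D : Module.End ℝ K) (J.symbol f) h = J.evol h f := by
  obtain ⟨N, hN⟩ := J.finite f
  rw [WKB.ev_eq_sum _ (J.natDegree_symbol_le (N := N) fun i hi => hN i (by omega)), evol,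
    J.comb_eq_sum _ _ _ (N := N + 1) fun i hi => hN i (by omega)]
  simp [iterate_eq_pow, mul_comm]

/-- The linearized equation and the linearized symmetry commute. -/
lemma zero_curvature {Ψ Q : K} (hQ : J.Dt Ψ Q = J.evol Q Ψ) (h : K) :
    J.Dt Ψ (J.evol Q h - J.evol h Q) - J.evol (J.evol Q h - J.evol h Q) Ψ =
      J.evol Q (J.Dt Ψ h - J.evol h Ψ) - J.evol (J.Dt Ψ h - J.evol h Ψ) Q := by
  have h1 := J.evol_comm Q h Ψ
  have h2 := J.Dt_evol Ψ h Q
  have h3 := J.Dt_evol Ψ Q h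
  have h4 : J.evol (J.Dt Ψ Q - J.evol Q Ψ) h = 0 := by
    rw [hQ, sub_self]
    refine J.comb_eq_zero _ _ _ rfl rfl (fun i => ?_) h
    induction i with
    | zero => rfl
    | succ i ih => rw [Function.iterate_succ_apply', ih, map_zero]
  rw [h4] at h3
  rw [← h1, ← h2, map_sub, map_sub, hQ]
  linear_combination h3

/-- The powers of `r D` are linearly independent. -/
lemma symbol_eq_zero {r : K} (hr : IsUnit r) {a : K[X]}
    (h : ∀ f, WKB.ev ((r • J.D : Derivation ℝ K K) : Module.End ℝ K) a f = 0) : a = 0 := by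
  set θ : Derivation ℝ K K := r • J.D with hθ
  obtain ⟨N₀, hN₀⟩ := J.finite r
  have : ∃ N, ∀ i, N ≤ i → ∀ j ≤ a.natDegree, J.du i (a.coeff j) = 0 := by
    choose M hM using fun j => J.finite (a.coeff j)
    refine ⟨∑ j ∈ Finset.range (a.natDegree + 1), M j, fun i hi j hj => hM j i ?_⟩
    refine le_trans ?_ hi
    exact Finset.single_le_sum (f := M) (fun _ _ => Nat.zero_le _) (by simp; omega)
  obtain ⟨N₁, hN₁⟩ := this
  -- The operator is tested on u_N with N beyond the orders of r and of all coefficients, so that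
  -- only the leading coefficient of a meets the highest derivative.
  obtain ⟨N, hN⟩ : ∃ N, N = N₀ + N₁ := ⟨_, rfl⟩
  have htop : ∀ i, J.HasTop (((θ : Module.End ℝ K) ^ i) (J.u N)) (N + i) (r ^ i) := by
    intro i
    induction i with
    | zero => exact ⟨OrdLE.u N, by simp [J.du_u]⟩
    | succ i ih =>
      rw [pow_succ', pow_succ']
      exact ih.mul_D fun j hj => hN₀ j (by change N + i < j at hj; omega)
  have h1 := congrArg (J.du (N + a.natDegree)) (h (J.u N))
  rw [WKB.ev_eq_sum _ le_rfl, map_sum, Finset.sum_range_succ, Finset.sum_eq_zero, zero_add,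
    smul_eq_mul, Derivation.leibniz, (htop _).2, hN₁ _ (by omega) _ le_rfl, smul_zero, add_zero,
    map_zero, smul_eq_mul] at h1
  · rw [← leadingCoeff_eq_zero]
    exact ((hr.pow _).mul_left_eq_zero).1 h1
  · intro i hi
    rw [Finset.mem_range] at hi
    rw [smul_eq_mul, Derivation.leibniz, (htop i).1 _ (by omega), hN₁ _ (by omega) _ hi.le,
      smul_zero, smul_zero, add_zero]

end JetAlgebra

namespace WKB

variable {K : Type*} [CommRing K] [Algebra ℝ K]

lemma apply_ev {θ δ : Derivation ℝ K K} (hδ : ∀ f, θ (δ f) = δ (θ f)) (a : K[X]) (h : K) :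
    δ (ev (θ : Module.End ℝ K) a h) =
      ev (θ : Module.End ℝ K) (coeffDer δ a) h + ev (θ : Module.End ℝ K) a (δ h) := by
  have key : ∀ i, δ (((θ : Module.End ℝ K) ^ i) h) = ((θ : Module.End ℝ K) ^ i) (δ h) := by
    intro i
    induction i with
    | zero => rfl
    | succ i ih =>
      rw [pow_succ', Module.End.mul_apply, Module.End.mul_apply, ← ih]
      exact (hδ _).symm
  induction a using Polynomial.induction_on' with
  | add p q hp hq =>
    simp only [map_add, Pi.add_apply, hp, hq]
    ring
  | monomial i c =>
    rw [coeffDer_monomial, ev_monomial, ev_monomial, ev_monomial, smul_eq_mul, Derivation.leibniz,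
      key]
    simp only [smul_eq_mul]
    ring

/-- The zero curvature equation on the level of symbols. -/
lemma zero_curvature_symbol {θ dt dQ : Derivation ℝ K K} (ht : ∀ f, θ (dt f) = dt (θ f))
    (hQ : ∀ f, θ (dQ f) = dQ (θ f)) (htQ : ∀ f, dt (dQ f) = dQ (dt f)) {l m : K[X]}
    (hinj : ∀ a : K[X], (∀ f, ev (θ : Module.End ℝ K) a f = 0) → a = 0)
    (h : ∀ f, dt (dQ f - ev (θ : Module.End ℝ K) m f)
        - ev (θ : Module.End ℝ K) l (dQ f - ev (θ : Module.End ℝ K) m f) =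
      dQ (dt f - ev (θ : Module.End ℝ K) l f)
        - ev (θ : Module.End ℝ K) m (dt f - ev (θ : Module.End ℝ K) l f)) :
    coeffDer dt m - coeffDer dQ l + star θ m l - star θ l m = 0 := by
  have hΔ : ∀ c w : K, (θ : Module.End ℝ K) (c • w) = c • (θ : Module.End ℝ K) w + θ c • w := by
    intro c w
    simp [Derivation.leibniz, mul_comm]
  have hsub : ∀ (a : K[X]) (f g : K), ev (θ : Module.End ℝ K) a (f - g) =
      ev (θ : Module.End ℝ K) a f - ev (θ : Module.End ℝ K) a g := by
    intro a f g
    simp only [ev_eq_sum _ le_rfl, map_sub, smul_sub, Finset.sum_sub_distrib]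
  refine hinj _ fun f => ?_
  have h1 := h f
  rw [hsub, hsub, map_sub, map_sub, apply_ev ht, apply_ev hQ, htQ] at h1
  rw [map_sub, map_add, map_sub, Pi.sub_apply, Pi.add_apply, Pi.sub_apply, ev_star θ _ hΔ,
    ev_star θ _ hΔ]
  linear_combination -h1

end WKB
end

/-! ### The projective arc length, the curvature, and functions of k and q. -/

noncomputable section

open Polynomial

namespace JetAlgebra

variable {K : Type*} [CommRing K] [Algebra ℝ K]

/-- The element `1/2`. -/
def half (K : Type*) [CommRing K] [Algebra ℝ K] : K := algebraMap ℝ K (1 / 2)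

lemma two_mul_half : 2 * half K = 1 := by
  rw [half, ← map_ofNat (algebraMap ℝ K) 2, ← map_mul]
  norm_num

@[simp]
lemma map_half (δ : Derivation ℝ K K) : δ (half K) = 0 := δ.map_algebraMap _

lemma map_ofNat' (δ : Derivation ℝ K K) (n : ℕ) [n.AtLeastTwo] : δ (ofNat(n) : K) = 0 :=
  δ.map_natCast n

/-- Twice the Schwarzian derivative of `u`, where `v = 1 / u_x`. -/
def schwarzian (J : JetAlgebra K) (v : K) : K := 2 * J.u 3 * v - 3 * (J.u 2 * v) ^ 2

/-- The projectively invariant arc length `ds = dx / p`, where `p` is a multiple of the inverse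
square root of the Schwarzian derivative. -/
structure ProjFrame (J : JetAlgebra K) where
  v : K
  p : K
  π : K
  -- The constant T p^2, with inverse s; for p = |T|^(-1/2) it is the sign of T. Keeping it as an
  -- element treats both signs at once.
  τ : K
  s : K
  hv : J.u 1 * v = 1
  hp : p * π = 1
  hs : s * τ = 1
  hτ : J.schwarzian v * p ^ 2 = τ
  dp : ∀ a, (2 * J.schwarzian v) * J.d a p = -p * J.d a (J.schwarzian v)
  dτ : ∀ a, J.d a τ = 0

namespace ProjFrame

variable {J : JetAlgebra K} (𝓕 : ProjFrame J)

/-- The derivative along the invariant arc length. -/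
def pd : Derivation ℝ K K := 𝓕.p • J.D

lemma pd_apply (f : K) : 𝓕.pd f = 𝓕.p * J.D f := rfl

def T : K := J.schwarzian 𝓕.v

/-- The invariant of lowest order (the curvature). -/
def k : K := 2 * 𝓕.p * J.D (J.D 𝓕.p) - J.D 𝓕.p ^ 2

/-- The derivative of the curvature. -/
def q : K := 𝓕.pd 𝓕.k

lemma π_mul_p : 𝓕.π * 𝓕.p = 1 := by rw [mul_comm, 𝓕.hp]

lemma isUnit_p : IsUnit 𝓕.p := IsUnit.of_mul_eq_one _ 𝓕.hp

lemma isUnit_π : IsUnit 𝓕.π := IsUnit.of_mul_eq_one _ 𝓕.π_mul_p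

lemma isUnit_s : IsUnit 𝓕.s := IsUnit.of_mul_eq_one _ 𝓕.hs

lemma isUnit_v : IsUnit 𝓕.v := IsUnit.of_mul_eq_one (J.u 1) (by rw [mul_comm, 𝓕.hv])

lemma isUnit_u_one (𝓕 : ProjFrame J) : IsUnit (J.u 1) := IsUnit.of_mul_eq_one _ 𝓕.hv

lemma T_mul : 𝓕.T * (𝓕.s * 𝓕.p ^ 2) = 1 := by
  have h1 := 𝓕.hτ
  have h2 := 𝓕.hs
  rw [T]
  linear_combination 𝓕.s * h1 + h2

lemma isUnit_T : IsUnit 𝓕.T := IsUnit.of_mul_eq_one _ 𝓕.T_mul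

lemma map_v (δ : Derivation ℝ K K) : δ 𝓕.v = -𝓕.v ^ 2 * δ (J.u 1) := by
  rw [Derivation.leibniz_of_mul_eq_one δ (show 𝓕.v * J.u 1 = 1 by rw [mul_comm, 𝓕.hv]),
    smul_eq_mul]

lemma map_π (δ : Derivation ℝ K K) : δ 𝓕.π = -𝓕.π ^ 2 * δ 𝓕.p := by
  rw [Derivation.leibniz_of_mul_eq_one δ 𝓕.π_mul_p, smul_eq_mul]

lemma map_s (δ : Derivation ℝ K K) (h : δ 𝓕.τ = 0) : δ 𝓕.s = 0 := by
  rw [Derivation.leibniz_of_mul_eq_one δ 𝓕.hs, h, smul_zero]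

lemma comb_τ (a b : K) (c : ℕ → K) : J.comb a b c 𝓕.τ = 0 := by
  have h := J.comb_rel (A := 1) (B := 0) (C := 0) (f := 𝓕.τ) (g := 0) (h := 0)
    (fun e => by rw [𝓕.dτ]; simp) a b c
  simpa using h

lemma comb_p (a b : K) (c : ℕ → K) :
    2 * 𝓕.T * J.comb a b c 𝓕.p = -𝓕.p * J.comb a b c 𝓕.T := by
  have h := J.comb_rel (A := 2 * 𝓕.T) (B := -𝓕.p) (C := 0) (f := 𝓕.p) (g := 𝓕.T) (h := 0)
    (fun e => by rw [T, 𝓕.dp]; simp) a b c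
  simpa using h

lemma comb_p' (a b : K) (c : ℕ → K) :
    J.comb a b c 𝓕.p = -half K * 𝓕.s * 𝓕.p ^ 3 * J.comb a b c 𝓕.T := by
  have h1 := 𝓕.comb_p a b c
  have h2 := 𝓕.T_mul
  have h3 := two_mul_half (K := K)
  linear_combination (half K * 𝓕.s * 𝓕.p ^ 2) * h1 - J.comb a b c 𝓕.p * h2 -
    (𝓕.T * 𝓕.s * 𝓕.p ^ 2 * J.comb a b c 𝓕.p) * h3

lemma map_T (δ : Derivation ℝ K K) : δ 𝓕.T = 2 * 𝓕.v * δ (J.u 3) - 6 * J.u 2 * 𝓕.v ^ 2 * δ (J.u 2)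
    + (6 * J.u 2 ^ 2 * 𝓕.v ^ 3 - 2 * J.u 3 * 𝓕.v ^ 2) * δ (J.u 1) := by
  simp only [T, schwarzian, map_sub, Derivation.leibniz, Derivation.leibniz_pow, smul_eq_mul,
    map_ofNat', 𝓕.map_v, nsmul_eq_mul]
  push_cast
  ring

lemma D_τ : J.D 𝓕.τ = 0 := 𝓕.comb_τ _ _ _

lemma D_s : J.D 𝓕.s = 0 := 𝓕.map_s _ 𝓕.D_τ

lemma pd_τ : 𝓕.pd 𝓕.τ = 0 := by rw [pd_apply, D_τ, mul_zero]

lemma pd_s : 𝓕.pd 𝓕.s = 0 := by rw [pd_apply, D_s, mul_zero]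

/-! ### Variation of the invariants -/

/-- The relative variation of `p` under `δu = u_x p h`. -/
def η (h : K) : K :=
  -𝓕.s * (𝓕.pd (𝓕.pd (𝓕.pd h)) + (𝓕.k + 𝓕.τ) * 𝓕.pd h + half K * 𝓕.q * h)

/-- The variation of the curvature under `δu = u_x p h`. -/
def varK (h : K) : K := 2 * 𝓕.pd (𝓕.pd (𝓕.η h)) + 2 * 𝓕.k * 𝓕.η h

lemma map_one (δ : Derivation ℝ K K) : δ 1 = 0 := δ.map_one_eq_zero

/-- The third derivative in terms of the arc length. -/
lemma cube_D (h : K) : 𝓕.p ^ 2 * J.D (J.D (J.D (𝓕.p * h))) =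
    𝓕.pd (𝓕.pd (𝓕.pd h)) + 𝓕.k * 𝓕.pd h + half K * 𝓕.q * h := by
  have h3 := two_mul_half (K := K)
  have hd : J.D (𝓕.p * h) = 𝓕.p * J.D h + h * J.D 𝓕.p := by rw [Derivation.leibniz]; rfl
  simp only [q, k, pd_apply, map_add, map_sub, Derivation.leibniz, Derivation.leibniz_pow,
    smul_eq_mul, nsmul_eq_mul, map_ofNat']
  push_cast
  linear_combination (-𝓕.p ^ 2 * h * J.D (J.D (J.D 𝓕.p))) * h3

/-- The variation u_x ξ is an infinitesimal change of the variable x, under which the Schwarzian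
transforms as a quadratic differential up to the cocycle ξ'''. -/
lemma evol_T (ξ : K) : J.evol (J.u 1 * ξ) 𝓕.T =
    2 * J.D (J.D (J.D ξ)) + 2 * 𝓕.T * J.D ξ + J.D 𝓕.T * ξ := by
  have hv := 𝓕.hv
  rw [map_T, map_T]
  simp only [evol_u, Function.iterate_succ_apply', Function.iterate_zero, id_eq]
  simp only [Derivation.leibniz, map_add, smul_eq_mul, D_u, T, schwarzian]
  linear_combination (2 * J.D (J.D (J.D ξ)) - 6 * J.u 2 * 𝓕.v * J.D (J.D ξ) +
    (6 * J.u 2 ^ 2 * 𝓕.v ^ 2 - 2 * J.u 3 * 𝓕.v) * J.D ξ) * hv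

lemma evol_p (h : K) : J.evol (J.u 1 * 𝓕.p * h) 𝓕.p = 𝓕.p * 𝓕.η h := by
  have h1 := 𝓕.comb_p' 0 0 fun i => (J.D^[i]) (J.u 1 * (𝓕.p * h))
  have h2 := 𝓕.comb_p 1 0 fun i => J.u (i + 1)
  have h3 := 𝓕.cube_D h
  have h4 : 𝓕.T * 𝓕.p ^ 2 = 𝓕.τ := 𝓕.hτ
  have h5 := two_mul_half (K := K)
  rw [← evol, evol_T] at h1
  rw [← D] at h2
  rw [mul_assoc, h1, η]
  have h6 : J.D (𝓕.p * h) = 𝓕.pd h + h * J.D 𝓕.p := by rw [Derivation.leibniz]; rfl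
  linear_combination (-2 * half K * 𝓕.s * 𝓕.p) * h3 - 2 * half K * 𝓕.s * 𝓕.p * 𝓕.pd h * h4
    - half K * 𝓕.s * 𝓕.p ^ 3 * h * h2 - 2 * half K * 𝓕.s * 𝓕.p ^ 3 * 𝓕.T * h6
    - 𝓕.s * 𝓕.p * (𝓕.pd (𝓕.pd (𝓕.pd h)) + (𝓕.k + 𝓕.τ) * 𝓕.pd h + half K * 𝓕.q * h) * h5

lemma evol_k (h : K) : J.evol (J.u 1 * 𝓕.p * h) 𝓕.k = 𝓕.varK h := by
  simp only [k, varK, map_sub, Derivation.leibniz, Derivation.leibniz_pow, smul_eq_mul,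
    nsmul_eq_mul, map_ofNat', ← D_evol, evol_p, pd_apply, map_add]
  push_cast
  ring

lemma evol_pd (h f : K) : J.evol (J.u 1 * 𝓕.p * h) (𝓕.pd f) =
    𝓕.η h * 𝓕.pd f + 𝓕.pd (J.evol (J.u 1 * 𝓕.p * h) f) := by
  simp only [pd_apply, Derivation.leibniz, smul_eq_mul, ← D_evol, evol_p]
  ring

lemma evol_q (h : K) : J.evol (J.u 1 * 𝓕.p * h) 𝓕.q =
    𝓕.η h * 𝓕.q + 𝓕.pd (𝓕.varK h) := by
  rw [q, evol_pd, evol_k]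

/-! ### Orders of the invariants -/

lemma ordLE_v : J.OrdLE 𝓕.v 1 := fun i hi => by
  rw [map_v, OrdLE.u 1 i hi, mul_zero]

lemma hasTop_p : J.HasTop 𝓕.p 3 (-𝓕.s * 𝓕.p ^ 3 * 𝓕.v) := by
  have h5 := two_mul_half (K := K)
  have h : ∀ i, J.du i 𝓕.p = -half K * 𝓕.s * 𝓕.p ^ 3 * J.du i 𝓕.T := fun i => by
    rw [d_u_eq_comb, d_u_eq_comb, comb_p']
  refine ⟨fun i hi => ?_, ?_⟩
  · rw [h, map_T, OrdLE.u 1 i (by omega), OrdLE.u 2 i (by omega), OrdLE.u 3 i (by omega)]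
    ring
  · rw [h, map_T, OrdLE.u 1 3 (by omega), OrdLE.u 2 3 (by omega), J.du_u, if_pos rfl]
    linear_combination (-𝓕.s * 𝓕.p ^ 3 * 𝓕.v) * h5

/-- `∂k/∂u_{5x}`. -/
def κ : K := 2 * 𝓕.p * (-𝓕.s * 𝓕.p ^ 3 * 𝓕.v)

lemma isUnit_κ : IsUnit 𝓕.κ := by
  have h2 : IsUnit (2 : K) := by exact_mod_cast WKB.isUnit_natCast (K := K) 2 (by norm_num)
  exact (h2.mul 𝓕.isUnit_p).mul ((𝓕.isUnit_s.neg.mul (𝓕.isUnit_p.pow 3)).mul 𝓕.isUnit_v)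

lemma ordLE_p : J.OrdLE 𝓕.p 3 := 𝓕.hasTop_p.1

lemma ordLE_τ (N : ℕ) : J.OrdLE 𝓕.τ N := fun _ _ => 𝓕.dτ _

lemma ordLE_s (N : ℕ) : J.OrdLE 𝓕.s N := fun _ _ => 𝓕.map_s _ (𝓕.dτ _)

lemma ordLE_κ : J.OrdLE 𝓕.κ 3 :=
  ((OrdLE.ofNat 2 3).mul 𝓕.ordLE_p).mul
    (((𝓕.ordLE_s 3).neg.mul (𝓕.ordLE_p.pow 3)).mul (𝓕.ordLE_v.mono (by omega)))

lemma hasTop_k : J.HasTop 𝓕.k 5 𝓕.κ := by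
  have h1 := 𝓕.hasTop_p.D.D
  have h2 : J.OrdLE (J.D 𝓕.p ^ 2) 4 := 𝓕.ordLE_p.D.pow 2
  have h3 := (h1.mul_left (((OrdLE.ofNat 2 3).mul 𝓕.ordLE_p).mono (by omega : 3 ≤ 4))).sub
    h2.hasTop
  exact h3.congr (by rw [κ, sub_zero])

lemma hasTop_pd {f c : K} {N : ℕ} (hN : 3 ≤ N) (h : J.HasTop f N c) :
    J.HasTop (𝓕.pd f) (N + 1) (𝓕.p * c) := h.mul_D (𝓕.ordLE_p.mono hN)

lemma ordLE_pd {f : K} {N : ℕ} (hN : 3 ≤ N) (h : J.OrdLE f N) : J.OrdLE (𝓕.pd f) (N + 1) :=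
  (𝓕.ordLE_p.mono (by omega)).mul h.D

lemma hasTop_q : J.HasTop 𝓕.q 6 (𝓕.p * 𝓕.κ) := 𝓕.hasTop_pd (by norm_num) 𝓕.hasTop_k

/-! ### Invariants of order six -/

/-- `f` is a function of `k` and `q`, with partial derivatives `a` and `b`. -/
def Inv (f a b : K) : Prop := ∀ e, J.d e f = a * J.d e 𝓕.k + b * J.d e 𝓕.q

variable {𝓕}

lemma Inv.comb {f a b : K} (h : 𝓕.Inv f a b) (a' b' : K) (c : ℕ → K) :
    J.comb a' b' c f = a * J.comb a' b' c 𝓕.k + b * J.comb a' b' c 𝓕.q := by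
  have := J.comb_rel (A := 1) (f := f) (B := a) (g := 𝓕.k) (C := b) (h := 𝓕.q)
    (fun e => by rw [one_mul]; exact h e) a' b' c
  rwa [one_mul] at this

lemma Inv.D {f a b : K} (h : 𝓕.Inv f a b) : J.D f = a * J.D 𝓕.k + b * J.D 𝓕.q := h.comb _ _ _

lemma Inv.pd {f a b : K} (h : 𝓕.Inv f a b) : 𝓕.pd f = a * 𝓕.q + b * 𝓕.pd 𝓕.q := by
  rw [pd_apply, h.D, q, pd_apply, pd_apply]
  ring

lemma Inv.evol {f a b : K} (h : 𝓕.Inv f a b) (g : K) :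
    J.evol g f = a * J.evol g 𝓕.k + b * J.evol g 𝓕.q := h.comb _ _ _

lemma Inv.ordLE {f a b : K} (h : 𝓕.Inv f a b) : J.OrdLE f 6 := fun i hi => by
  rw [h, 𝓕.hasTop_k.1 i (by omega), 𝓕.hasTop_q.1 i hi, mul_zero, mul_zero, add_zero]

lemma Inv.hasTop {f a b : K} (h : 𝓕.Inv f a b) : J.HasTop f 6 (b * (𝓕.p * 𝓕.κ)) :=
  ⟨h.ordLE, by rw [h, 𝓕.hasTop_k.1 6 (by omega), 𝓕.hasTop_q.2, mul_zero, zero_add]⟩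

lemma Inv.hasTop_five {f a : K} (h : 𝓕.Inv f a 0) : J.HasTop f 5 (a * 𝓕.κ) :=
  ⟨fun i hi => by rw [h, 𝓕.hasTop_k.1 i (by omega), mul_zero, zero_mul, add_zero],
    by rw [h, 𝓕.hasTop_k.2, zero_mul, add_zero]⟩

lemma Inv.add {f a b f' a' b' : K} (h : 𝓕.Inv f a b) (h' : 𝓕.Inv f' a' b') :
    𝓕.Inv (f + f') (a + a') (b + b') := fun e => by rw [map_add, h, h']; ring

lemma Inv.sub {f a b f' a' b' : K} (h : 𝓕.Inv f a b) (h' : 𝓕.Inv f' a' b') :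
    𝓕.Inv (f - f') (a - a') (b - b') := fun e => by rw [map_sub, h, h']; ring

lemma Inv.mul {f a b f' a' b' : K} (h : 𝓕.Inv f a b) (h' : 𝓕.Inv f' a' b') :
    𝓕.Inv (f * f') (f * a' + f' * a) (f * b' + f' * b) := fun e => by
  rw [Derivation.leibniz, h, h', smul_eq_mul, smul_eq_mul]; ring

lemma Inv.congr {f a b f' a' b' : K} (h : 𝓕.Inv f a b) (hf : f = f') (ha : a = a') (hb : b = b') :
    𝓕.Inv f' a' b' := hf ▸ ha ▸ hb ▸ h

lemma inv_const {c : K} (h : ∀ e, J.d e c = 0) : 𝓕.Inv c 0 0 := fun e => by rw [h]; ring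

lemma inv_k : 𝓕.Inv 𝓕.k 1 0 := fun e => by ring

lemma inv_q : 𝓕.Inv 𝓕.q 0 1 := fun e => by ring

lemma Inv.of_mul_eq_one {f a b g : K} (h : 𝓕.Inv f a b) (hg : g * f = 1) :
    𝓕.Inv g (-g ^ 2 * a) (-g ^ 2 * b) := fun e => by
  rw [Derivation.leibniz_of_mul_eq_one _ hg, h, smul_eq_mul]; ring

lemma Inv.pow {f a b : K} (h : 𝓕.Inv f a b) (n : ℕ) :
    𝓕.Inv (f ^ (n + 1)) ((n + 1 : ℕ) * f ^ n * a) ((n + 1 : ℕ) * f ^ n * b) := fun e => by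
  rw [Derivation.leibniz_pow, h, smul_eq_mul, nsmul_eq_mul, Nat.add_sub_cancel]; ring

/-- The partial derivatives of an invariant are determined. -/
lemma Inv.unique {f a b a' b' : K} (h : 𝓕.Inv f a b) (h' : 𝓕.Inv f a' b') : a = a' ∧ b = b' := by
  have h6 := h.hasTop.2.symm.trans h'.hasTop.2
  have hb : b = b' := ((𝓕.isUnit_p.mul 𝓕.isUnit_κ).mul_left_inj).1 h6
  refine ⟨?_, hb⟩
  have h5 := (h (.u 5)).symm.trans (h' (.u 5))
  rw [hb, 𝓕.hasTop_k.2] at h5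
  exact (𝓕.isUnit_κ.mul_left_inj).1 (add_right_cancel h5)

/-- The partial derivatives of invariants are invariants (Cartan's lemma). -/
lemma Inv.exists_second {f a b : K} (h : 𝓕.Inv f a b) :
    ∃ ak m bq, 𝓕.Inv a ak m ∧ 𝓕.Inv b m bq := by
  have hsymm : ∀ e e', J.d e a * J.d e' 𝓕.k + J.d e b * J.d e' 𝓕.q =
      J.d e' a * J.d e 𝓕.k + J.d e' b * J.d e 𝓕.q := by
    intro e e'
    have h1 := J.d_comm e e' f
    rw [h, h, map_add, map_add, Derivation.leibniz, Derivation.leibniz, Derivation.leibniz,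
      Derivation.leibniz, J.d_comm e' e, J.d_comm e' e] at h1
    simp only [smul_eq_mul] at h1
    linear_combination h1
  obtain ⟨w, hw⟩ := 𝓕.isUnit_κ.exists_right_inv
  obtain ⟨z, hz⟩ := (𝓕.isUnit_p.mul 𝓕.isUnit_κ).exists_right_inv
  -- Symmetry of the second derivatives of f is read off against u_6, where dk vanishes and dq is a
  -- unit, to solve for db. Against u_5, where dk is a unit, it then gives da.
  have hb : 𝓕.Inv b (z * J.du 6 a) (z * J.du 6 b) := fun e => by
    have h1 := hsymm e (.u 6)
    rw [𝓕.hasTop_k.1 6 (by omega), 𝓕.hasTop_q.2] at h1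
    linear_combination z * h1 - J.d e b * hz
  have ha : 𝓕.Inv a (w * (J.du 5 a - J.du 5 𝓕.q * (z * J.du 6 a)))
      (w * (J.du 5 b - J.du 5 𝓕.q * (z * J.du 6 b))) := fun e => by
    have h1 := hsymm e (.u 5)
    rw [𝓕.hasTop_k.2] at h1
    have h2 := hb e
    linear_combination w * h1 - J.d e a * hw - w * J.du 5 𝓕.q * h2
  refine ⟨_, _, _, ha.congr rfl rfl ?_, hb⟩
  have h1 := ha.hasTop.2
  linear_combination (-z) * h1 - (w * (J.du 5 b - J.du 5 𝓕.q * (z * J.du 6 b))) * hz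

end ProjFrame

end JetAlgebra
end

/-! ### Normal form of the infinitesimally invariant equations. -/

noncomputable section

open Polynomial

namespace JetAlgebra

variable {K : Type*} [CommRing K] [Algebra ℝ K]

/-- The infinitesimal form of projective invariance of the equation `u_t = Ψ` of order six. -/
structure InfinitesimallyInvariant (J : JetAlgebra K) (Ψ : K) : Prop where
  ord : J.OrdLE Ψ 6
  dx : J.d .x Ψ = 0
  dt : J.d .t Ψ = 0
  du_zero : J.du 0 Ψ = 0
  scale_u : ∑ i ∈ Finset.range 7, J.u i * J.du i Ψ = Ψ
  scale_x : ∑ i ∈ Finset.range 7, (i : K) * J.u i * J.du i Ψ = 0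
  special_x : ∑ i ∈ Finset.range 7, (i * (i - 1) : K) * J.u (i - 1) * J.du i Ψ = 0
  special_u : ∑ i ∈ Finset.range 7,
    (∑ j ∈ Finset.range (i + 1), (i.choose j : K) * J.u j * J.u (i - j)) * J.du i Ψ =
      2 * J.u 0 * Ψ

namespace ProjFrame

variable {J : JetAlgebra K} (𝓕 : ProjFrame J)

lemma iterate_D_u_zero (i : ℕ) : (J.D^[i]) (J.u 0) = J.u i := by
  induction i with
  | zero => rfl
  | succ i ih => rw [Function.iterate_succ_apply', ih, D_u]

lemma map_p_of_map_T {a b : K} {c : ℕ → K} (h : J.comb a b c 𝓕.T = 0) :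
    J.comb a b c 𝓕.p = 0 := by
  rw [comb_p', h, mul_zero]

/-- Evolutionary fields commute with D, so invariance of p passes to everything built from p and D.
-/
lemma evol_k_of_evol_p {g : K} (h : J.evol g 𝓕.p = 0) :
    J.evol g 𝓕.k = 0 ∧ J.evol g 𝓕.q = 0 := by
  have hk : J.evol g 𝓕.k = 0 := by
    simp only [k, map_sub, Derivation.leibniz, Derivation.leibniz_pow, smul_eq_mul,
      nsmul_eq_mul, map_ofNat', ← D_evol, h, map_zero]
    ring
  refine ⟨hk, ?_⟩
  rw [q, pd_apply, Derivation.leibniz, ← D_evol, hk, h, map_zero, smul_zero, smul_zero, add_zero]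

lemma scale_u_p : J.evol (J.u 0) 𝓕.p = 0 := by
  refine 𝓕.map_p_of_map_T ?_
  rw [← evol, map_T]
  simp only [evol_u, iterate_D_u_zero]
  linear_combination (6 * J.u 2 ^ 2 * 𝓕.v ^ 2 - 2 * J.u 3 * 𝓕.v) * 𝓕.hv

lemma special_u_p : J.evol (J.u 0 ^ 2) 𝓕.p = 0 := by
  refine 𝓕.map_p_of_map_T ?_
  rw [← evol, map_T]
  simp only [evol_u, Function.iterate_succ_apply', Function.iterate_zero, id_eq,
    Derivation.leibniz_pow, Derivation.leibniz, map_add, smul_eq_mul, D_u, nsmul_eq_mul,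
    Nat.add_one_sub_one, pow_one, Nat.cast_ofNat, map_ofNat', map_zero]
  linear_combination (2 * J.u 0 * (6 * J.u 2 ^ 2 * 𝓕.v ^ 2 - 2 * J.u 3 * 𝓕.v)
    - 12 * J.u 2 * J.u 1 * 𝓕.v) * 𝓕.hv

/-- The weight operator. -/
def weight (J : JetAlgebra K) : Derivation ℝ K K := J.comb 0 0 fun i => i * J.u i

/-- The vertical part of the special projective transformations of `x` at `x = 0`. -/
def special (J : JetAlgebra K) : Derivation ℝ K K :=
  J.comb 0 0 fun i => (i * (i - 1) : K) * J.u (i - 1)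

/-- Dilations of x multiply D by a weight. The weight operator here has no x ∂/∂x part, so its
commutator with D is D - ∂_x, and f must not depend on x explicitly. -/
lemma weight_D {f : K} (hf : J.d .x f = 0) : weight J (J.D f) = J.D (weight J f) + J.D f := by
  have h := J.comb_comm 0 0 (fun i => (i : K) * J.u i) 1 0 (fun i => J.u (i + 1)) f
  rw [← D, ← weight] at h
  obtain ⟨N, hN⟩ := J.finite f
  have h2 : J.D f = J.comb 0 0 (fun i => J.u (i + 1)) f := by
    rw [D, J.comb_eq_sum _ _ _ hN, J.comb_eq_sum _ _ _ hN, hf]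
    ring
  rw [← sub_eq_iff_eq_add', h, h2, ← sub_eq_zero, comb_sub]
  refine J.comb_eq_zero _ _ _ ?_ ?_ (fun i => ?_) f
  · rw [map_one]; simp
  · simp
  · rw [weight, comb_u, Derivation.leibniz, D_u, Derivation.map_natCast]
    simp only [smul_eq_mul]
    push_cast
    ring

/-- The sl(2) relation between the special projective generator, D and the weight. -/
lemma special_D (f : K) : special J (J.D f) = J.D (special J f) + 2 * weight J f := by
  have h := J.comb_comm 0 0 (fun i => (i * (i - 1) : K) * J.u (i - 1)) 1 0
    (fun i => J.u (i + 1)) f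
  rw [← D, ← special] at h
  obtain ⟨N, hN⟩ := J.finite f
  have h2 : 2 * weight J f = J.comb 0 0 (fun i => 2 * (i * J.u i)) f := by
    rw [weight, J.comb_eq_sum _ _ _ hN, J.comb_eq_sum _ _ _ hN]
    simp only [zero_mul, zero_add, Finset.mul_sum]
    exact Finset.sum_congr rfl fun i _ => by ring
  rw [← sub_eq_iff_eq_add', h, h2, ← sub_eq_zero, comb_sub]
  refine J.comb_eq_zero _ _ _ ?_ ?_ (fun i => ?_) f
  · rw [map_one]; simp
  · simp
  · rw [special, comb_u, Derivation.leibniz, D_u]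
    have h3 : J.D ((i : K) * ((i : K) - 1)) = 0 := by
      rw [Derivation.leibniz, map_sub, Derivation.map_natCast, map_one]; simp
    rw [h3]
    cases i with
    | zero => simp
    | succ i =>
      simp only [Nat.add_sub_cancel, smul_eq_mul]
      push_cast
      ring

lemma dx_D_eq_zero {f : K} (h : J.d .x f = 0) : J.d .x (J.D f) = 0 := by
  rw [dx_D, h, map_zero]

lemma d_p (e : JetIndex) : J.d e 𝓕.p = -half K * 𝓕.s * 𝓕.p ^ 3 * J.d e 𝓕.T := by
  have h1 := 𝓕.dp e
  have h2 := 𝓕.T_mul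
  have h3 := two_mul_half (K := K)
  rw [← T] at h1
  linear_combination (half K * 𝓕.s * 𝓕.p ^ 2) * h1 - J.d e 𝓕.p * h2 -
    (𝓕.T * 𝓕.s * 𝓕.p ^ 2 * J.d e 𝓕.p) * h3

lemma dx_p : J.d .x 𝓕.p = 0 := by
  rw [d_p, map_T, J.dx_u, J.dx_u, J.dx_u]; ring

lemma dt_p : J.d .t 𝓕.p = 0 := by
  rw [d_p, map_T, J.dt_u, J.dt_u, J.dt_u]; ring

lemma du_zero_p : J.du 0 𝓕.p = 0 := by
  rw [d_p, map_T, J.du_u, J.du_u, J.du_u]; simp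

lemma d_k_eq_zero {e : JetIndex} (hD : ∀ f, J.d e (J.D f) = J.D (J.d e f)) (h : J.d e 𝓕.p = 0) :
    J.d e 𝓕.k = 0 ∧ J.d e 𝓕.q = 0 := by
  have hk : J.d e 𝓕.k = 0 := by
    simp only [k, map_sub, Derivation.leibniz, Derivation.leibniz_pow, smul_eq_mul,
      nsmul_eq_mul, map_ofNat', hD, h, map_zero]
    ring
  refine ⟨hk, ?_⟩
  rw [q, pd_apply, Derivation.leibniz, hD, hk, h, map_zero, smul_zero, smul_zero, add_zero]

lemma dx_k : J.d .x 𝓕.k = 0 ∧ J.d .x 𝓕.q = 0 := 𝓕.d_k_eq_zero J.dx_D 𝓕.dx_p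

lemma dt_k : J.d .t 𝓕.k = 0 ∧ J.d .t 𝓕.q = 0 :=
  𝓕.d_k_eq_zero (fun f => (J.D_d_t f).symm) 𝓕.dt_p

lemma du_zero_k : J.du 0 𝓕.k = 0 ∧ J.du 0 𝓕.q = 0 := 𝓕.d_k_eq_zero J.du_zero_D 𝓕.du_zero_p

lemma weight_p : weight J 𝓕.p = -𝓕.p := by
  rw [weight, comb_p', ← weight, map_T]
  simp only [weight, comb_u]
  have h1 := 𝓕.T_mul
  have h2 := two_mul_half (K := K)
  have h3 := 𝓕.hv
  simp only [T, schwarzian] at h1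
  push_cast
  linear_combination (-𝓕.p * half K * 2) * h1 - 𝓕.p * h2 + (-half K * 𝓕.s * 𝓕.p ^ 3) *
    (6 * J.u 2 ^ 2 * 𝓕.v ^ 2 - 2 * J.u 3 * 𝓕.v) * h3

lemma special_p : special J 𝓕.p = 0 := by
  refine 𝓕.map_p_of_map_T ?_
  rw [← special, map_T]
  simp only [special, comb_u]
  push_cast
  linear_combination (-12 * J.u 2 * 𝓕.v) * 𝓕.hv

lemma weight_k : weight J 𝓕.k = 0 ∧ weight J 𝓕.q = 0 := by
  have h1 := dx_D_eq_zero 𝓕.dx_p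
  have e1 : weight J (J.D 𝓕.p) = 0 := by
    rw [weight_D 𝓕.dx_p, weight_p, map_neg, neg_add_cancel]
  have e2 : weight J (J.D (J.D 𝓕.p)) = J.D (J.D 𝓕.p) := by
    rw [weight_D h1, e1, map_zero, zero_add]
  have hk : weight J 𝓕.k = 0 := by
    simp only [k, map_sub, Derivation.leibniz, Derivation.leibniz_pow, smul_eq_mul,
      nsmul_eq_mul, map_ofNat', e1, e2, weight_p]
    ring
  refine ⟨hk, ?_⟩
  rw [q, pd_apply, Derivation.leibniz, weight_D 𝓕.dx_k.1, hk, weight_p, map_zero]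
  simp only [smul_eq_mul]
  ring

lemma special_k : special J 𝓕.k = 0 ∧ special J 𝓕.q = 0 := by
  have h1 := dx_D_eq_zero 𝓕.dx_p
  have e1 : weight J (J.D 𝓕.p) = 0 := by
    rw [weight_D 𝓕.dx_p, weight_p, map_neg, neg_add_cancel]
  have f1 : special J (J.D 𝓕.p) = -2 * 𝓕.p := by
    rw [special_D, special_p, weight_p, map_zero]; ring
  have f2 : special J (J.D (J.D 𝓕.p)) = -2 * J.D 𝓕.p := by
    rw [special_D, f1, e1, Derivation.leibniz, map_neg, map_ofNat']
    simp only [smul_eq_mul]; ring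
  have hk : special J 𝓕.k = 0 := by
    simp only [k, map_sub, Derivation.leibniz, Derivation.leibniz_pow, smul_eq_mul,
      nsmul_eq_mul, map_ofNat', f1, f2, special_p]
    push_cast
    ring
  refine ⟨hk, ?_⟩
  rw [q, pd_apply, Derivation.leibniz, special_D, hk, special_p, 𝓕.weight_k.1, map_zero]
  simp

/-- An equation which is infinitesimally invariant is `u_t = u_x p F`, with an invariant `F`. -/
lemma exists_inv {Ψ : K} (hΨ : J.InfinitesimallyInvariant Ψ) :
    ∃ F a b, Ψ = J.u 1 * 𝓕.p * F ∧ 𝓕.Inv F a b := by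
  set F := Ψ * 𝓕.v * 𝓕.π with hF
  have hΨF : Ψ = J.u 1 * 𝓕.p * F := by
    rw [hF]
    linear_combination (-Ψ) * 𝓕.hv - Ψ * J.u 1 * 𝓕.v * 𝓕.hp
  have hord : J.OrdLE F 6 := (hΨ.ord.mul (𝓕.ordLE_v.mono (by omega))).mul
    ((𝓕.ordLE_p.mono (by omega)).of_mul_eq_one 𝓕.π_mul_p)
  have hδ : ∀ δ : Derivation ℝ K K, ∀ m n : K, δ Ψ = (m + n) * Ψ → δ (J.u 1) = m * J.u 1 →
      δ 𝓕.p = n * 𝓕.p → δ F = 0 := by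
    intro δ m n h1 h2 h3
    rw [hF, Derivation.leibniz, Derivation.leibniz, map_v, map_π, h1, h2, h3]
    simp only [smul_eq_mul]
    linear_combination (-Ψ * 𝓕.v * 𝓕.π * n) * 𝓕.hp - (Ψ * 𝓕.v * 𝓕.π * m) * 𝓕.hv
  have hsum : ∀ c : ℕ → K, J.comb 0 0 c Ψ = ∑ i ∈ Finset.range 7, c i * J.du i Ψ := fun c => by
    rw [J.comb_eq_sum _ _ _ (N := 7) fun i hi => hΨ.ord i (by omega)]; ring
  have hE1 : J.evol (J.u 0) F = 0 := by
    refine hδ _ 1 0 ?_ (by simp) (by rw [scale_u_p, zero_mul])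
    rw [evol, hsum]
    simp only [iterate_D_u_zero]
    rw [hΨ.scale_u]; ring
  have hE5 : J.evol (J.u 0 ^ 2) F = 0 := by
    refine hδ _ (2 * J.u 0) 0 ?_ ?_ (by rw [special_u_p, zero_mul])
    · rw [evol, hsum, add_zero, ← hΨ.special_u]
      refine Finset.sum_congr rfl fun i hi => ?_
      congr 1
      rw [Finset.mem_range] at hi
      interval_cases i <;>
      simp only [Function.iterate_succ_apply', Function.iterate_zero, id_eq,
        Derivation.leibniz_pow, Derivation.leibniz, map_add, smul_eq_mul, D_u, nsmul_eq_mul,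
        Nat.add_one_sub_one, pow_one, Nat.cast_ofNat, map_ofNat', map_zero,
        Finset.sum_range_succ, Finset.sum_range_zero, Nat.choose, Nat.cast_one] <;>
      norm_num [Derivation.leibniz, map_ofNat'] <;> ring
    · simp [Derivation.leibniz_pow]
      ring
  have hE3 : weight J F = 0 := by
    refine hδ _ 1 (-1) ?_ (by simp [weight]) (by rw [weight_p]; ring)
    rw [weight, hsum, hΨ.scale_x]; ring
  have hE4 : special J F = 0 := by
    refine hδ _ 0 0 ?_ (by simp [special]) (by rw [special_p]; ring)
    rw [special, hsum, hΨ.special_x]; ring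
  have hz : ∀ e, J.d e Ψ = 0 → J.d e (J.u 1) = 0 → J.d e 𝓕.p = 0 → J.d e F = 0 :=
    fun e h1 h2 h3 => hδ _ 0 0 (by rw [h1]; ring) (by rw [h2]; ring) (by rw [h3]; ring)
  obtain ⟨w, hw⟩ := 𝓕.isUnit_κ.exists_right_inv
  obtain ⟨z, hz'⟩ := (𝓕.isUnit_p.mul 𝓕.isUnit_κ).exists_right_inv
  obtain ⟨b, hb⟩ : ∃ b, b = z * J.du 6 F := ⟨_, rfl⟩
  obtain ⟨a, ha⟩ : ∃ a, a = w * (J.du 5 F - b * J.du 5 𝓕.q) := ⟨_, rfl⟩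
  refine ⟨F, a, b, hΨF, ?_⟩
  -- The components of dF - a dk - b dq. The choice of a and b kills those along u_6 and u_5, and
  -- invariance under translations of u kills that along u_0. The two scalings and the two special
  -- projective generators give four linear equations for the remaining four.
  set ϖ : ℕ → K := fun i => J.du i F - a * J.du i 𝓕.k - b * J.du i 𝓕.q with hϖ
  have hϖ6 : ϖ 6 = 0 := by
    simp only [hϖ]
    rw [𝓕.hasTop_k.1 6 (by omega), 𝓕.hasTop_q.2, hb]
    linear_combination (-J.du 6 F) * hz'
  have hϖ5 : ϖ 5 = 0 := by
    simp only [hϖ]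
    rw [𝓕.hasTop_k.2, ha]
    linear_combination (-(J.du 5 F - b * J.du 5 𝓕.q)) * hw
  have hϖ0 : ϖ 0 = 0 := by
    simp only [hϖ]
    rw [𝓕.du_zero_k.1, 𝓕.du_zero_k.2, hz (.u 0) hΨ.du_zero (by simp [J.du_u]) 𝓕.du_zero_p]
    ring
  have hrel : ∀ c : ℕ → K, J.comb 0 0 c F = 0 → J.comb 0 0 c 𝓕.k = 0 ∧ J.comb 0 0 c 𝓕.q = 0 →
      c 1 * ϖ 1 + c 2 * ϖ 2 + c 3 * ϖ 3 + c 4 * ϖ 4 = 0 := by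
    intro c h1 h2
    have e1 := J.comb_eq_sum 0 0 c (f := F) (N := 7) fun i hi => hord i (by omega)
    have e2 := J.comb_eq_sum 0 0 c (f := 𝓕.k) (N := 7) fun i hi => 𝓕.hasTop_k.1 i (by omega)
    have e3 := J.comb_eq_sum 0 0 c (f := 𝓕.q) (N := 7) fun i hi => 𝓕.hasTop_q.1 i (by omega)
    rw [h1] at e1
    rw [h2.1] at e2
    rw [h2.2] at e3
    simp only [Finset.sum_range_succ, Finset.sum_range_zero, zero_mul, zero_add] at e1 e2 e3
    simp only [hϖ] at hϖ0 hϖ5 hϖ6 ⊢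
    linear_combination -e1 + a * e2 + b * e3 - c 0 * hϖ0 - c 5 * hϖ5 - c 6 * hϖ6
  have r1 := hrel _ hE1 (𝓕.evol_k_of_evol_p 𝓕.scale_u_p)
  have r5 := hrel _ hE5 (𝓕.evol_k_of_evol_p 𝓕.special_u_p)
  have r3 := hrel _ hE3 𝓕.weight_k
  have r4 := hrel _ hE4 𝓕.special_k
  simp only [iterate_D_u_zero] at r1
  simp only [Function.iterate_succ_apply', Function.iterate_zero, id_eq,
    Derivation.leibniz_pow, Derivation.leibniz, map_add, smul_eq_mul, D_u, nsmul_eq_mul,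
    Nat.add_one_sub_one, pow_one, Nat.cast_ofNat, map_ofNat', map_zero] at r5
  push_cast at r3 r4
  norm_num at r3 r4
  -- The linear system is triangular in the order ϖ₄, ϖ₃, ϖ₂, ϖ₁, with pivots 2 T u_1^2 (twice), 2
  -- u_1 and u_1. The first pivot is where the Schwarzian must be a unit.
  have hT : 𝓕.T * J.u 1 ^ 2 = 2 * J.u 1 * J.u 3 - 3 * J.u 2 ^ 2 := by
    simp only [T, schwarzian]
    linear_combination (2 * J.u 1 * J.u 3 - 3 * J.u 2 ^ 2 * (J.u 1 * 𝓕.v + 1)) * 𝓕.hv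
  have h2 : IsUnit (2 : K) := by exact_mod_cast WKB.isUnit_natCast (K := K) 2 (by norm_num)
  have hu : IsUnit (2 * (𝓕.T * J.u 1 ^ 2)) :=
    h2.mul (𝓕.isUnit_T.mul (𝓕.isUnit_u_one.pow 2))
  have w4 : ϖ 4 = 0 := by
    refine (hu.mul_right_eq_zero).1 ?_
    rw [hT]
    linear_combination J.u 1 * r4 - r5 + 2 * J.u 0 * r1
  rw [w4] at r1 r3 r4 r5
  have w3 : ϖ 3 = 0 := by
    refine (hu.mul_right_eq_zero).1 ?_
    rw [hT]
    linear_combination 2 * J.u 1 * (r3 - r1) - J.u 2 * r4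
  have w2 : ϖ 2 = 0 := by
    refine ((h2.mul 𝓕.isUnit_u_one).mul_right_eq_zero).1 ?_
    rw [w3] at r4
    linear_combination r4
  have w1 : ϖ 1 = 0 := by
    refine (𝓕.isUnit_u_one.mul_right_eq_zero).1 ?_
    rw [w2, w3] at r1
    linear_combination r1
  intro e
  rw [← sub_eq_zero]
  match e with
  | .x => rw [𝓕.dx_k.1, 𝓕.dx_k.2, hz .x hΨ.dx (J.dx_u 1) 𝓕.dx_p]; ring
  | .t => rw [𝓕.dt_k.1, 𝓕.dt_k.2, hz .t hΨ.dt (J.dt_u 1) 𝓕.dt_p]; ring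
  | .u i =>
    have : ϖ i = 0 := by
      by_cases hi : i < 7
      · interval_cases i <;> assumption
      · simp only [hϖ]
        rw [hord i (by omega), 𝓕.hasTop_k.1 i (by omega), 𝓕.hasTop_q.1 i (by omega)]; ring
    linear_combination this

end ProjFrame

end JetAlgebra
end

/-! ### The leading conserved density forces F_q^(-1/6) to be of the form α(k) q. -/

noncomputable section

open Polynomial

namespace JetAlgebra

variable {K : Type*} [CommRing K] [Algebra ℝ K]

lemma isUnit_two : IsUnit (2 : K) := by
  exact_mod_cast WKB.isUnit_natCast (K := K) 2 (by norm_num)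

lemma isUnit_half : IsUnit (half K) :=
  IsUnit.of_mul_eq_one (2 : K) (by rw [mul_comm, two_mul_half])

namespace ProjFrame

variable {J : JetAlgebra K} {𝓕 : ProjFrame J}

lemma pd_mul (f g : K) : 𝓕.pd (f * g) = f * 𝓕.pd g + g * 𝓕.pd f := Derivation.leibniz _ _ _

lemma pd_eq_zero_of_D {f : K} (h : J.D f = 0) : 𝓕.pd f = 0 := by rw [pd_apply, h, mul_zero]

lemma Inv.D_const {f : K} (h : 𝓕.Inv f 0 0) : J.D f = 0 := by rw [h.D]; ring

lemma OrdLE.const {μ : K} (h : J.D μ = 0) (N : ℕ) : J.OrdLE μ N := fun i _ =>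
  du_eq_zero_of_D h i

lemma ordLE_half (N : ℕ) : J.OrdLE (half K) N := fun _ _ => map_half _

lemma Inv.hasTop_η {F Fk Fq : K} (hF : 𝓕.Inv F Fk Fq) :
    J.HasTop (𝓕.η F) 9 (-𝓕.s * (𝓕.p * (𝓕.p * (𝓕.p * (Fq * (𝓕.p * 𝓕.κ)))))) := by
  have h1 := 𝓕.hasTop_pd (by norm_num) (𝓕.hasTop_pd (by norm_num)
    (𝓕.hasTop_pd (by norm_num) hF.hasTop))
  have h2 : J.OrdLE ((𝓕.k + 𝓕.τ) * 𝓕.pd F) 8 :=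
    (𝓕.hasTop_k.1.mono (by norm_num) |>.add (𝓕.ordLE_τ 8)).mul
      ((𝓕.ordLE_pd (by norm_num) hF.ordLE).mono (by norm_num))
  have h3 : J.OrdLE (half K * 𝓕.q * F) 8 :=
    ((ordLE_half 8).mul (𝓕.hasTop_q.1.mono (by norm_num))).mul
      (hF.ordLE.mono (by norm_num))
  exact (((h1.add h2.hasTop).add h3.hasTop).mul_left (𝓕.ordLE_s 8).neg).congr (by ring)

/-- If the density of the form `f ds` is conserved up to a factor depending on `t`, then `f` is
of the form `α(k) q`. -/
lemma eq_q_mul_of_conserved {F Fk Fq f fk fq μ w : K} (hF : 𝓕.Inv F Fk Fq) (hf : 𝓕.Inv f fk fq)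
    (hFq : IsUnit Fq) (hfu : IsUnit f) (hrel : ∀ e, 6 * Fq * J.d e f = -f * J.d e Fq)
    (hμ : J.D μ = 0)
    (h : fk * 𝓕.varK F + fq * (𝓕.η F * 𝓕.q + 𝓕.pd (𝓕.varK F)) - f * 𝓕.η F - μ * f = 𝓕.pd w) :
    f = 𝓕.q * fq ∧ ∃ m, 𝓕.Inv fq m 0 := by
  have hp8 : ∀ N, 3 ≤ N → J.OrdLE 𝓕.p N := fun N hN => 𝓕.ordLE_p.mono hN
  have hκ8 : ∀ N, 3 ≤ N → J.OrdLE 𝓕.κ N := fun N hN => 𝓕.ordLE_κ.mono hN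
  have hpu := 𝓕.isUnit_p
  have hκu := 𝓕.isUnit_κ
  have hsu := 𝓕.isUnit_s
  have hs0 := 𝓕.pd_s
  have hτ0 := 𝓕.pd_τ
  have hh0 : 𝓕.pd (half K) = 0 := map_half _
  obtain ⟨fkk, m, fqq, hfk, hfq⟩ := hf.exists_second
  obtain ⟨Fkk, Fm, Fqq, hFk, hFq'⟩ := hF.exists_second
  set η := 𝓕.η F with hη
  -- W is the variational derivative of f ds in k at fixed arc length. B also accounts for the
  -- variation of ds, so that integration by parts turns the law into η B - μ f being a derivative
  -- along the arc length.
  obtain ⟨W, hW⟩ : ∃ W, W = fk - 𝓕.pd fq := ⟨_, rfl⟩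
  obtain ⟨B, hB⟩ : ∃ B, B = 2 * 𝓕.pd (𝓕.pd W) + 2 * 𝓕.k * W + 𝓕.q * fq - f := ⟨_, rfl⟩
  have h1 : η * B + -(μ * f) =
      𝓕.pd (w - fq * 𝓕.varK F - 2 * (W * 𝓕.pd η) + 2 * (η * 𝓕.pd W)) := by
    simp only [map_add, map_sub, pd_mul, map_ofNat', ← h, hB, varK, ← hη]
    rw [hW]
    simp only [map_sub]
    ring
  have hC : ∀ N, 6 ≤ N → J.OrdLE (-(μ * f)) N := fun N hN =>
    ((OrdLE.const hμ N).mul (hf.ordLE.mono hN)).neg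
  have hWtop : J.HasTop W 7 (0 - 𝓕.p * (fqq * (𝓕.p * 𝓕.κ))) := by
    rw [hW]
    exact hfk.ordLE.hasTop.sub (𝓕.hasTop_pd (by norm_num) hfq.hasTop)
  have hlow : J.OrdLE (2 * 𝓕.k * W + 𝓕.q * fq - f) 8 :=
    ((((OrdLE.ofNat 2 8).mul (𝓕.hasTop_k.1.mono (by norm_num))).mul
      (hWtop.1.mono (by norm_num))).add
      ((𝓕.hasTop_q.1.mono (by norm_num)).mul (hfq.ordLE.mono (by norm_num)))).sub
      (hf.ordLE.mono (by norm_num))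
  have hBtop : J.HasTop B 9 (2 * (𝓕.p * (𝓕.p * (0 - 𝓕.p * (fqq * (𝓕.p * 𝓕.κ))))) + 0) := by
    have h2 := 𝓕.hasTop_pd (by norm_num) (𝓕.hasTop_pd (by norm_num) hWtop)
    rw [hB, show 2 * 𝓕.pd (𝓕.pd W) + 2 * 𝓕.k * W + 𝓕.q * fq - f =
      2 * 𝓕.pd (𝓕.pd W) + (2 * 𝓕.k * W + 𝓕.q * fq - f) by ring]
    exact (h2.mul_left (OrdLE.ofNat 2 8)).add hlow.hasTop
  have hFqo : ∀ N, 6 ≤ N → J.OrdLE Fq N := fun N hN => hFq'.ordLE.mono hN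
  obtain ⟨_, _, _, -, hfqq⟩ := hfq.exists_second
  have hp8' := hp8 8 (by norm_num)
  have hκ8' := hκ8 8 (by norm_num)
  -- Both η and B have order nine; the top coefficient of B is a unit multiple of f_qq, so f is
  -- affine in q.
  have e1 := mul_top_eq_zero hF.hasTop_η hBtop
    ((𝓕.ordLE_s 8).neg.mul (hp8'.mul (hp8'.mul (hp8'.mul ((hFqo 8 (by norm_num)).mul
      (hp8'.mul hκ8'))))))
    (((OrdLE.ofNat 2 8).mul (hp8'.mul (hp8'.mul ((OrdLE.zero 8).sub
      (hp8'.mul ((hfqq.ordLE.mono (by norm_num)).mul (hp8'.mul hκ8'))))))).add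
      (OrdLE.zero 8))
    (hC 8 (by norm_num)).hasTop hp8' hpu h1
  have hfqq0 : fqq = 0 := by
    have hu : IsUnit (2 * 𝓕.s * 𝓕.p ^ 8 * 𝓕.κ ^ 2 * Fq) :=
      (((isUnit_two.mul hsu).mul (hpu.pow 8)).mul (hκu.pow 2)).mul hFq
    refine (hu.mul_right_eq_zero).1 ?_
    linear_combination e1
  subst hfqq0
  obtain ⟨mk, mq, mqq, hm, h0⟩ := hfq.exists_second
  have hmq : mq = 0 := (h0.unique (inv_const (fun e => by simp))).1
  subst hmq
  have hWe : W = fk - m * 𝓕.q := by rw [hW, hfq.pd]; ring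
  have hWi : 𝓕.Inv W (fkk - 𝓕.q * mk) 0 := by
    rw [hWe]
    exact (hfk.sub (hm.mul inv_q)).congr rfl (by ring) (by ring)
  obtain ⟨Wk, hWk⟩ : ∃ Wk, Wk = fkk - 𝓕.q * mk := ⟨_, rfl⟩
  rw [← hWk] at hWi
  obtain ⟨_, _, _, hWki, -⟩ := hWi.exists_second
  -- Now W depends on k alone and B has order at most seven. Up to a term without derivatives of F,
  -- η is the derivative of -s G, and one integration by parts pairs G with the derivative of B,
  -- both of order eight.
  obtain ⟨G, hG⟩ : ∃ G, G = 𝓕.pd (𝓕.pd F) + (𝓕.k + 𝓕.τ) * F := ⟨_, rfl⟩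
  have hηG : η = -𝓕.s * (𝓕.pd G - half K * 𝓕.q * F) := by
    rw [hη, ProjFrame.η, hG]
    have hq : 𝓕.pd 𝓕.k = 𝓕.q := rfl
    simp only [map_add, pd_mul, hτ0, hq]
    linear_combination -(𝓕.s * 𝓕.q * F) * two_mul_half (K := K)
  have h2 : 𝓕.s * G * 𝓕.pd B + (𝓕.s * half K * 𝓕.q * F * B + -(μ * f)) =
      𝓕.pd (w - fq * 𝓕.varK F - 2 * (W * 𝓕.pd η) + 2 * (η * 𝓕.pd W) + 𝓕.s * (G * B)) := by
    rw [map_add, ← h1, hηG]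
    simp only [pd_mul, hs0]
    ring
  have hlow2 : J.OrdLE (2 * 𝓕.k * W + 𝓕.q * fq - f) 6 :=
    ((((OrdLE.ofNat 2 6).mul (𝓕.hasTop_k.1.mono (by norm_num))).mul
      (hWi.hasTop_five.1.mono (by norm_num))).add
      ((𝓕.hasTop_q.1.mono (by norm_num)).mul (hfq.ordLE.mono (by norm_num)))).sub
      (hf.ordLE.mono (by norm_num))
  have hBtop2 : J.HasTop B 7 (2 * (𝓕.p * (𝓕.p * (Wk * 𝓕.κ))) + 0) := by
    have h2 := 𝓕.hasTop_pd (by norm_num) (𝓕.hasTop_pd (by norm_num) hWi.hasTop_five)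
    rw [hB, show 2 * 𝓕.pd (𝓕.pd W) + 2 * 𝓕.k * W + 𝓕.q * fq - f =
      2 * 𝓕.pd (𝓕.pd W) + (2 * 𝓕.k * W + 𝓕.q * fq - f) by ring]
    exact (h2.mul_left (OrdLE.ofNat 2 6)).add hlow2.hasTop
  have hFo : ∀ N, 6 ≤ N → J.OrdLE F N := fun N hN => hF.ordLE.mono hN
  have hGtop : J.HasTop (𝓕.s * G) 8 (𝓕.s * (𝓕.p * (𝓕.p * (Fq * (𝓕.p * 𝓕.κ))) + 0)) := by
    have h2 := 𝓕.hasTop_pd (by norm_num) (𝓕.hasTop_pd (by norm_num) hF.hasTop)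
    rw [hG]
    exact (h2.add (((𝓕.hasTop_k.1.mono (by norm_num) : J.OrdLE 𝓕.k 7).add (𝓕.ordLE_τ 7)).mul
      (hFo 7 (by norm_num))).hasTop).mul_left (𝓕.ordLE_s 7)
  have hp7 := hp8 7 (by norm_num)
  have hκ7 := hκ8 7 (by norm_num)
  -- This pairing has top coefficient proportional to W_k, so W is constant.
  have e2 := mul_top_eq_zero hGtop (𝓕.hasTop_pd (by norm_num) hBtop2)
    ((𝓕.ordLE_s 7).mul ((hp7.mul (hp7.mul ((hFqo 7 (by norm_num)).mul
      (hp7.mul hκ7)))).add (OrdLE.zero 7)))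
    (hp7.mul (((OrdLE.ofNat 2 7).mul (hp7.mul (hp7.mul ((hWki.ordLE.mono (by norm_num)).mul
      hκ7)))).add (OrdLE.zero 7)))
    ((((((𝓕.ordLE_s 7).mul (ordLE_half 7)).mul (𝓕.hasTop_q.1.mono (by norm_num))).mul
      (hFo 7 (by norm_num))).mul hBtop2.1).add (hC 7 (by norm_num))).hasTop hp7 hpu h2
  have hWk0 : Wk = 0 := by
    have hu : IsUnit (2 * 𝓕.s * 𝓕.p ^ 6 * 𝓕.κ ^ 2 * Fq) :=
      (((isUnit_two.mul hsu).mul (hpu.pow 6)).mul (hκu.pow 2)).mul hFq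
    refine (hu.mul_right_eq_zero).1 ?_
    linear_combination e2
  rw [hWk0] at hWi
  have hWD := hWi.D_const
  have hWpd : 𝓕.pd W = 0 := pd_eq_zero_of_D hWD
  obtain ⟨B0, hB0⟩ : ∃ B0, B0 = f - 𝓕.q * fq := ⟨_, rfl⟩
  have hB0i : 𝓕.Inv B0 W 0 := by
    rw [hB0]
    exact (hf.sub (inv_q.mul hfq)).congr rfl (by rw [hWe]; ring) (by ring)
  have hBe : B = 2 * 𝓕.k * W - B0 := by
    rw [hB, hWpd, map_zero, hB0]; ring
  have hBpd : 𝓕.pd B = W * 𝓕.q := by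
    rw [hBe, map_sub, pd_mul, pd_mul, map_ofNat', hB0i.pd, hWpd, ← q]; ring
  have hBo : J.OrdLE B 6 := by
    rw [hBe]
    exact (((OrdLE.ofNat 2 6).mul (𝓕.hasTop_k.1.mono (by norm_num))).mul
      (OrdLE.const hWD 6)).sub hB0i.ordLE
  -- With W constant the derivative of B is W q. Integrating by parts once more pairs the
  -- derivatives of q and F, both of order seven, which forces W = 0.
  have h3 : -W * 𝓕.s * 𝓕.pd 𝓕.q * 𝓕.pd F + (W * 𝓕.s * 𝓕.q * ((𝓕.k + 𝓕.τ) * F) +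
      𝓕.s * half K * 𝓕.q * F * B + -(μ * f)) =
      𝓕.pd (w - fq * 𝓕.varK F - 2 * (W * 𝓕.pd η) + 2 * (η * 𝓕.pd W) + 𝓕.s * (G * B) -
        W * (𝓕.s * (𝓕.q * 𝓕.pd F))) := by
    rw [map_sub, ← h2, hBpd, hG]
    simp only [pd_mul, hs0, hWpd]
    ring
  have hp6 := hp8 6 (by norm_num)
  have hκ6 := hκ8 6 (by norm_num)
  have hqtop : J.HasTop (-W * 𝓕.s * 𝓕.pd 𝓕.q) 7 (-W * 𝓕.s * (𝓕.p * (𝓕.p * 𝓕.κ))) :=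
    (𝓕.hasTop_pd (by norm_num) 𝓕.hasTop_q).mul_left ((OrdLE.const hWD 6).neg.mul (𝓕.ordLE_s 6))
  have e3 := mul_top_eq_zero hqtop (𝓕.hasTop_pd (by norm_num) hF.hasTop)
    (((OrdLE.const hWD 6).neg.mul (𝓕.ordLE_s 6)).mul (hp6.mul (hp6.mul hκ6)))
    (hp6.mul ((hFqo 6 le_rfl).mul (hp6.mul hκ6)))
    ((((((OrdLE.const hWD 6).mul (𝓕.ordLE_s 6)).mul 𝓕.hasTop_q.1).mul
      (((𝓕.hasTop_k.1.mono (by norm_num)).add (𝓕.ordLE_τ 6)).mul hF.ordLE)).add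
      (((((𝓕.ordLE_s 6).mul (ordLE_half 6)).mul 𝓕.hasTop_q.1).mul hF.ordLE).mul hBo)).add
      (hC 6 le_rfl)).hasTop hp6 hpu h3
  have hW0 : W = 0 := by
    have hu : IsUnit (𝓕.s * 𝓕.p ^ 4 * 𝓕.κ ^ 2 * Fq) :=
      ((hsu.mul (hpu.pow 4)).mul (hκu.pow 2)).mul hFq
    refine (hu.mul_right_eq_zero).1 ?_
    linear_combination -e3
  rw [hW0] at hB0i
  have hL : -𝓕.s * half K * B0 * (𝓕.q * F) - μ * f = 𝓕.p * J.D
      (w - fq * 𝓕.varK F - 2 * (W * 𝓕.pd η) + 2 * (η * 𝓕.pd W) + 𝓕.s * (G * B)) := by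
    rw [← pd_apply, ← h2, hBpd, hBe, hW0]
    ring
  have hB0c : ∀ i, J.du i B0 = 0 := fun i => by rw [hB0i]; ring
  have hμc : ∀ i, J.du i μ = 0 := fun i => du_eq_zero_of_D hμ i
  have hsc : J.du 6 𝓕.s = 0 := 𝓕.ordLE_s 5 6 (by norm_num)
  have hpκ : J.du 6 (𝓕.p * 𝓕.κ) = 0 := (𝓕.ordLE_p.mul 𝓕.ordLE_κ) 6 (by norm_num)
  -- What remains has order six and must be affine in u_6. As f is affine in q, the μ-term drops out
  -- of the second derivative.
  have e4 := du_du_eq_zero (N := 5) (((((𝓕.ordLE_s 6).neg.mul (ordLE_half 6)).mul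
    (fun i _ => hB0c i : J.OrdLE B0 6)).mul (𝓕.hasTop_q.1.mul hF.ordLE)).sub
    ((OrdLE.const hμ 6).mul hf.ordLE)) (hp8 5 (by norm_num)) hpu hL
  have e5 : B0 * (2 * Fq + 𝓕.q * Fqq) = 0 := by
    have hu : IsUnit (𝓕.s * half K * (𝓕.p * 𝓕.κ) ^ 2) :=
      (hsu.mul isUnit_half).mul ((hpu.mul hκu).pow 2)
    refine (hu.mul_right_eq_zero).1 ?_
    simp only [map_sub, map_add, map_neg, map_zero, Derivation.leibniz, hB0c, hμc, hsc, map_half,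
      𝓕.hasTop_q.2, hF.hasTop.2, hf.hasTop.2, hfq.hasTop.2, hFq'.hasTop.2, hpκ, smul_eq_mul] at e4
    linear_combination -e4
  have e6 : 6 * Fq * fq = -f * Fqq := by
    have h6 := hrel (.u 6)
    rw [hf.hasTop.2, hFq'.hasTop.2] at h6
    refine ((hpu.mul hκu).mul_left_inj).1 ?_
    linear_combination h6
  -- Here f^6 F_q being constant enters: 2 F_q + q F_qq = 0 would mean f = 3 q f_q. Since the ring
  -- may have zero divisors, the constant B0 is kept as a factor; differentiating in u_6 then gives
  -- B0 f_q = 0, hence B0 f = 0.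
  have e7 : B0 * (B0 - 2 * 𝓕.q * fq) = 0 := by
    refine ((isUnit_two.mul hFq).mul_right_eq_zero).1 ?_
    rw [hB0] at e5 ⊢
    linear_combination f * e5 - 𝓕.q * (f - 𝓕.q * fq) * e6
  have e8 : B0 * fq = 0 := by
    have h6 := congrArg (J.du 6) e7
    simp only [map_sub, Derivation.leibniz, hB0c, map_ofNat', 𝓕.hasTop_q.2, hfq.hasTop.2,
      map_zero, smul_eq_mul] at h6
    refine ((isUnit_two.mul (hpu.mul hκu)).mul_right_eq_zero).1 ?_
    linear_combination -h6
  have e9 : B0 = 0 := by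
    refine (hfu.mul_left_eq_zero).1 ?_
    have : f = B0 + 𝓕.q * fq := by rw [hB0]; ring
    rw [this]
    linear_combination e7 + 3 * 𝓕.q * e8
  exact ⟨by linear_combination e9 - hB0, m, hfq⟩

end ProjFrame

end JetAlgebra
end

/-! ### Curvature as independent variable, and gauge transformations of symbols. -/

noncomputable section

open Polynomial

namespace WKB

variable {K : Type*} [CommRing K] [Algebra ℝ K]

/-- The correction of `δ` by a multiple of `θ` that annihilates `k`, where `α * θ k = 1`. -/
def freeze (θ : Derivation ℝ K K) (α k : K) (δ : Derivation ℝ K K) : Derivation ℝ K K :=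
  δ - (α * δ k) • θ

section freeze

variable {θ δ : Derivation ℝ K K} {α k : K}

lemma freeze_apply (f : K) : freeze θ α k δ f = δ f - α * δ k * θ f := rfl

lemma freeze_self (h : α * θ k = 1) : freeze θ α k δ k = 0 := by
  rw [freeze_apply]
  linear_combination -(δ k) * h

lemma map_theta_eq_zero (h : α * θ k = 1) {δ' : Derivation ℝ K K} (hα : δ' α = 0) :
    δ' (θ k) = 0 := by
  rw [Derivation.leibniz_of_mul_eq_one δ' ((mul_comm _ _).trans h), hα, smul_zero]

variable {D : Derivation ℝ K K} {r : K}

/-- The commutator of θ = r D with the frozen field is a multiple of θ. It annihilates k, because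
the frozen field annihilates both k and θ k = 1/α. As θ k is a unit, the multiple is zero, which
reads as a formula for δ r. -/
lemma map_rescaling (hr : IsUnit r) (hθ : θ = r • D) (hD : ∀ f, D (δ f) = δ (D f))
    (h : α * θ k = 1) (hα : freeze θ α k δ α = 0) : δ r = -(r * θ (α * δ k)) := by
  obtain ⟨r', hr'⟩ := hr.exists_right_inv
  have h1 : ∀ f, θ f = r * D f := fun f => by rw [hθ]; rfl
  have h2 := map_theta_eq_zero h hα
  have h3 : θ (freeze θ α k δ k) = 0 := by rw [freeze_self h, map_zero]
  rw [freeze_apply, map_sub, Derivation.leibniz θ (α * δ k)] at h3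
  rw [freeze_apply] at h2
  have h4 : θ (δ k) = r * δ (D k) := by rw [h1, hD]
  have h5 : δ (θ k) = r * δ (D k) + D k * δ r := by
    rw [h1, Derivation.leibniz]; rfl
  simp only [smul_eq_mul] at h3
  linear_combination (-α * r) * (h3 - h2 - h4 + h5) - (δ r + r * θ (α * δ k)) * h +
    α * δ r * h1 k

lemma freeze_comm (hr : IsUnit r) (hθ : θ = r • D) (hD : ∀ f, D (δ f) = δ (D f))
    (h : α * θ k = 1) (hα : freeze θ α k δ α = 0) (f : K) :
    θ (freeze θ α k δ f) = freeze θ α k δ (θ f) := by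
  have h1 : ∀ f, θ f = r * D f := fun f => by rw [hθ]; rfl
  have h2 := map_rescaling hr hθ hD h hα
  have h3 : θ (δ f) = r * δ (D f) := by rw [h1, hD]
  have h4 : δ (θ f) = r * δ (D f) + D f * δ r := by rw [h1, Derivation.leibniz]; rfl
  rw [freeze_apply, freeze_apply, map_sub, Derivation.leibniz θ (α * δ k), h3, h4]
  simp only [smul_eq_mul]
  linear_combination (-D f) * h2 - θ (α * δ k) * h1 f

/-- The same argument: the commutator of two frozen fields is a multiple of θ that annihilates k. -/
lemma freeze_freeze_comm {δ' : Derivation ℝ K K} (h : α * θ k = 1)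
    (h1 : ∀ f, θ (freeze θ α k δ f) = freeze θ α k δ (θ f))
    (h2 : ∀ f, θ (freeze θ α k δ' f) = freeze θ α k δ' (θ f))
    (hcomm : ∀ f, δ (δ' f) = δ' (δ f)) (f : K) :
    freeze θ α k δ (freeze θ α k δ' f) = freeze θ α k δ' (freeze θ α k δ f) := by
  set d := freeze θ α k δ with hd
  set d' := freeze θ α k δ' with hd'
  set X := α * δ k with hX
  set X' := α * δ' k with hX'
  have e1 : ∀ f, δ f = d f + X * θ f := fun f => by rw [hd, freeze_apply]; ring
  have e2 : ∀ f, δ' f = d' f + X' * θ f := fun f => by rw [hd', freeze_apply]; ring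
  have key : ∀ f, d (d' f) - d' (d f) =
      -(d X' - d' X + X * θ X' - X' * θ X) * θ f := by
    intro f
    have h3 := hcomm f
    rw [e1 f, e2 f, e1, e2] at h3
    simp only [map_add, Derivation.leibniz, smul_eq_mul, h1, h2] at h3
    linear_combination h3
  have h4 := key k
  rw [hd, hd', freeze_self h, freeze_self h, map_zero, map_zero, sub_zero, ← hd, ← hd'] at h4
  rw [← sub_eq_zero, key]
  linear_combination (-α * θ f) * h4 + (-(d X' - d' X + X * θ X' - X' * θ X) * θ f) * (-h)

end freeze

/-! ### Gauge transformations of symbols -/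

/-- The symbol of `e (θ + γ) P`. -/
def gaugeStep (θ : Derivation ℝ K K) (e γ : K) (P : K[X]) : K[X] :=
  C e * (coeffDer θ P + X * P + C γ * P)

section gaugeStep

variable {θ : Derivation ℝ K K} {e γ : K}

lemma ev_gaugeStep (P : K[X]) (h : K) : ev (θ : Module.End ℝ K) (gaugeStep θ e γ P) h =
    e * (θ (ev (θ : Module.End ℝ K) P h) + γ * ev (θ : Module.End ℝ K) P h) := by
  have h1 : gaugeStep θ e γ P = e • (symbolOp θ P + γ • P) := by
    rw [gaugeStep, symbolOp_apply, smul_eq_C_mul, smul_eq_C_mul]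
  have hΔ : ∀ c w : K, (θ : Module.End ℝ K) (c • w) = c • (θ : Module.End ℝ K) w + θ c • w := by
    intro c w
    simp [Derivation.leibniz, mul_comm]
  rw [h1, map_smul, map_add, map_smul, Pi.smul_apply, Pi.add_apply, Pi.smul_apply,
    ev_symbolOp θ _ hΔ]
  rfl

lemma coeff_gaugeStep (P : K[X]) (i : ℕ) : (gaugeStep θ e γ P).coeff (i + 1) =
    e * (θ (P.coeff (i + 1)) + P.coeff i + γ * P.coeff (i + 1)) := by
  rw [gaugeStep, coeff_C_mul, coeff_add, coeff_add, coeff_coeffDer, coeff_X_mul, coeff_C_mul]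

lemma coeff_gaugeStep_zero (P : K[X]) : (gaugeStep θ e γ P).coeff 0 =
    e * (θ (P.coeff 0) + γ * P.coeff 0) := by
  rw [gaugeStep, coeff_C_mul, coeff_add, coeff_add, coeff_coeffDer, mul_coeff_zero X, coeff_X_zero,
    coeff_C_mul, zero_mul, add_zero]

lemma natDegree_gaugeStep {P : K[X]} {N : ℕ} (h : P.natDegree ≤ N) :
    (gaugeStep θ e γ P).natDegree ≤ N + 1 := by
  rw [natDegree_le_iff_coeff_eq_zero] at h ⊢
  intro i hi
  obtain ⟨i, rfl⟩ : ∃ j, i = j + 1 := ⟨i - 1, by omega⟩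
  rw [coeff_gaugeStep, h i (by omega), h (i + 1) (by omega), map_zero]
  ring

lemma ev_one (h : K) : ev (θ : Module.End ℝ K) (1 : K[X]) h = h := by
  rw [← C_1, ← monomial_zero_left, ev_monomial, one_smul, pow_zero, Module.End.one_apply]

lemma ev_C_mul (c : K) (P : K[X]) (h : K) :
    ev (θ : Module.End ℝ K) (C c * P) h = c * ev (θ : Module.End ℝ K) P h := by
  rw [← smul_eq_C_mul, map_smul]; rfl

lemma ev_add (P Q : K[X]) (h : K) : ev (θ : Module.End ℝ K) (P + Q) h =
    ev (θ : Module.End ℝ K) P h + ev (θ : Module.End ℝ K) Q h := by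
  rw [map_add]; rfl

/-- Gauge steps represent conjugated derivations. -/
lemma apply_mul_ev {δ : Derivation ℝ K K} {G : K} (hδ : ∀ f, δ f = e * θ f) (hG : θ G = γ * G)
    (P : K[X]) (h : K) : δ (G * ev (θ : Module.End ℝ K) P h) =
      G * ev (θ : Module.End ℝ K) (gaugeStep θ e γ P) h := by
  rw [ev_gaugeStep, hδ, Derivation.leibniz, hG, smul_eq_mul, smul_eq_mul]
  ring

/-- Conjugation by G and the change from δ to θ preserve the order of an operator and multiply its
leading coefficient by e^n. -/
lemma exists_gauge {δ : Derivation ℝ K K} {G : K} (hδ : ∀ f, δ f = e * θ f)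
    (hG : θ G = γ * G) {a : K[X]} {n : ℕ} (ha : a.natDegree ≤ n) :
    ∃ b : K[X], b.natDegree ≤ n ∧ b.coeff n = a.coeff n * e ^ n ∧
      ∀ h, ev (δ : Module.End ℝ K) a (G * h) = G * ev (θ : Module.End ℝ K) b h := by
  have hpow : ∀ i : ℕ, ∃ P : K[X], P.natDegree ≤ i ∧ P.coeff i = e ^ i ∧
      ∀ h, ((δ : Module.End ℝ K) ^ i) (G * h) = G * ev (θ : Module.End ℝ K) P h := by
    intro i
    induction i with
    | zero => exact ⟨1, by simp, by simp, fun h => by rw [ev_one]; rfl⟩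
    | succ i ih =>
      obtain ⟨P, h1, h2, h3⟩ := ih
      refine ⟨gaugeStep θ e γ P, natDegree_gaugeStep h1, ?_, fun h => ?_⟩
      · rw [coeff_gaugeStep, h2, coeff_eq_zero_of_natDegree_lt (by omega), map_zero]
        ring
      · rw [pow_succ', Module.End.mul_apply, h3]
        exact apply_mul_ev hδ hG P h
  choose P h1 h2 h3 using hpow
  refine ⟨∑ i ∈ Finset.range (n + 1), C (a.coeff i) * P i, ?_, ?_, fun h => ?_⟩
  · refine natDegree_sum_le_of_forall_le _ _ fun i hi => ?_
    refine (natDegree_C_mul_le _ _).trans ((h1 i).trans ?_)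
    have := Finset.mem_range.1 hi
    omega
  · rw [finsetSum_coeff, Finset.sum_range_succ, Finset.sum_eq_zero, zero_add, coeff_C_mul, h2]
    intro i hi
    have := Finset.mem_range.1 hi
    rw [coeff_C_mul, coeff_eq_zero_of_natDegree_lt ((h1 i).trans_lt this), mul_zero]
  · rw [ev_eq_sum _ ha, map_sum, Finset.sum_apply, Finset.mul_sum]
    refine Finset.sum_congr rfl fun i _ => ?_
    rw [ev_C_mul, h3, smul_eq_mul]
    ring

/-- The three leading coefficients of a gauge step. -/
lemma gaugeStep_leading {P : K[X]} {j : ℕ} {E b c w : K} (hP : P.natDegree ≤ j + 2)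
    (h2 : P.coeff (j + 2) = E) (h1 : P.coeff (j + 1) = E * b) (h0 : P.coeff j = E * c)
    (hE : θ E = E * w) :
    (gaugeStep θ e γ P).natDegree ≤ j + 1 + 2 ∧
    (gaugeStep θ e γ P).coeff (j + 1 + 2) = E * e ∧
    (gaugeStep θ e γ P).coeff (j + 1 + 1) = E * e * (b + w + γ) ∧
    (gaugeStep θ e γ P).coeff (j + 1) = E * e * (c + θ b + (w + γ) * b) := by
  refine ⟨natDegree_gaugeStep hP, ?_, ?_, ?_⟩
  · rw [show j + 1 + 2 = j + 2 + 1 by ring, coeff_gaugeStep, h2,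
      coeff_eq_zero_of_natDegree_lt (by omega), map_zero]
    ring
  · rw [coeff_gaugeStep, h1, show j + 1 + 1 = j + 2 by ring, h2, hE]
    ring
  · rw [coeff_gaugeStep, h1, h0, Derivation.leibniz, hE, smul_eq_mul, smul_eq_mul]
    ring

end gaugeStep

end WKB
end

/-! ### The three leading coefficients of the linearized equation. -/

noncomputable section

open Polynomial

namespace JetAlgebra

namespace ProjFrame

open WKB

variable {K : Type*} [CommRing K] [Algebra ℝ K] {J : JetAlgebra K} {𝓕 : ProjFrame J}

/-- The symbol of the linearized equation in an arbitrary parametrization and gauge. -/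
lemma exists_linearization {F Fk Fq e γ g w ē : K} {θ : Derivation ℝ K K}
    (hF : 𝓕.Inv F Fk Fq) (hpd : ∀ f, 𝓕.pd f = e * θ f) (hg : θ g = γ * g) (he : θ e = e * w)
    (hē : ē * e = 1) :
    ∃ l : K[X], l.natDegree ≤ 6 ∧
      l.coeff 6 = -2 * 𝓕.s * Fq * e ^ 6 ∧
      l.coeff 5 = -2 * 𝓕.s * Fq * e ^ 6 * (15 * w + 6 * γ) - 2 * 𝓕.s * Fk * e ^ 5 ∧
      l.coeff 4 = -2 * 𝓕.s * Fq * e ^ 6 * (20 * θ w + 15 * θ γ + 85 * w ^ 2 + 75 * w * γ +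
        15 * γ ^ 2 + (2 * 𝓕.k + 𝓕.τ) * ē ^ 2) - 2 * 𝓕.s * Fk * e ^ 5 * (10 * w + 5 * γ) ∧
      ∀ h, J.evol (J.u 1 * 𝓕.p * (g * h)) (J.u 1 * 𝓕.p * F) =
        J.u 1 * 𝓕.p * g * ev (θ : Module.End ℝ K) l h := by
  have hs : θ 𝓕.s = 0 := by
    have h1 := 𝓕.pd_s
    rw [hpd] at h1
    linear_combination ē * h1 - θ 𝓕.s * hē
  have n2 : θ (2 : K) = 0 := map_ofNat' θ 2
  have n3 : θ (3 : K) = 0 := map_ofNat' θ 3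
  have n6 : θ (6 : K) = 0 := map_ofNat' θ 6
  have n4 : θ (4 : K) = 0 := map_ofNat' θ 4
  have n10 : θ (10 : K) = 0 := map_ofNat' θ 10
  have n5 : θ (5 : K) = 0 := map_ofNat' θ 5
  have n15 : θ (15 : K) = 0 := map_ofNat' θ 15
  set δ := gaugeStep θ e γ with hδ
  -- B1, B2, B3 are the symbols of h ↦ ∂(g h), ∂²(g h), ∂³(g h) divided by g, with ∂ = `pd`. From
  -- them come H for the variation of p, V for that of k and V1 for the arc length derivative of V.
  set B1 := δ 1 with hB1
  have b1 : B1.natDegree ≤ 1 := natDegree_gaugeStep (by simp)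
  have b11 : B1.coeff 1 = e := by
    rw [hB1, hδ, coeff_gaugeStep, coeff_one, coeff_one]; simp
  have b10 : B1.coeff 0 = e * γ := by
    rw [hB1, hδ, coeff_gaugeStep_zero, coeff_one]; simp
  set B2 := δ B1 with hB2
  have b2 : B2.natDegree ≤ 0 + 2 := natDegree_gaugeStep b1
  have b22 : B2.coeff (0 + 2) = e ^ 2 := by
    rw [hB2, hδ, coeff_gaugeStep, b11, coeff_eq_zero_of_natDegree_lt (by omega), map_zero]
    ring
  have b21 : B2.coeff (0 + 1) = e ^ 2 * (w + 2 * γ) := by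
    rw [hB2, hδ, coeff_gaugeStep, b11, b10, he]
    ring
  have b20 : B2.coeff 0 = e ^ 2 * (θ γ + (w + γ) * γ) := by
    rw [hB2, hδ, coeff_gaugeStep_zero, b10, Derivation.leibniz, he, smul_eq_mul, smul_eq_mul]
    ring
  have hE2 : θ (e ^ 2) = e ^ 2 * (2 * w) := by
    rw [Derivation.leibniz_pow, he]; simp; ring
  obtain ⟨b3, b33, b32, b31⟩ := gaugeStep_leading (e := e) (γ := γ) b2 b22 b21 b20 hE2
  set B3 := δ B2 with hB3
  rw [← hδ, ← hB3] at b3 b33 b32 b31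
  set H := C (-𝓕.s) * (B3 + C (𝓕.k + 𝓕.τ) * B1 + C (half K * 𝓕.q)) with hH
  have c3 : H.natDegree ≤ 1 + 2 := by
    refine (natDegree_C_mul_le _ _).trans ((natDegree_add_le _ _).trans (max_le
      ((natDegree_add_le _ _).trans (max_le (by omega)
        ((natDegree_C_mul_le _ _).trans (by omega)))) (by rw [natDegree_C]; omega)))
  have c33 : H.coeff (1 + 2) = -𝓕.s * e ^ 3 := by
    rw [hH, coeff_C_mul, coeff_add, coeff_add, coeff_C_mul, coeff_C, if_neg (by omega),
      coeff_eq_zero_of_natDegree_lt (p := B1) (by omega)]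
    linear_combination (-𝓕.s) * b33
  have c32 : H.coeff (1 + 1) = -𝓕.s * e ^ 3 * (3 * w + 3 * γ) := by
    rw [hH, coeff_C_mul, coeff_add, coeff_add, coeff_C_mul, coeff_C, if_neg (by omega),
      coeff_eq_zero_of_natDegree_lt (p := B1) (by omega)]
    linear_combination (-𝓕.s) * b32
  have c31 : H.coeff 1 = -𝓕.s * e ^ 3 * (θ w + 3 * θ γ + 2 * w ^ 2 + 6 * w * γ + 3 * γ ^ 2 +
      (𝓕.k + 𝓕.τ) * ē ^ 2) := by
    rw [hH, coeff_C_mul, coeff_add, coeff_add, coeff_C_mul, coeff_C, if_neg (by omega), b11]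
    simp only [map_add, Derivation.leibniz, n2, smul_eq_mul] at b31
    linear_combination (-𝓕.s) * b31 + 𝓕.s * (𝓕.k + 𝓕.τ) * e * (ē * e + 1) * hē
  have hE3 : ∀ (c : K) (n : ℕ), θ c = 0 →
      θ (c * e ^ (n + 1)) = c * e ^ (n + 1) * ((n + 1) * w) := by
    intro c n hc
    rw [Derivation.leibniz, hc, Derivation.leibniz_pow, he]
    simp
    ring
  have hs' : θ (-𝓕.s) = 0 := by rw [map_neg, hs, neg_zero]
  obtain ⟨d4, d44, d43, d42⟩ := gaugeStep_leading (e := e) (γ := γ) c3 c33 c32 c31 (hE3 _ 2 hs')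
  set H1 := δ H with hH1
  rw [← hδ, ← hH1] at d4 d44 d43 d42
  simp only [map_add, Derivation.leibniz, n3, smul_eq_mul] at d42
  obtain ⟨d5, d55, d54, d53⟩ := gaugeStep_leading (e := e) (γ := γ) (E := -𝓕.s * e ^ (3 + 1))
    (b := 6 * w + 4 * γ) (c := 4 * θ w + 6 * θ γ + 11 * w ^ 2 + 18 * w * γ + 6 * γ ^ 2 +
      (𝓕.k + 𝓕.τ) * ē ^ 2) d4 (d44.trans (by ring)) (d43.trans (by push_cast; ring))
    (d42.trans (by push_cast; ring)) (hE3 _ 3 hs')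
  set H2 := δ H1 with hH2
  rw [← hδ, ← hH2] at d5 d55 d54 d53
  set V := C 2 * H2 + C (2 * 𝓕.k) * H with hV
  have v5 : V.natDegree ≤ 3 + 2 := (natDegree_add_le _ _).trans (max_le
    ((natDegree_C_mul_le _ _).trans (by omega)) ((natDegree_C_mul_le _ _).trans (by omega)))
  have v55 : V.coeff (3 + 2) = -2 * 𝓕.s * e ^ (4 + 1) := by
    rw [hV, coeff_add, coeff_C_mul, coeff_C_mul, coeff_eq_zero_of_natDegree_lt (p := H) (by omega)]
    linear_combination 2 * d55
  have v54 : V.coeff (3 + 1) = -2 * 𝓕.s * e ^ (4 + 1) * (10 * w + 5 * γ) := by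
    rw [hV, coeff_add, coeff_C_mul, coeff_C_mul, coeff_eq_zero_of_natDegree_lt (p := H) (by omega)]
    push_cast at d54
    linear_combination 2 * d54
  have v53 : V.coeff 3 = -2 * 𝓕.s * e ^ (4 + 1) * (10 * θ w + 10 * θ γ + 35 * w ^ 2 +
      40 * w * γ + 10 * γ ^ 2 + (2 * 𝓕.k + 𝓕.τ) * ē ^ 2) := by
    simp only [map_add, Derivation.leibniz, n6, n4, smul_eq_mul] at d53
    rw [hV, coeff_add, coeff_C_mul, coeff_C_mul]
    push_cast at d53
    linear_combination 2 * d53 + 2 * 𝓕.k * c33 + 2 * 𝓕.s * 𝓕.k * e ^ 3 * (ē * e + 1) * hē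
  have hs2 : θ (-2 * 𝓕.s) = 0 := by
    rw [Derivation.leibniz, hs, map_neg, n2]; simp
  obtain ⟨f6, f66, f65, f64⟩ := gaugeStep_leading (e := e) (γ := γ) v5 v55 v54 v53 (hE3 _ 4 hs2)
  set V1 := δ V with hV1
  rw [← hδ, ← hV1] at f6 f66 f65 f64
  clear_value V H
  have ev1 : ∀ P h, 𝓕.pd (g * ev (θ : Module.End ℝ K) P h) =
      g * ev (θ : Module.End ℝ K) (δ P) h := apply_mul_ev hpd hg
  have ev0 : ∀ h, 𝓕.pd (g * h) = g * ev (θ : Module.End ℝ K) B1 h := fun h => by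
    rw [hB1, ← ev1, ev_one]
  have evC : ∀ (c h : K), ev (θ : Module.End ℝ K) (C c) h = c * h := fun c h => by
    rw [← mul_one (C c), ev_C_mul, ev_one]
  have evH : ∀ h, 𝓕.η (g * h) = g * ev (θ : Module.End ℝ K) H h := fun h => by
    rw [η, ev0, ev1, ev1, hH, ev_C_mul, ev_add, ev_add, ev_C_mul, evC, ← hB2, ← hB3]
    ring
  have evV : ∀ h, 𝓕.varK (g * h) = g * ev (θ : Module.End ℝ K) V h := fun h => by
    rw [varK, evH, ev1, ev1, hV, ev_add, ev_C_mul, ev_C_mul, ← hH1, ← hH2]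
    ring
  refine ⟨C (F * (𝓕.v * J.u 2 * 𝓕.p + J.D 𝓕.p)) + C F * B1 + C (F + Fq * 𝓕.q) * H + C Fk * V +
    C Fq * V1, ?_, ?_, ?_, ?_, fun h => ?_⟩
  · refine (natDegree_add_le _ _).trans (max_le ((natDegree_add_le _ _).trans (max_le
      ((natDegree_add_le _ _).trans (max_le ((natDegree_add_le _ _).trans (max_le ?_ ?_)) ?_))
      ?_)) ?_)
    · rw [natDegree_C]; omega
    all_goals exact (natDegree_C_mul_le _ _).trans (by omega)
  · simp only [coeff_add, coeff_C_mul, coeff_C]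
    rw [if_neg (by omega), coeff_eq_zero_of_natDegree_lt (p := B1) (by omega),
      coeff_eq_zero_of_natDegree_lt (p := H) (by omega),
      coeff_eq_zero_of_natDegree_lt (p := V) (by omega)]
    linear_combination Fq * f66
  · simp only [coeff_add, coeff_C_mul, coeff_C]
    rw [if_neg (by omega), coeff_eq_zero_of_natDegree_lt (p := B1) (by omega),
      coeff_eq_zero_of_natDegree_lt (p := H) (by omega)]
    push_cast at f65
    linear_combination Fq * f65 + Fk * v55
  · simp only [coeff_add, coeff_C_mul, coeff_C]
    simp only [map_add, Derivation.leibniz, n10, n5, smul_eq_mul] at f64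
    rw [if_neg (by omega), coeff_eq_zero_of_natDegree_lt (p := B1) (by omega),
      coeff_eq_zero_of_natDegree_lt (p := H) (by omega)]
    push_cast at f64
    linear_combination Fq * f64 + Fk * v54
  · have hp := 𝓕.evol_p (g * h)
    have hk := 𝓕.evol_k (g * h)
    have hq := 𝓕.evol_q (g * h)
    rw [mul_assoc (J.u 1)] at hp hk hq
    rw [mul_assoc (J.u 1) 𝓕.p (g * h)] at *
    rw [Derivation.leibniz, Derivation.leibniz, hF.evol, hp, hk, hq, evol_u, evV, ev1, evH,
      ev_add, ev_add, ev_add, ev_add, evC, ev_C_mul, ev_C_mul, ev_C_mul, ev_C_mul, ← hV1]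
    have h1 := ev0 h
    rw [pd_apply] at h1
    simp only [Function.iterate_succ_apply', Function.iterate_zero, id_eq, Derivation.leibniz,
      smul_eq_mul, D_u] at h1 ⊢
    linear_combination (J.u 1 * 𝓕.p * F) * h1 - J.u 2 * 𝓕.p ^ 2 * g * h * F * 𝓕.hv

end ProjFrame

end JetAlgebra
end

/-! ### The zero curvature equation after gauging, and the shape of the separant. -/

noncomputable section

open Polynomial

namespace JetAlgebra

open WKB

variable {K : Type*} [CommRing K] [Algebra ℝ K] {J : JetAlgebra K}

/-- The commutator of the two flows is the evolutionary field of the defect of the symmetry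
condition. -/
lemma Dt_evol_of_symmetry {Ψ Q : K} (hsym : J.Dt Ψ Q = J.evol Q Ψ) (f : K) :
    J.Dt Ψ (J.evol Q f) = J.evol Q (J.Dt Ψ f) := by
  rw [← sub_eq_zero, J.Dt_evol, hsym, sub_self]
  refine J.comb_eq_zero _ _ _ rfl rfl (fun i => ?_) f
  induction i with
  | zero => rfl
  | succ i ih => rw [Function.iterate_succ_apply', ih, map_zero]

/-- The zero curvature equation in the gauge `G`, along the vector fields that annihilate `k`. -/
lemma exists_gauged_zero_curvature {Ψ Q G G' γ r r' α k : K} {n : ℕ} {θ : Derivation ℝ K K}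
    {l' : K[X]} (hn : 7 ≤ n) (hQ : J.OrdLE Q n) (hQn : IsUnit (J.du n Q))
    (hsym : J.Dt Ψ Q = J.evol Q Ψ) (hθ : θ = r • J.D) (hr : r' * r = 1) (hk : α * θ k = 1)
    (hαt : freeze θ α k (J.Dt Ψ) α = 0) (hαQ : freeze θ α k (J.evol Q) α = 0)
    (hG : θ G = γ * G) (hG' : G' * G = 1) (hl : l'.natDegree ≤ 6)
    (hl' : ∀ h, J.evol (G * h) Ψ = G * ev (θ : Module.End ℝ K) l' h) :
    ∃ l m : K[X], l.natDegree ≤ 6 ∧ (∀ i, 2 ≤ i → l.coeff i = l'.coeff i) ∧ m.natDegree ≤ n ∧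
      IsUnit (m.coeff n) ∧
      coeffDer (freeze θ α k (J.Dt Ψ)) m - coeffDer (freeze θ α k (J.evol Q)) l +
        star θ m l - star θ l m = 0 := by
  have hru : IsUnit r := IsUnit.of_mul_eq_one _ ((mul_comm _ _).trans hr)
  have hr'u : IsUnit r' := IsUnit.of_mul_eq_one _ hr
  have hGu : IsUnit G := IsUnit.of_mul_eq_one _ ((mul_comm _ _).trans hG')
  have hδ : ∀ f, J.D f = r' * θ f := fun f => by
    rw [hθ, Derivation.smul_apply, smul_eq_mul]
    linear_combination -(J.D f) * hr
  obtain ⟨m', hm, hmn, hm'⟩ := exists_gauge (G := G) (γ := γ) hδ hG (J.natDegree_symbol_le hQ)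
  have ht := freeze_comm hru hθ (J.D_Dt Ψ) hk hαt
  have hq := freeze_comm hru hθ (J.D_evol Q) hk hαQ
  set dt := freeze θ α k (J.Dt Ψ) with hdt
  set dQ := freeze θ α k (J.evol Q) with hdQ
  have hX : ∀ h, ev (θ : Module.End ℝ K) (X : K[X]) h = θ h := fun h => by
    rw [← monomial_one_one_eq_X, ev_monomial, one_smul, pow_one]; rfl
  have hC : ∀ c h : K, ev (θ : Module.End ℝ K) (C c) h = c * h := fun c h => by
    rw [← mul_one (C c), ev_C_mul, ev_one]
  have hsubst : ∀ (P : K[X]) (a b h : K), ev (θ : Module.End ℝ K) (P - C a * X - C b) h =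
      ev (θ : Module.End ℝ K) P h - a * θ h - b * h := fun P a b h => by
    rw [map_sub, map_sub, Pi.sub_apply, Pi.sub_apply, ev_C_mul, hX, hC]
  have hdeg : ∀ (P : K[X]) (a b : K) (N : ℕ), 1 ≤ N → P.natDegree ≤ N →
      (P - C a * X - C b).natDegree ≤ N := fun P a b N hN hP => by
    refine (natDegree_sub_le _ _).trans (max_le ((natDegree_sub_le _ _).trans (max_le hP ?_)) ?_)
    · exact (natDegree_C_mul_le _ _).trans (natDegree_X_le.trans hN)
    · rw [natDegree_C]; omega
  have hcoeff : ∀ (P : K[X]) (a b : K) (i : ℕ), 2 ≤ i →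
      (P - C a * X - C b).coeff i = P.coeff i := fun P a b i hi => by
    rw [coeff_sub, coeff_sub, coeff_C, if_neg (by omega), coeff_C_mul_X, if_neg (by omega)]
    ring
  -- Freezing k subtracts a multiple of θ from each flow, and the gauge adds a function. Both are
  -- absorbed into the coefficients of index 1 and 0, so those of index at least 2 are untouched.
  set l := l' - C (α * J.Dt Ψ k) * X - C (G' * J.Dt Ψ G) with hl0
  set m := m' - C (α * J.evol Q k) * X - C (G' * J.evol Q G) with hm0
  have hat : ∀ h, J.Dt Ψ (G * h) - J.evol (G * h) Ψ =
      G * (dt h - ev (θ : Module.End ℝ K) l h) := fun h => by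
    rw [hl', hl0, hsubst, Derivation.leibniz, hdt, freeze_apply, smul_eq_mul, smul_eq_mul]
    linear_combination -(h * J.Dt Ψ G) * hG'
  have haQ : ∀ h, J.evol Q (G * h) - J.evol (G * h) Q =
      G * (dQ h - ev (θ : Module.End ℝ K) m h) := fun h => by
    rw [← J.ev_symbol Q (G * h), hm', hm0, hsubst, Derivation.leibniz, hdQ, freeze_apply,
      smul_eq_mul,
      smul_eq_mul]
    linear_combination -(h * J.evol Q G) * hG'
  refine ⟨l, m, hdeg _ _ _ _ (by norm_num) hl, fun i hi => hcoeff _ _ _ _ hi,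
    hdeg _ _ _ _ (by omega) hm, ?_, ?_⟩
  · rw [hcoeff _ _ _ _ (by omega), hmn, coeff_symbol]
    exact hQn.mul (hr'u.pow n)
  · refine zero_curvature_symbol ht hq
      (freeze_freeze_comm hk ht hq (Dt_evol_of_symmetry hsym)) ?_ fun f => ?_
    · intro a ha
      exact J.symbol_eq_zero hru (by rw [← hθ]; exact ha)
    · have h1 := J.zero_curvature hsym (G * f)
      rw [haQ, hat, hat, haQ] at h1
      exact (hGu.mul_right_inj).1 h1

namespace ProjFrame

variable {𝓕 : ProjFrame J}

lemma Dt_eq_evol_of_inv {F Fk Fq : K} (hF : 𝓕.Inv F Fk Fq) (Ψ : K) : J.Dt Ψ F = J.evol Ψ F := by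
  rw [Dt_eq, hF, 𝓕.dt_k.1, 𝓕.dt_k.2]; ring

lemma Dt_inv {F f fk fq : K} (hf : 𝓕.Inv f fk fq) :
    J.Dt (J.u 1 * 𝓕.p * F) f = fk * 𝓕.varK F + fq * (𝓕.η F * 𝓕.q + 𝓕.pd (𝓕.varK F)) := by
  rw [Dt_eq_evol_of_inv hf, hf.evol, evol_k, evol_q]

lemma Dt_p (F : K) : J.Dt (J.u 1 * 𝓕.p * F) 𝓕.p = 𝓕.p * 𝓕.η F := by
  rw [Dt_eq, 𝓕.dt_p, evol_p, zero_add]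

lemma du_six {F Fk Fq : K} (hF : 𝓕.Inv F Fk Fq) :
    J.du 6 (J.u 1 * 𝓕.p * F) = -2 * 𝓕.s * 𝓕.p ^ 6 * Fq := by
  have h1 : J.OrdLE (J.u 1 * 𝓕.p) 5 :=
    ((OrdLE.u 1).mono (by omega)).mul (𝓕.ordLE_p.mono (by omega))
  rw [(hF.hasTop.mul_left h1).2, κ]
  linear_combination (-2 * 𝓕.s * 𝓕.p ^ 6 * Fq) * 𝓕.hv

lemma ordLE_rhs {F Fk Fq : K} (hF : 𝓕.Inv F Fk Fq) : J.OrdLE (J.u 1 * 𝓕.p * F) 6 :=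
  (((OrdLE.u 1).mono (by omega)).mul (𝓕.ordLE_p.mono (by omega))).mul hF.ordLE

/-- The separant of an equation with a symmetry of high order. -/
lemma eq_q_mul_of_symmetry {Q F Fk Fq f fk fq : K} {n : ℕ} (hn : 7 ≤ n) (hQ : J.OrdLE Q n)
    (hQn : IsUnit (J.du n Q)) (hF : 𝓕.Inv F Fk Fq) (hFq : IsUnit Fq)
    (hsym : J.Dt (J.u 1 * 𝓕.p * F) Q = J.evol Q (J.u 1 * 𝓕.p * F))
    (hf : 𝓕.Inv f fk fq) (hfu : IsUnit f) (hrel : ∀ e, 6 * Fq * J.d e f = -f * J.d e Fq) :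
    f = 𝓕.q * fq ∧ ∃ m, 𝓕.Inv fq m 0 := by
  -- The leading coefficient of L is -2 s p^6 F_q, so ρ = f/p makes l₆ ρ^6 constant, and the density
  -- ρ dx is f ds.
  have hε : ∀ e, J.d e (-2 * 𝓕.s * Fq * f ^ 6) = 0 := fun e => by
    have h2 := map_ofNat' (J.d e) 2
    have hs := 𝓕.map_s _ (𝓕.dτ e)
    simp only [Derivation.leibniz, Derivation.leibniz_pow, map_neg, h2, hs, smul_eq_mul,
      nsmul_eq_mul]
    push_cast
    linear_combination (-2 * 𝓕.s * f ^ 5) * hrel e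
  have hDε : J.D (-2 * 𝓕.s * Fq * f ^ 6) = 0 := by rw [(inv_const (𝓕 := 𝓕) hε).D]; ring
  have hlu : IsUnit (J.du 6 (J.u 1 * 𝓕.p * F)) := by
    rw [du_six hF]
    exact ((isUnit_two.neg.mul 𝓕.isUnit_s).mul (𝓕.isUnit_p.pow 6)).mul hFq
  obtain ⟨c, w, hc, hc0, h⟩ := conserved_leading (θ := J.D) (dt := J.Dt (J.u 1 * 𝓕.p * F))
    (dQ := J.evol Q) (l := J.symbol (J.u 1 * 𝓕.p * F)) (m := J.symbol Q) (ρ := f * 𝓕.π)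
    (ε := -2 * 𝓕.s * Fq * f ^ 6) hn
    (J.natDegree_symbol_le (ordLE_rhs hF)) (J.natDegree_symbol_le hQ)
    (zero_curvature_symbol (J.D_Dt _) (J.D_evol Q) (Dt_evol_of_symmetry hsym)
      (fun a ha => J.symbol_eq_zero isUnit_one (by rw [one_smul]; exact ha))
      (fun g => by simp only [ev_symbol]; exact J.zero_curvature hsym g))
    (by rw [coeff_symbol]; exact hlu) (by rw [coeff_symbol]; exact hQn)
    (hfu.mul 𝓕.isUnit_π) (by
      rw [coeff_symbol, du_six hF]
      have h1 := congrArg (· ^ 6) 𝓕.hp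
      simp only [mul_pow, one_pow] at h1
      linear_combination (-2 * 𝓕.s * Fq * f ^ 6) * h1) hDε
  -- With z = 1/(n c) the factor μ is 1/n times the logarithmic time derivative of c.
  obtain ⟨z, hz⟩ := ((isUnit_natCast (K := K) n (by omega)).mul hc).exists_left_inv
  have hz0 : J.D z = 0 := by
    rw [Derivation.leibniz_of_mul_eq_one _ hz, Derivation.leibniz, hc0, Derivation.map_natCast]
    simp
  refine eq_q_mul_of_conserved (μ := z * J.Dt (J.u 1 * 𝓕.p * F) c)
    (w := -6 * z * (-2 * 𝓕.s * Fq * f ^ 6) * w) hF hf hFq hfu hrel ?_ ?_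
  · rw [Derivation.leibniz, hz0, J.D_Dt, hc0, map_zero]; simp
  · have h6 := map_ofNat' J.D 6
    rw [← Dt_inv hf, pd_apply, Derivation.leibniz, Derivation.leibniz, hDε, Derivation.leibniz,
      hz0, map_neg, h6]
    rw [Derivation.leibniz, map_π, Dt_p] at h
    simp only [smul_eq_mul]
    linear_combination (z * 𝓕.p) * h + z * f * J.Dt (J.u 1 * 𝓕.p * F) c * 𝓕.hp -
      J.Dt (J.u 1 * 𝓕.p * F) f * (𝓕.p * 𝓕.π * hz + 𝓕.hp) +
      f * 𝓕.η F * (𝓕.p ^ 2 * 𝓕.π ^ 2 * hz + (𝓕.p * 𝓕.π + 1) * 𝓕.hp)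

end ProjFrame

end JetAlgebra
end

/-! ### Equations with separant governed by α(k) q, in the parametrization by k. -/

noncomputable section

open Polynomial

namespace JetAlgebra

namespace ProjFrame

open WKB

variable {K : Type*} [CommRing K] [Algebra ℝ K] {J : JetAlgebra K} {𝓕 : ProjFrame J}

/-- The data of an equation whose separant is `e ^ (-6)` with `e = α(k) q`, and the parametrization
`θ = e⁻¹ ∂`. -/
structure Separant (𝓕 : ProjFrame J) where
  F : K
  Fk : K
  Fq : K
  hF : 𝓕.Inv F Fk Fq
  hFq : IsUnit Fq
  e : K
  e' : K
  he' : e' * e = 1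
  α : K
  α' : K
  hα' : α' * α = 1
  m : K
  hα : 𝓕.Inv α m 0
  he : e = 𝓕.q * α
  hrel : ∀ i, 6 * Fq * J.d i e = -e * J.d i Fq

namespace Separant

variable (S : Separant 𝓕)

/-- Since e ds = α(k) q ds = α(k) dk, this is differentiation with respect to k up to a factor
depending on k alone. -/
def θ : Derivation ℝ K K := (S.e' * 𝓕.p) • J.D

lemma θ_apply (f : K) : S.θ f = S.e' * 𝓕.p * J.D f := rfl

lemma isUnit_e : IsUnit S.e := IsUnit.of_mul_eq_one _ ((mul_comm _ _).trans S.he')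

lemma isUnit_e' : IsUnit S.e' := IsUnit.of_mul_eq_one _ S.he'

lemma isUnit_α : IsUnit S.α := IsUnit.of_mul_eq_one _ ((mul_comm _ _).trans S.hα')

lemma isUnit_scale : IsUnit (S.e' * 𝓕.p) := S.isUnit_e'.mul 𝓕.isUnit_p

lemma pd_eq (f : K) : 𝓕.pd f = S.e * S.θ f := by
  rw [pd_apply, θ_apply]
  linear_combination (-𝓕.p * J.D f) * S.he'

lemma inv_e : 𝓕.Inv S.e (𝓕.q * S.m) S.α := by
  rw [S.he]
  exact (inv_q.mul S.hα).congr rfl (by ring) (by ring)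

lemma α_mul_θ_k : S.α * S.θ 𝓕.k = 1 := by
  have h : S.θ 𝓕.k = S.e' * 𝓕.q := by rw [θ_apply, q, pd_apply, mul_assoc]
  rw [h]
  linear_combination S.he' - S.e' * S.he

lemma θ_k : S.θ 𝓕.k = S.α' := by
  linear_combination S.α' * S.α_mul_θ_k - S.θ 𝓕.k * S.hα'

/-- The logarithmic derivative of `e`. -/
def w : K := S.e' * S.θ S.e

lemma θ_e : S.θ S.e = S.e * S.w := by
  rw [w]
  linear_combination (-S.θ S.e) * S.he'

/-- The logarithmic derivative of `α`. -/
def v : K := S.m * S.α' ^ 2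

lemma θ_inv {f a : K} (h : 𝓕.Inv f a 0) : S.θ f = a * S.α' := by
  have h1 : S.θ f = a * S.θ 𝓕.k := by rw [θ_apply, θ_apply, h.D]; ring
  rw [h1, θ_k]

lemma θ_α : S.θ S.α = S.α * S.v := by
  rw [S.θ_inv S.hα, v]
  linear_combination (-S.m * S.α') * S.hα'

lemma freeze_inv {δ : Derivation ℝ K K} {f a : K} (h : S.θ f = a * S.θ 𝓕.k)
    (h' : δ f = a * δ 𝓕.k) : freeze S.θ S.α 𝓕.k δ f = 0 := by
  rw [freeze_apply, h, h']
  linear_combination (-a * δ 𝓕.k) * S.α_mul_θ_k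

lemma freeze_comb {f a x y : K} {c : ℕ → K} (h : 𝓕.Inv f a 0) :
    freeze S.θ S.α 𝓕.k (J.comb x y c) f = 0 := by
  refine S.freeze_inv (a := a) ?_ ?_
  · rw [θ_apply, θ_apply, h.D]; ring
  · rw [h.comb]; ring

def rhs : K := J.u 1 * 𝓕.p * S.F

/-- The time derivative along the flow that annihilates `k`. -/
def dt : Derivation ℝ K K := freeze S.θ S.α 𝓕.k (J.Dt S.rhs)

lemma dt_inv {f a : K} (h : 𝓕.Inv f a 0) : S.dt f = 0 := S.freeze_comb h

lemma dt_comm (f : K) : S.θ (S.dt f) = S.dt (S.θ f) :=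
  freeze_comm S.isUnit_scale rfl (J.D_Dt _) S.α_mul_θ_k (S.dt_inv S.hα) f

def η : K := 𝓕.η S.F

/-- The coefficient of θ that is subtracted from the time derivative to keep k fixed. -/
def X : K := S.α * 𝓕.varK S.F

lemma X_eq : S.X = 2 * S.α * (S.e * S.θ (S.e * S.θ S.η) + 𝓕.k * S.η) := by
  rw [X, varK, ← η, S.pd_eq, S.pd_eq]
  ring

/-- The logarithmic time derivative of `e`. -/
def ϖ : K := S.η + S.θ S.X - S.X * S.w

lemma Dt_k : J.Dt S.rhs 𝓕.k = 𝓕.varK S.F := by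
  rw [rhs, Dt_inv inv_k]; ring

/-- Obtained without differentiating e = q α: the evolution of e' p is dictated by `map_rescaling`,
and that of p is known. -/
lemma dt_e : S.dt S.e = S.e * S.ϖ := by
  have h := map_rescaling S.isUnit_scale rfl (J.D_Dt S.rhs) S.α_mul_θ_k (S.dt_inv S.hα)
  rw [Derivation.leibniz, Derivation.leibniz_of_mul_eq_one _ S.he', S.Dt_k, ← X, rhs, Dt_p,
    ← rhs, ← η, ← θ] at h
  obtain ⟨π, hπ⟩ := 𝓕.isUnit_p.exists_left_inv
  rw [dt, freeze_apply, S.Dt_k, ← X, S.θ_e, ϖ]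
  simp only [smul_eq_mul] at h
  have h2 := S.he'
  linear_combination (-S.e ^ 2 * π) * h - (J.Dt S.rhs S.e) * (S.e' * S.e + 1) * h2
    - J.Dt S.rhs S.e * S.e' ^ 2 * S.e ^ 2 * hπ + 
    (S.e * (S.η + S.θ S.X)) * (S.e * S.e' * hπ + h2)

lemma dt_w : S.dt S.w = S.θ S.ϖ := by
  have h1 := congrArg S.dt S.θ_e
  rw [← dt_comm, dt_e, Derivation.leibniz, Derivation.leibniz, S.θ_e, S.dt_e] at h1
  simp only [smul_eq_mul] at h1
  refine (S.isUnit_e.mul_right_inj).1 ?_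
  linear_combination -h1

/-! ### Orders -/

lemma hasTop_e : J.HasTop S.e 6 (S.α * (𝓕.p * 𝓕.κ)) := S.inv_e.hasTop

lemma ordLE_e' : J.OrdLE S.e' 6 := S.hasTop_e.1.of_mul_eq_one S.he'

lemma ordLE_α : J.OrdLE S.α 5 := S.hα.hasTop_five.1

lemma hasTop_θ {f a : K} {N : ℕ} (hN : 6 ≤ N) (h : J.HasTop f N a) :
    J.HasTop (S.θ f) (N + 1) (S.e' * 𝓕.p * a) :=
  h.mul_D ((S.ordLE_e'.mono hN).mul (𝓕.ordLE_p.mono (by omega)))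

lemma hasTop_w : J.HasTop S.w 7 (S.e' * (S.e' * 𝓕.p * (S.α * (𝓕.p * 𝓕.κ)))) :=
  (S.hasTop_θ le_rfl S.hasTop_e).mul_left S.ordLE_e'

lemma isUnit_top : IsUnit (S.α * (𝓕.p * 𝓕.κ)) :=
  S.isUnit_α.mul (𝓕.isUnit_p.mul 𝓕.isUnit_κ)

lemma D_const {f : K} (h : S.θ f = 0) : J.D f = 0 :=
  (S.isUnit_scale.mul_right_eq_zero).1 h

/-! ### Products with the logarithmic derivative of `e` -/

/-- The derivative of `Y` as a density of weight one. -/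
def nabla (Y : K) : K := S.θ Y + S.w * Y

/-- Integration by parts moves θ from X to Y, turning Y θX - X w Y into -X times `nabla Y`.
Inserting the formula for X, one of its two outer derivatives is moved over as well, which leaves a
factor e θη. -/
lemma mul_ϖ (Y : K) : ∃ Z, Y * S.ϖ = S.η * Y + 2 * (S.e * S.θ S.η) *
    S.θ (S.e * S.α * S.nabla Y) - 2 * 𝓕.k * S.α * S.η * S.nabla Y + S.θ Z := by
  obtain ⟨B, hB⟩ : ∃ B, B = S.e * S.θ S.η := ⟨_, rfl⟩
  obtain ⟨A, hA⟩ : ∃ A, A = S.e * S.α * S.nabla Y := ⟨_, rfl⟩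
  refine ⟨S.X * Y - 2 * (A * B), ?_⟩
  have h2 := map_ofNat' S.θ 2
  have hX := S.X_eq
  rw [← hB] at hX
  rw [← hB, ← hA, ϖ, map_sub, Derivation.leibniz, Derivation.leibniz, Derivation.leibniz, h2]
  simp only [smul_eq_mul]
  have hA' : A = S.e * S.α * (S.θ Y + S.w * Y) := hA
  rw [nabla]
  linear_combination (-(S.θ Y + S.w * Y)) * hX + 2 * S.θ B * hA'

/-- All derivatives are now moved off η. This form serves when Y has low order, so that the cofactor
of η reaches the order of η itself. -/
lemma mul_ϖ' (Y : K) : ∃ Z, Y * S.ϖ = S.η * (Y - 2 * S.θ (S.e * S.θ (S.e * S.α * S.nabla Y)) -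
    2 * 𝓕.k * S.α * S.nabla Y) + S.θ Z := by
  obtain ⟨Z, hZ⟩ := S.mul_ϖ Y
  obtain ⟨B, hB⟩ : ∃ B, B = S.θ (S.e * S.α * S.nabla Y) := ⟨_, rfl⟩
  refine ⟨Z + 2 * (S.e * B * S.η), ?_⟩
  have h2 := map_ofNat' S.θ 2
  rw [← hB] at hZ ⊢
  rw [hZ, map_add, Derivation.leibniz S.θ 2, Derivation.leibniz S.θ (S.e * B), h2]
  simp only [smul_eq_mul]
  ring

lemma hasTop_nabla {Y a : K} {N : ℕ} (hN : 7 ≤ N) (h : J.HasTop Y N a) :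
    J.HasTop (S.nabla Y) (N + 1) (S.e' * 𝓕.p * a) :=
  ((S.hasTop_θ (by omega) h).add (((S.hasTop_w.1.mono hN).mul h.1).hasTop)).congr (add_zero _)

lemma hasTop_η : J.HasTop S.η 9 (-𝓕.s * (𝓕.p * (𝓕.p * (𝓕.p * (S.Fq * (𝓕.p * 𝓕.κ)))))) :=
  S.hF.hasTop_η

lemma ordLE_Fq : J.OrdLE S.Fq 6 := by
  obtain ⟨_, _, _, -, h⟩ := S.hF.exists_second
  exact h.ordLE

lemma isUnit_top_η : IsUnit (-𝓕.s * (𝓕.p * (𝓕.p * (𝓕.p * (S.Fq * (𝓕.p * 𝓕.κ)))))) :=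
  𝓕.isUnit_s.neg.mul (𝓕.isUnit_p.mul (𝓕.isUnit_p.mul (𝓕.isUnit_p.mul (S.hFq.mul
    (𝓕.isUnit_p.mul 𝓕.isUnit_κ)))))

lemma ordLE_top_η : J.OrdLE (-𝓕.s * (𝓕.p * (𝓕.p * (𝓕.p * (S.Fq * (𝓕.p * 𝓕.κ)))))) 6 := by
  have hp := 𝓕.ordLE_p.mono (show 3 ≤ 6 by omega)
  exact (𝓕.ordLE_s 6).neg.mul (hp.mul (hp.mul (hp.mul (S.ordLE_Fq.mul
    (hp.mul (𝓕.ordLE_κ.mono (by omega)))))))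

lemma ordLE_top : J.OrdLE (S.α * (𝓕.p * 𝓕.κ)) 6 :=
  (S.ordLE_α.mono (by omega)).mul ((𝓕.ordLE_p.mono (by omega)).mul (𝓕.ordLE_κ.mono (by omega)))

lemma ordLE_scale : J.OrdLE (S.e' * 𝓕.p) 6 := S.ordLE_e'.mul (𝓕.ordLE_p.mono (by omega))

/-- A density `Γ(k) e ^ 5` is conserved only if it vanishes. -/
lemma eq_zero_of_conserved {Γ a μ z : K} (hΓ : 𝓕.Inv Γ a 0) (hμ : S.θ μ = 0)
    (h : Γ * S.e ^ 5 * S.ϖ + μ = S.θ z) : Γ = 0 := by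
  obtain ⟨Y, hY⟩ : ∃ Y, Y = Γ * S.e ^ 5 := ⟨_, rfl⟩
  obtain ⟨E, hE⟩ : ∃ E, E = S.α * (𝓕.p * 𝓕.κ) := ⟨_, rfl⟩
  obtain ⟨r, hr⟩ : ∃ r, r = S.e' * 𝓕.p := ⟨_, rfl⟩
  have hEu : IsUnit E := hE ▸ S.isUnit_top
  have hru : IsUnit r := hr ▸ S.isUnit_scale
  have hE6 : J.OrdLE E 6 := hE ▸ S.ordLE_top
  have hr6 : J.OrdLE r 6 := hr ▸ S.ordLE_scale
  have he := S.hasTop_e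
  rw [← hE] at he
  have hYtop : J.HasTop Y 6 (5 * Γ * S.e ^ 4 * E) := by
    rw [hY]
    refine ⟨(hΓ.hasTop_five.1.mono (by omega)).mul (he.1.pow 5), ?_⟩
    rw [Derivation.leibniz, hΓ.hasTop_five.1 6 (by omega), Derivation.leibniz_pow, he.2]
    simp only [smul_eq_mul, nsmul_eq_mul]
    push_cast
    ring
  -- The factor 6 is 5 from differentiating e^5, plus 1 from the term w Y.
  have hY' : J.HasTop (S.nabla Y) 7 (6 * Γ * S.e ^ 4 * E * r) := by
    have h1 := S.hasTop_θ le_rfl hYtop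
    have h2 := S.hasTop_w.mul_right hYtop.1
    refine (h1.add h2).congr ?_
    rw [← hE, ← hr, hY]
    linear_combination (Γ * S.e ^ 4 * E * r) * S.he'
  have h1 := (S.hasTop_θ (by norm_num) ((S.hasTop_θ (by norm_num)
    (hY'.mul_left (he.1.mul (S.ordLE_α.mono (by omega))))).mul_left (he.1.mono (by omega))))
  have hB : J.HasTop (Y - 2 * S.θ (S.e * S.θ (S.e * S.α * S.nabla Y)) -
      2 * 𝓕.k * S.α * S.nabla Y) 9 (0 - 2 * (r * (S.e * (r * (S.e * S.α *
        (6 * Γ * S.e ^ 4 * E * r))))) - 0) := by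
    rw [← hr] at h1
    have h2 : J.OrdLE (2 * 𝓕.k * S.α * S.nabla Y) 8 :=
      ((((OrdLE.ofNat 2 8).mul (𝓕.hasTop_k.1.mono (by omega))).mul
        (S.ordLE_α.mono (by omega))).mul (hY'.1.mono (by omega)))
    exact (((hYtop.1.mono (by omega) : J.OrdLE Y 8).hasTop).sub
      (h1.mul_left (OrdLE.ofNat 2 8))).sub h2.hasTop
  obtain ⟨Z, hZ⟩ := S.mul_ϖ' Y
  have hfin : S.η * (Y - 2 * S.θ (S.e * S.θ (S.e * S.α * S.nabla Y)) -
      2 * 𝓕.k * S.α * S.nabla Y) + μ = r * J.D (z - Z) := by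
    rw [hr, ← θ_apply, map_sub, ← h, ← hY, hZ]
    ring
  have hm : ∀ {f : K}, J.OrdLE f 6 → J.OrdLE f 8 := fun h => h.mono (by omega)
  have hΓ8 : J.OrdLE Γ 8 := hΓ.hasTop_five.1.mono (by omega)
  -- Two more applications of θ bring the cofactor to order nine, the order of η, with top
  -- coefficient a unit multiple of Γ.
  have h3 := mul_top_eq_zero S.hasTop_η hB (hm S.ordLE_top_η)
    (((OrdLE.zero 8).sub ((OrdLE.ofNat 2 8).mul ((hm hr6).mul ((hm he.1).mul ((hm hr6).mul
      (((hm he.1).mul (S.ordLE_α.mono (by omega))).mul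
      (((((OrdLE.ofNat 6 8).mul hΓ8).mul ((hm he.1).pow 4)).mul (hm hE6)).mul
        (hm hr6)))))))).sub (OrdLE.zero 8))
    (OrdLE.const (S.D_const hμ) 8).hasTop (hm hr6) hru hfin
  have h4 := (S.isUnit_top_η.mul_right_eq_zero).1 h3
  have h12 : IsUnit (12 : K) := by exact_mod_cast isUnit_natCast (K := K) 12 (by norm_num)
  have hu : IsUnit (12 * r ^ 3 * S.e ^ 6 * S.α * E) :=
    (((h12.mul (hru.pow 3)).mul
      (S.isUnit_e.pow 6)).mul S.isUnit_α).mul hEu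
  refine (hu.mul_right_eq_zero).1 ?_
  linear_combination -h4

/-- The subleading coefficient in the normalized gauge. -/
def T : K := -350 * S.θ S.w - 60 * S.θ S.v - 175 * S.w ^ 2 - 60 * S.w * S.v - 12 * S.v ^ 2 +
  20 * S.e' ^ 2 * (2 * 𝓕.k + 𝓕.τ)

lemma exists_inv_v : ∃ a, 𝓕.Inv S.v a 0 := by
  obtain ⟨mk, _, _, h1, h2⟩ := S.hα.exists_second
  have h3 := (h2.unique (inv_const (fun e => by simp))).1
  subst h3
  exact ⟨_, (h1.mul ((S.hα.of_mul_eq_one S.hα').pow 1)).congr (by rw [v]) rfl (by simp)⟩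

lemma inv_τ : 𝓕.Inv 𝓕.τ 0 0 := inv_const 𝓕.dτ

lemma dt_e' : S.dt S.e' = -S.e' * S.ϖ := by
  rw [Derivation.leibniz_of_mul_eq_one _ S.he', S.dt_e, smul_eq_mul]
  linear_combination (-S.e' * S.ϖ) * S.he'

/-- Along the frozen flow k, v and τ do not change, while w varies by θϖ and e' by -e' ϖ.
Integrating by parts leaves the variational derivative of T times ϖ. -/
lemma dt_T : ∃ Z, S.dt S.T =
    (350 * S.θ S.w + 60 * S.θ S.v - 40 * S.e' ^ 2 * (2 * 𝓕.k + 𝓕.τ)) * S.ϖ + S.θ Z := by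
  obtain ⟨a, ha⟩ := S.exists_inv_v
  have hv : S.dt S.v = 0 := S.dt_inv ha
  have hθv : S.dt (S.θ S.v) = 0 := by rw [← dt_comm, hv, map_zero]
  have hθw : S.dt (S.θ S.w) = S.θ (S.θ S.ϖ) := by rw [← dt_comm, dt_w]
  have hk : S.dt 𝓕.k = 0 := S.dt_inv inv_k
  have hτ : S.dt 𝓕.τ = 0 := S.dt_inv inv_τ
  have n : ∀ (δ : Derivation ℝ K K) (n : ℕ) [n.AtLeastTwo], δ (ofNat(n) : K) = 0 :=
    fun δ n _ => map_ofNat' δ n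
  refine ⟨-350 * S.θ S.ϖ - 350 * S.w * S.ϖ - 60 * S.v * S.ϖ, ?_⟩
  simp only [T, map_add, map_sub, map_neg, Derivation.leibniz, Derivation.leibniz_pow, n, hv, hθv,
    hθw, hk, hτ, S.dt_w, S.dt_e', smul_eq_mul, nsmul_eq_mul]
  push_cast
  ring

/-- The variational derivative Y of T has order eight, with top coefficient a unit because of the
term 350 θw. Then θ(e α `nabla Y`) and e θη both have order ten with unit top coefficients, while
all remaining terms, including a T, have order at most nine. -/
lemma not_conserved_T [Nontrivial K] {a b z : K} (ha : S.θ a = 0) (hb : S.θ b = 0)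
    (h : S.dt S.T + a * S.T + b = S.θ z) : False := by
  obtain ⟨Z₁, hZ₁⟩ := S.dt_T
  obtain ⟨Y, hY⟩ : ∃ Y, Y = 350 * S.θ S.w + 60 * S.θ S.v - 40 * S.e' ^ 2 * (2 * 𝓕.k + 𝓕.τ) :=
    ⟨_, rfl⟩
  rw [← hY] at hZ₁
  obtain ⟨E, hE⟩ : ∃ E, E = S.α * (𝓕.p * 𝓕.κ) := ⟨_, rfl⟩
  obtain ⟨r, hr⟩ : ∃ r, r = S.e' * 𝓕.p := ⟨_, rfl⟩
  have hEu : IsUnit E := hE ▸ S.isUnit_top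
  have hru : IsUnit r := hr ▸ S.isUnit_scale
  have hE6 : J.OrdLE E 6 := hE ▸ S.ordLE_top
  have hr6 : J.OrdLE r 6 := hr ▸ S.ordLE_scale
  have he := S.hasTop_e
  rw [← hE] at he
  obtain ⟨c, hv⟩ := S.exists_inv_v
  have hw := S.hasTop_w
  have hθw := S.hasTop_θ (by norm_num) hw
  rw [← hE, ← hr] at hθw
  have hv7 : J.OrdLE S.v 7 := hv.ordLE.mono (by omega)
  have hθv : J.OrdLE (S.θ S.v) 7 := (S.hasTop_θ le_rfl hv.hasTop).1
  have hk7 : J.OrdLE (2 * 𝓕.k + 𝓕.τ) 7 :=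
    ((OrdLE.ofNat 2 7).mul (𝓕.hasTop_k.1.mono (by omega))).add (𝓕.ordLE_τ 7)
  have he7 : J.OrdLE (S.e' ^ 2) 7 := (S.ordLE_e'.mono (by omega)).pow 2
  have hYtop : J.HasTop Y 8 (350 * (r * (S.e' * (r * E))) + 0 - 0) := by
    rw [hY]
    exact ((hθw.mul_left (OrdLE.ofNat 350 7)).add ((OrdLE.ofNat 60 7).mul hθv).hasTop).sub
      ((((OrdLE.ofNat 40 7).mul he7).mul hk7)).hasTop
  have hY' := S.hasTop_nabla (by norm_num) hYtop
  rw [← hr] at hY'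
  have hT : J.OrdLE S.T 8 := by
    have m : ∀ {f : K}, J.OrdLE f 7 → J.OrdLE f 8 := fun h => h.mono (by omega)
    exact ((((((OrdLE.ofNat 350 8).neg.mul hθw.1).sub ((OrdLE.ofNat 60 8).mul (m hθv))).sub
      ((OrdLE.ofNat 175 8).mul ((m hw.1).pow 2))).sub
      (((OrdLE.ofNat 60 8).mul (m hw.1)).mul (m hv7))).sub
      ((OrdLE.ofNat 12 8).mul ((m hv7).pow 2))).add
      (((OrdLE.ofNat 20 8).mul (m he7)).mul (m hk7))
  obtain ⟨Z, hZ⟩ := S.mul_ϖ Y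
  have hm : ∀ {f : K}, J.OrdLE f 6 → J.OrdLE f 9 := fun h => h.mono (by omega)
  have hm8 : ∀ {f : K}, J.OrdLE f 6 → J.OrdLE f 8 := fun h => h.mono (by omega)
  have hA := (S.hasTop_θ (by norm_num) (hY'.mul_left
    ((hm8 he.1).mul (S.ordLE_α.mono (by omega)))))
  rw [← hr] at hA
  have hη := 𝓕.hasTop_pd (by norm_num) S.hasTop_η
  have hfin : 𝓕.pd S.η * (2 * S.θ (S.e * S.α * S.nabla Y)) + (S.η * Y -
      2 * 𝓕.k * S.α * S.η * S.nabla Y + a * S.T + b) = r * J.D (z - Z₁ - Z) := by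
    rw [hr, ← θ_apply, map_sub, map_sub, ← h, hZ₁, hZ, S.pd_eq]
    ring
  have hη9 := S.hasTop_η.1
  have hC : J.OrdLE (S.η * Y - 2 * 𝓕.k * S.α * S.η * S.nabla Y + a * S.T + b) 9 :=
    (((hη9.mul (hYtop.1.mono (by omega))).sub ((((((OrdLE.ofNat 2 9).mul
      (𝓕.hasTop_k.1.mono (by omega))).mul (S.ordLE_α.mono (by omega))).mul hη9)).mul hY'.1)).add
      ((OrdLE.const (S.D_const ha) 9).mul (hT.mono (by omega)))).add
      (OrdLE.const (S.D_const hb) 9)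
  have hYo : J.OrdLE (350 * (r * (S.e' * (r * E))) + 0 - 0) 9 :=
    (((OrdLE.ofNat 350 9).mul ((hm hr6).mul ((hm S.ordLE_e').mul ((hm hr6).mul
      (hm hE6))))).add (OrdLE.zero 9)).sub (OrdLE.zero 9)
  have h3 := mul_top_eq_zero hη (hA.mul_left (OrdLE.ofNat 2 9))
    ((𝓕.ordLE_p.mono (by omega)).mul (hm S.ordLE_top_η))
    ((OrdLE.ofNat 2 9).mul ((hm hr6).mul (((hm he.1).mul (S.ordLE_α.mono (by omega))).mul
      ((hm hr6).mul hYo))))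
    hC.hasTop (hm hr6) hru hfin
  have h350 : IsUnit (350 : K) := by exact_mod_cast isUnit_natCast (K := K) 350 (by norm_num)
  have hYu : IsUnit (350 * (r * (S.e' * (r * E))) + 0 - 0) := by
    rw [add_zero, sub_zero]
    exact h350.mul (hru.mul (S.isUnit_e'.mul (hru.mul hEu)))
  exact ((𝓕.isUnit_p.mul S.isUnit_top_η).mul (isUnit_two.mul (hru.mul ((S.isUnit_e.mul
    S.isUnit_α).mul (hru.mul hYu))))).ne_zero h3

end Separant

end ProjFrame

end JetAlgebra
end

/-! ### The contradiction in an abstract jet algebra. -/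

noncomputable section

open Polynomial

namespace JetAlgebra

open WKB

variable {K : Type*} [CommRing K] [Algebra ℝ K] {J : JetAlgebra K}

namespace ProjFrame

namespace Separant

variable {𝓕 : ProjFrame J} (S : Separant 𝓕)

/-- The leading coefficient of the linearized equation in the parametrization `θ`. -/
def ε : K := -2 * 𝓕.s * S.Fq * S.e ^ 6

lemma inv_ε : 𝓕.Inv S.ε 0 0 := inv_const fun i => by
  have h2 := map_ofNat' (J.d i) 2
  have hs := 𝓕.map_s _ (𝓕.dτ i)
  simp only [ε, Derivation.leibniz, Derivation.leibniz_pow, map_neg, h2, hs, smul_eq_mul,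
    nsmul_eq_mul]
  push_cast
  linear_combination (-2 * 𝓕.s * S.e ^ 5) * S.hrel i

lemma isUnit_ε : IsUnit S.ε :=
  ((isUnit_two.neg.mul 𝓕.isUnit_s).mul S.hFq).mul (S.isUnit_e.pow 6)

/-- The gauge is |e|^(-5/2) |α|^(-1/5). The first exponent removes w from the second coefficient of
L, since 15 w + 6 γ becomes -(6/5) v. The second leaves a multiple of e^5 by a function of k alone.
-/
lemma exists_gauge_factor : ∃ g γ, IsUnit g ∧ S.θ g = γ * g ∧ 10 * γ = -25 * S.w - 2 * S.v := by
  obtain ⟨g₁, hu₁, h₁⟩ := J.rpow S.e S.isUnit_e (-5 / 2)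
  obtain ⟨g₂, hu₂, h₂⟩ := J.rpow S.α S.isUnit_α (-1 / 5)
  have hθ : ∀ {y g : K} {c : ℝ}, (∀ a, y * J.d a g = c • (g * J.d a y)) →
      y * S.θ g = algebraMap ℝ K c * (g * S.θ y) := fun {y g c} h => by
    have h1 := J.comb_rel (A := y) (B := algebraMap ℝ K c * g) (C := 0) (f := g) (g := y) (h := 0)
      (fun e => by rw [h, Algebra.smul_def]; ring) 1 0 fun i => J.u (i + 1)
    rw [← D] at h1
    rw [θ_apply, θ_apply]
    linear_combination (S.e' * 𝓕.p) * h1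
  have e₁ := hθ h₁
  have e₂ := hθ h₂
  rw [S.θ_e] at e₁
  rw [S.θ_α] at e₂
  refine ⟨g₁ * g₂, algebraMap ℝ K (-5 / 2) * S.w + algebraMap ℝ K (-1 / 5) * S.v, hu₁.mul hu₂,
    ?_, ?_⟩
  · rw [Derivation.leibniz, smul_eq_mul, smul_eq_mul]
    linear_combination (g₂ * S.e') * e₁ + (g₁ * S.α') * e₂ + (-g₂ * S.θ g₁ +
      algebraMap ℝ K (-5 / 2) * g₁ * g₂ * S.w) * S.he' + (-g₁ * S.θ g₂ +
      algebraMap ℝ K (-1 / 5) * g₁ * g₂ * S.v) * S.hα'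
  · have a₁ : (10 : K) * algebraMap ℝ K (-5 / 2) = -25 := by
      rw [← map_ofNat (algebraMap ℝ K) 10, ← map_mul, ← map_ofNat (algebraMap ℝ K) 25, ← map_neg]
      norm_num
    have a₂ : (10 : K) * algebraMap ℝ K (-1 / 5) = -2 := by
      rw [← map_ofNat (algebraMap ℝ K) 10, ← map_mul, ← map_ofNat (algebraMap ℝ K) 2, ← map_neg]
      norm_num
    linear_combination S.w * a₁ + S.v * a₂

/-- The coefficient of the density of weight five in the subleading part of the equation. -/
def Γ : K := 10 * 𝓕.s * S.Fk + 6 * S.ε * S.m * S.α' ^ 2 * S.e' ^ 5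

lemma Γ_mul : S.Γ * S.e ^ 5 = 10 * 𝓕.s * S.Fk * S.e ^ 5 + 6 * S.ε * S.v := by
  have h := congrArg (· ^ 5) S.he'
  simp only [mul_pow, one_pow] at h
  rw [Γ, v]
  linear_combination (6 * S.ε * S.m * S.α' ^ 2) * h

/-- Because F_q e^6 is constant with e = α q, the k-derivative of F_q equals -6 F_q m/α. This
cancels the q-derivative of the second term of `Γ`, and the exponent of α in the gauge was chosen
for that cancellation. -/
lemma exists_inv_Γ : ∃ a, 𝓕.Inv S.Γ a 0 := by
  obtain ⟨Fkk, M, Fqq, h1, h2⟩ := S.hF.exists_second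
  obtain ⟨mk, _, _, hm, h0⟩ := S.hα.exists_second
  have h3 := (h0.unique (inv_const (fun e => by simp))).1
  subst h3
  have he := S.inv_e
  have hFq : 𝓕.Inv S.Fq (-6 * S.Fq * S.e' * (𝓕.q * S.m)) (-6 * S.Fq * S.e' * S.α) := fun i => by
    have h4 := S.hrel i
    rw [he i] at h4
    linear_combination S.e' * h4 - (J.d i S.Fq) * S.he'
  have hM := (h2.unique hFq).1
  have hs : 𝓕.Inv 𝓕.s 0 0 := inv_const fun i => 𝓕.map_s _ (𝓕.dτ i)
  have hn : ∀ (n : ℕ) [n.AtLeastTwo], 𝓕.Inv (ofNat(n) : K) 0 0 :=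
    fun n _ => inv_const fun i => map_ofNat' _ n
  have h5 := (((hn 10).mul hs).mul h1).add (((((hn 6).mul S.inv_ε).mul hm).mul
    ((S.hα.of_mul_eq_one S.hα').pow 1)).mul ((he.of_mul_eq_one S.he').pow 4))
  refine ⟨_, h5.congr (by rw [Γ]) rfl ?_⟩
  rw [hM, ε]
  have h6 := congrArg (· ^ 6) S.he'
  simp only [mul_pow, one_pow] at h6
  have h7 : S.e' * 𝓕.q = S.α' := by
    linear_combination S.α' * S.he' - S.e' * S.α' * S.he - S.e' * 𝓕.q * S.hα'
  push_cast
  linear_combination (60 * 𝓕.s * S.Fq * S.m * S.α' ^ 2 * S.α) * h6 -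
    60 * 𝓕.s * S.Fq * S.m * h7 + 60 * 𝓕.s * S.Fq * S.m * S.α' * S.hα'

/-- The second conservation law gives Γ = 0, hence l₅ = 0. This makes the third law available, and
it contradicts `not_conserved_T`. -/
theorem not_symmetry [Nontrivial K] {Q : K} {n : ℕ} (hn : 7 ≤ n) (hQ : J.OrdLE Q n)
    (hQn : IsUnit (J.du n Q)) (hsym : J.Dt S.rhs Q = J.evol Q S.rhs) : False := by
  obtain ⟨g, γ, hg, hgγ, hγ⟩ := S.exists_gauge_factor
  obtain ⟨l', hl, hl6, hl5, hl4, hev⟩ := exists_linearization S.hF S.pd_eq hgγ S.θ_e S.he'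
  have hGu : IsUnit (J.u 1 * 𝓕.p * g) := (𝓕.isUnit_u_one.mul 𝓕.isUnit_p).mul hg
  obtain ⟨G', hG'⟩ := hGu.exists_left_inv
  have hG : S.θ (J.u 1 * 𝓕.p * g) = G' * S.θ (J.u 1 * 𝓕.p * g) * (J.u 1 * 𝓕.p * g) := by
    linear_combination (-S.θ (J.u 1 * 𝓕.p * g)) * hG'
  have hscale : ∃ r', r' * (S.e' * 𝓕.p) = 1 := S.isUnit_scale.exists_left_inv
  obtain ⟨r', hr'⟩ := hscale
  obtain ⟨l, m, hl₀, hcoeff, hm, hmn, hZ⟩ := exists_gauged_zero_curvature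
    (θ := S.θ) (γ := G' * S.θ (J.u 1 * 𝓕.p * g)) hn hQ hQn hsym rfl hr'
    S.α_mul_θ_k (S.dt_inv S.hα) (S.freeze_comb S.hα) hG hG' hl
    (fun h => by rw [← hev h, mul_assoc (J.u 1 * 𝓕.p), mul_assoc (J.u 1)]; rfl)
  have hε : l.coeff 6 = S.ε := by rw [hcoeff 6 (by norm_num), hl6, ε]
  rw [← ε, ← hcoeff 5 (by norm_num)] at hl5
  rw [← ε, ← hcoeff 4 (by norm_num)] at hl4
  have hθε : S.θ S.ε = 0 := by rw [S.θ_inv S.inv_ε, zero_mul]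
  have hdtε : S.dt S.ε = 0 := S.dt_inv S.inv_ε
  have hdQε : freeze S.θ S.α 𝓕.k (J.evol Q) S.ε = 0 := S.freeze_comb S.inv_ε
  have hl5' : 5 * l.coeff 5 = -(S.Γ * S.e ^ 5) := by
    rw [S.Γ_mul]
    linear_combination 5 * hl5 + 3 * S.ε * hγ
  have n5 : ∀ δ : Derivation ℝ K K, δ (5 : K) = 0 := fun δ => map_ofNat' δ 5
  have n20 : ∀ δ : Derivation ℝ K K, δ (20 : K) = 0 := fun δ => map_ofNat' δ 20
  have hΓ : S.Γ = 0 := by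
    obtain ⟨a, ha⟩ := S.exists_inv_Γ
    obtain ⟨c, b, z, hc, hc0, hb, h⟩ := conserved_second hn hl₀ hm hZ S.dt_comm
      (hε ▸ S.isUnit_ε) hmn (by rw [hε, hθε]) (by rw [hε]; exact hdtε) (by rw [hε]; exact hdQε)
    obtain ⟨c', hc'⟩ := hc.exists_left_inv
    have hc'0 : S.θ c' = 0 := by
      rw [Derivation.leibniz_of_mul_eq_one _ hc', hc0, smul_zero]
    refine S.eq_zero_of_conserved (μ := c' * b) (z := -(c' * z)) ha ?_ ?_
    · rw [Derivation.leibniz, hc'0, hb, smul_zero, smul_zero, add_zero]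
    · have h1 := congrArg S.dt hl5'
      rw [Derivation.leibniz, n5, map_neg, Derivation.leibniz, Derivation.leibniz_pow, S.dt_e,
        S.dt_inv ha] at h1
      simp only [smul_eq_mul, nsmul_eq_mul] at h1
      push_cast at h1
      rw [map_neg, Derivation.leibniz, hc'0, smul_eq_mul, smul_zero, add_zero]
      have h5 : IsUnit (5 : K) := by exact_mod_cast isUnit_natCast (K := K) 5 (by norm_num)
      refine (h5.mul_right_inj).1 ?_
      change c * S.dt (l.coeff 5) = _ at h
      linear_combination (-5 * c') * h + h1 + 5 * S.dt (l.coeff 5) * hc'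
  have h5u : IsUnit (5 : K) := by exact_mod_cast isUnit_natCast (K := K) 5 (by norm_num)
  have hl50 : l.coeff 5 = 0 := by
    rw [hΓ, zero_mul, neg_zero] at hl5'
    exact (h5u.mul_right_eq_zero).1 hl5'
  have hFk := S.Γ_mul
  rw [hΓ, zero_mul] at hFk
  have hγθ := congrArg S.θ hγ
  have n10 : S.θ (10 : K) = 0 := map_ofNat' _ 10
  have n25 : S.θ (25 : K) = 0 := map_ofNat' _ 25
  have n2 : S.θ (2 : K) = 0 := map_ofNat' _ 2
  simp only [Derivation.leibniz, map_sub, map_neg, n10, n25, n2, smul_eq_mul] at hγθ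
  -- Γ = 0 expresses F_k through v, and the gauge expresses γ through w and v; what remains of l₄ is
  -- the constant ε times T.
  have hT : 20 * l.coeff 4 = S.ε * S.T := by
    rw [T]
    linear_combination 20 * hl4 + (40 * S.w + 20 * γ) * hFk + 30 * S.ε * hγθ +
      S.ε * (150 * S.w + 3 * (10 * γ - 25 * S.w - 2 * S.v) + 12 * S.v) * hγ
  obtain ⟨c, a, b, z, hc, hc0, ha, hb, h⟩ := conserved_third hn hl₀ hm hZ S.dt_comm
    (hε ▸ S.isUnit_ε) hmn (by rw [hε, hθε]) (by rw [hε]; exact hdtε) (by rw [hε]; exact hdQε) hl50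
  change c * S.dt (l.coeff 4) + _ = _ at h
  obtain ⟨c', hc'⟩ := (hc.mul S.isUnit_ε).exists_left_inv
  have hc'0 : S.θ c' = 0 := by
    rw [Derivation.leibniz_of_mul_eq_one _ hc', Derivation.leibniz, hc0, hθε]; simp
  refine S.not_conserved_T (a := c' * S.ε * a) (b := -(20 * c' * b)) (z := 20 * c' * z) ?_ ?_ ?_
  · simp [Derivation.leibniz, hc'0, hθε, ha]
  · simp [Derivation.leibniz, hc'0, hb, n20]
  · have h1 := congrArg S.dt hT
    rw [Derivation.leibniz, n20, Derivation.leibniz, hdtε] at h1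
    simp only [smul_eq_mul] at h1
    rw [Derivation.leibniz, Derivation.leibniz, hc'0, n20]
    simp only [smul_eq_mul]
    linear_combination (20 * c') * h - c' * c * h1 - S.dt S.T * hc' - c' * a * hT

end Separant

end ProjFrame

/-- Taking p as the power -1/2 of T makes T p^2 constant by its logarithmic derivative, whatever the
sign of T. -/
lemma exists_projFrame (h1 : IsUnit (J.u 1)) (h : ∀ v, J.u 1 * v = 1 → IsUnit (J.schwarzian v)) :
    Nonempty (ProjFrame J) := by
  obtain ⟨v, hv⟩ := h1.exists_right_inv
  have hT := h v hv
  obtain ⟨p, hp, hd⟩ := J.rpow _ hT (-1 / 2)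
  obtain ⟨π, hπ⟩ := hp.exists_right_inv
  obtain ⟨s, hs⟩ := (hT.mul (hp.pow 2)).exists_left_inv
  have hdp : ∀ a, (2 * J.schwarzian v) * J.d a p = -p * J.d a (J.schwarzian v) := fun a => by
    have h1 : (2 : K) * algebraMap ℝ K (-1 / 2) = -1 := by
      rw [← map_ofNat (algebraMap ℝ K) 2, ← map_mul]
      norm_num
    have h2 := hd a
    rw [Algebra.smul_def] at h2
    linear_combination 2 * h2 + p * J.d a (J.schwarzian v) * h1
  refine ⟨⟨v, p, π, _, s, hv, hπ, hs, rfl, hdp, fun a => ?_⟩⟩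
  rw [Derivation.leibniz, Derivation.leibniz_pow, smul_eq_mul, smul_eq_mul, nsmul_eq_mul]
  push_cast
  linear_combination p * hdp a

/-- A projectively invariant equation of order six has no symmetries of order at least seven, in
any jet algebra where the relevant functions are invertible. -/
theorem not_symmetry [Nontrivial K] {Ψ Q : K} {n : ℕ} (hΨ : J.InfinitesimallyInvariant Ψ)
    (h1 : IsUnit (J.u 1)) (hS : ∀ v, J.u 1 * v = 1 → IsUnit (J.schwarzian v))
    (h6 : IsUnit (J.du 6 Ψ)) (hn : 7 ≤ n) (hQ : J.OrdLE Q n) (hQn : IsUnit (J.du n Q))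
    (hsym : J.Dt Ψ Q = J.evol Q Ψ) : False := by
  obtain ⟨𝓕⟩ := exists_projFrame h1 hS
  obtain ⟨F, Fk, Fq, rfl, hF⟩ := 𝓕.exists_inv hΨ
  have hFq : IsUnit Fq := by
    rw [ProjFrame.du_six hF] at h6
    exact isUnit_of_mul_isUnit_right h6
  -- f is proportional to the power -1/6 of the separant, divided by that of the factor p^6
  -- contained in it.
  obtain ⟨f, hfu, hd⟩ := J.rpow Fq hFq (-1 / 6)
  have hrel : ∀ e, 6 * Fq * J.d e f = -f * J.d e Fq := fun a => by
    have h1 : (6 : K) * algebraMap ℝ K (-1 / 6) = -1 := by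
      rw [← map_ofNat (algebraMap ℝ K) 6, ← map_mul]
      norm_num
    have h2 := hd a
    rw [Algebra.smul_def] at h2
    linear_combination 6 * h2 + f * J.d a Fq * h1
  obtain ⟨_, Fkq, Fqq, -, hFq'⟩ := hF.exists_second
  obtain ⟨z, hz⟩ := hFq.exists_left_inv
  have hf : 𝓕.Inv f (algebraMap ℝ K (-1 / 6) * z * f * Fkq)
      (algebraMap ℝ K (-1 / 6) * z * f * Fqq) := fun a => by
    have h2 := hd a
    rw [Algebra.smul_def, hFq' a] at h2
    linear_combination z * h2 - J.d a f * hz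
  obtain ⟨hfq, m, hm⟩ := ProjFrame.eq_q_mul_of_symmetry hn hQ hQn hF hFq hsym hf hfu hrel
  -- Since f = q f_q is a unit, so is its factor α = f_q. In the same way q has no zeros, without
  -- shrinking the domain.
  have hα : IsUnit (algebraMap ℝ K (-1 / 6) * z * f * Fqq) :=
    isUnit_of_mul_isUnit_right (x := 𝓕.q) (by rw [← hfq]; exact hfu)
  obtain ⟨e', he'⟩ := hfu.exists_left_inv
  obtain ⟨α', hα'⟩ := hα.exists_left_inv
  exact ProjFrame.Separant.not_symmetry (𝓕 := 𝓕)
    ⟨F, Fk, Fq, hF, hFq, f, e', he', _, α', hα', m, hm, hfq, hrel⟩ hn hQ hQn hsym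

end JetAlgebra
end

/-! ### Smooth differential functions on an open set of jets form a jet algebra. -/

noncomputable section

open scoped ContDiff Topology

/-! ### Differential functions on an open set of jets -/

/-- The projection of jets, as a linear map. -/
def truncL (n : ℕ) : JetInf →L[ℝ] Jet n :=
  (ContinuousLinearMap.fst ℝ ℝ (ℝ × (ℕ → ℝ))).prod
    (((ContinuousLinearMap.fst ℝ ℝ (ℕ → ℝ)).comp (ContinuousLinearMap.snd ℝ ℝ (ℝ × (ℕ → ℝ)))).prod
      ((ContinuousLinearMap.pi fun i : Fin (n + 1) => ContinuousLinearMap.proj (i : ℕ)).comp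
        ((ContinuousLinearMap.snd ℝ ℝ (ℕ → ℝ)).comp (ContinuousLinearMap.snd ℝ ℝ (ℝ × (ℕ → ℝ))))))

@[simp]
lemma truncL_apply (n : ℕ) (j : JetInf) : truncL n j = trunc n j := rfl

/-- Filling in the higher derivatives of a given jet is a continuous section through it. Openness
makes the image of Ω an open set, on which smooth representatives can be differentiated. -/
lemma isOpenMap_trunc (n : ℕ) : IsOpenMap (trunc n) := by
  refine IsOpenMap.of_sections fun j => ⟨fun p => (p.1, p.2.1, fun k =>
    if h : k < n + 1 then p.2.2 ⟨k, h⟩ else j.2.2 k), ?_, ?_, ?_⟩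
  · refine Continuous.continuousAt ?_
    refine continuous_fst.prodMk ((continuous_fst.comp continuous_snd).prodMk
      (continuous_pi fun k => ?_))
    split_ifs
    · exact (continuous_apply _).comp (continuous_snd.comp continuous_snd)
    · exact continuous_const
  · refine Prod.ext rfl (Prod.ext rfl (funext fun k => ?_))
    simp [trunc]
  · intro p
    refine Prod.ext rfl (Prod.ext rfl (funext fun k => ?_))
    have := k.2
    simp only [trunc, dif_pos this]

/-- The projection of finite jets. -/
def restrictL {m n : ℕ} (h : n ≤ m) : Jet m →L[ℝ] Jet n :=
  (ContinuousLinearMap.fst ℝ ℝ _).prod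
    (((ContinuousLinearMap.fst ℝ ℝ _).comp (ContinuousLinearMap.snd ℝ ℝ _)).prod
      ((ContinuousLinearMap.pi fun i : Fin (n + 1) =>
        ContinuousLinearMap.proj (Fin.castLE (by omega : n + 1 ≤ m + 1) i)).comp
        ((ContinuousLinearMap.snd ℝ ℝ _).comp (ContinuousLinearMap.snd ℝ ℝ _))))

/-- On `Ω`, `f` is the smooth function `g` of the jets of order `n`. -/
def IsRep {Ω : Set JetInf} (f : Ω → ℝ) (n : ℕ) (g : Jet n → ℝ) : Prop :=
  ContDiffOn ℝ ∞ g (trunc n '' Ω) ∧ ∀ j : Ω, f j = g (trunc n j)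

namespace IsRep

variable {Ω : Set JetInf} {f f₁ f₂ : Ω → ℝ} {n m : ℕ}

lemma mono {g : Jet n → ℝ} (h : IsRep f n g) (hnm : n ≤ m) : IsRep f m (g ∘ restrictL hnm) := by
  refine ⟨h.1.comp (restrictL hnm).contDiff.contDiffOn ?_, fun j => h.2 j⟩
  rintro _ ⟨j, hj, rfl⟩
  exact ⟨j, hj, rfl⟩

lemma exists_common {g₁ : Jet n → ℝ} {g₂ : Jet m → ℝ} (h₁ : IsRep f₁ n g₁) (h₂ : IsRep f₂ m g₂) :
    ∃ k g₁' g₂', IsRep f₁ k g₁' ∧ IsRep f₂ k g₂' :=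
  ⟨max n m, _, _, h₁.mono (le_max_left _ _), h₂.mono (le_max_right _ _)⟩

end IsRep

/-- The algebra of differential functions on `Ω`. -/
def JetFun (Ω : Set JetInf) : Subalgebra ℝ (Ω → ℝ) where
  carrier := {f | ∃ n g, IsRep f n g}
  mul_mem' := by
    rintro f₁ f₂ ⟨_, _, h₁⟩ ⟨_, _, h₂⟩
    obtain ⟨k, g₁, g₂, h₁, h₂⟩ := h₁.exists_common h₂
    exact ⟨k, fun p => g₁ p * g₂ p, h₁.1.mul h₂.1, fun j => by rw [Pi.mul_apply, h₁.2, h₂.2]⟩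
  add_mem' := by
    rintro f₁ f₂ ⟨_, _, h₁⟩ ⟨_, _, h₂⟩
    obtain ⟨k, g₁, g₂, h₁, h₂⟩ := h₁.exists_common h₂
    exact ⟨k, fun p => g₁ p + g₂ p, h₁.1.add h₂.1, fun j => by rw [Pi.add_apply, h₁.2, h₂.2]⟩
  algebraMap_mem' r := ⟨0, fun _ => r, contDiffOn_const, fun _ => rfl⟩

namespace JetFun

variable {Ω : Set JetInf}

/-- The extension of a function by zero. -/
def ext (f : Ω → ℝ) (j : JetInf) : ℝ := by
  classical exact if h : j ∈ Ω then f ⟨j, h⟩ else 0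

lemma ext_of_mem (f : Ω → ℝ) {j : JetInf} (h : j ∈ Ω) : ext f j = f ⟨j, h⟩ := dif_pos h

/-- The derivative of `f` in the direction `v`. -/
def dir (v : JetInf) (f : Ω → ℝ) (j : Ω) : ℝ := deriv (fun s : ℝ => ext f (j + s • v)) 0

lemma eventually_mem (hΩ : IsOpen Ω) (j : Ω) (v : JetInf) :
    ∀ᶠ s : ℝ in 𝓝 0, (j : JetInf) + s • v ∈ Ω := by
  have hc : Continuous fun s : ℝ => (j : JetInf) + s • v := by fun_prop
  exact hc.continuousAt.eventually_mem (by simpa using hΩ.mem_nhds j.2)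

lemma isRep_differentiableAt (hΩ : IsOpen Ω) {f : Ω → ℝ} {n : ℕ} {g : Jet n → ℝ} (h : IsRep f n g)
    (j : Ω) : ContDiffAt ℝ ∞ g (trunc n j) :=
  h.1.contDiffAt ((isOpenMap_trunc n Ω hΩ).mem_nhds ⟨j, j.2, rfl⟩)

/-- The directional derivative of any extension. -/
lemma hasDerivAt_of_isRep (hΩ : IsOpen Ω) {f : Ω → ℝ} {n : ℕ} {g : Jet n → ℝ} (h : IsRep f n g)
    {F : JetInf → ℝ} (hF : ∀ j : Ω, F j = f j) (v : JetInf) (j : Ω) :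
    HasDerivAt (fun s : ℝ => F (j + s • v)) (fderiv ℝ g (trunc n j) (trunc n v)) 0 := by
  have hg := ((isRep_differentiableAt hΩ h j).differentiableAt (by simp)).hasFDerivAt
  have hl : HasDerivAt (fun s : ℝ => trunc n (j : JetInf) + s • trunc n v) (trunc n v) 0 := by
    simpa using ((hasDerivAt_id (0 : ℝ)).smul_const (trunc n v)).const_add (trunc n (j : JetInf))
  have h1 : HasFDerivAt g (fderiv ℝ g (trunc n j))
      (trunc n (j : JetInf) + (0 : ℝ) • trunc n v) := by
    simpa using hg
  refine (h1.comp_hasDerivAt 0 hl).congr_of_eventuallyEq ?_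
  filter_upwards [eventually_mem hΩ j v] with s hs
  rw [hF ⟨_, hs⟩, h.2]
  simp only [Function.comp_apply]
  rw [← truncL_apply, map_add, map_smul]
  rfl

lemma dir_eq (hΩ : IsOpen Ω) {f : Ω → ℝ} {n : ℕ} {g : Jet n → ℝ} (h : IsRep f n g) (v : JetInf)
    (j : Ω) : dir v f j = fderiv ℝ g (trunc n j) (trunc n v) :=
  (hasDerivAt_of_isRep hΩ h (fun j => ext_of_mem f j.2) v j).deriv

lemma isRep_dir (hΩ : IsOpen Ω) {f : Ω → ℝ} {n : ℕ} {g : Jet n → ℝ} (h : IsRep f n g) (v : JetInf) :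
    IsRep (dir v f) n fun p => fderiv ℝ g p (trunc n v) :=
  ⟨(h.1.fderiv_of_isOpen (isOpenMap_trunc n Ω hΩ) (by simp)).clm_apply contDiffOn_const,
    fun j => dir_eq hΩ h v j⟩

lemma dir_comm (hΩ : IsOpen Ω) {f : Ω → ℝ} (hf : f ∈ JetFun Ω) (v w : JetInf) :
    dir v (dir w f) = dir w (dir v f) := by
  obtain ⟨n, g, h⟩ := hf
  funext j
  rw [dir_eq hΩ (isRep_dir hΩ h w), dir_eq hΩ (isRep_dir hΩ h v)]
  have hg := isRep_differentiableAt hΩ h j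
  have hd : DifferentiableAt ℝ (fderiv ℝ g) (trunc n j) :=
    (hg.fderiv_right (m := 1) (by norm_cast)).differentiableAt (by simp)
  have key : ∀ a b, fderiv ℝ (fun p => fderiv ℝ g p a) (trunc n j) b =
      fderiv ℝ (fderiv ℝ g) (trunc n j) b a := fun a b => by
    rw [fderiv_clm_apply hd (differentiableAt_const _)]
    simp
  rw [key, key]
  exact (hg.isSymmSndFDerivAt (by simp; norm_cast)).eq _ _

/-- The derivation in the direction `v`. -/
def derivation (hΩ : IsOpen Ω) (v : JetInf) : Derivation ℝ (JetFun Ω) (JetFun Ω) :=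
  Derivation.mk'
    { toFun := fun f => ⟨dir v f, by
        obtain ⟨n, g, h⟩ := f.2
        exact ⟨n, _, isRep_dir hΩ h v⟩⟩
      map_add' := fun f₁ f₂ => by
        obtain ⟨_, _, h₁⟩ := f₁.2
        obtain ⟨_, _, h₂⟩ := f₂.2
        refine Subtype.ext (funext fun j => ?_)
        have e₁ := hasDerivAt_of_isRep hΩ h₁ (fun j => ext_of_mem f₁ j.2) v j
        have e₂ := hasDerivAt_of_isRep hΩ h₂ (fun j => ext_of_mem f₂ j.2) v j
        have e := (e₁.add e₂).deriv
        rw [← dir_eq hΩ h₁, ← dir_eq hΩ h₂] at e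
        refine Eq.trans ?_ e
        change deriv _ 0 = deriv _ 0
        congr 1
        funext s
        by_cases hs : (j : JetInf) + s • v ∈ Ω <;> simp [ext, hs]
      map_smul' := fun r f => by
        obtain ⟨_, _, h₁⟩ := f.2
        refine Subtype.ext (funext fun j => ?_)
        have e := ((hasDerivAt_of_isRep hΩ h₁ (fun j => ext_of_mem f j.2) v j).const_mul r).deriv
        rw [← dir_eq hΩ h₁] at e
        refine Eq.trans ?_ e
        simp only [dir]
        congr 1
        funext s
        by_cases hs : (j : JetInf) + s • v ∈ Ω <;> simp [ext, hs] }
    fun f₁ f₂ => by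
      obtain ⟨_, _, h₁⟩ := f₁.2
      obtain ⟨_, _, h₂⟩ := f₂.2
      refine Subtype.ext (funext fun j => ?_)
      have e₁ := hasDerivAt_of_isRep hΩ h₁ (fun j => ext_of_mem f₁ j.2) v j
      have e₂ := hasDerivAt_of_isRep hΩ h₂ (fun j => ext_of_mem f₂ j.2) v j
      have e := (e₁.mul e₂).deriv
      rw [← dir_eq hΩ h₁, ← dir_eq hΩ h₂] at e
      have e0 : ∀ f : Ω → ℝ, ext f ((j : JetInf) + (0 : ℝ) • v) = f j := fun f => by
        rw [zero_smul, add_zero, ext_of_mem f j.2]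
      rw [e0, e0] at e
      have e' : dir v (f₁ * f₂ : JetFun Ω) j =
          dir v f₁ j * (f₂ : Ω → ℝ) j + (f₁ : Ω → ℝ) j * dir v f₂ j := by
        refine Eq.trans ?_ e
        simp only [dir]
        congr 1
        funext s
        by_cases hs : (j : JetInf) + s • v ∈ Ω <;> simp [ext, hs]
      change dir v (f₁ * f₂ : JetFun Ω) j =
        (f₁ : Ω → ℝ) j * dir v f₂ j + (f₂ : Ω → ℝ) j * dir v f₁ j
      rw [e']
      ring

/-- The direction of a partial derivative. -/
def direction : JetIndex → JetInf
  | .x => (1, 0, 0)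
  | .t => (0, 1, 0)
  | .u i => (0, 0, Pi.single i 1)

lemma trunc_direction_u_of_lt {i n : ℕ} (h : n < i) : trunc n (direction (.u i)) = 0 := by
  refine Prod.ext rfl (Prod.ext rfl (funext fun k => ?_))
  have : (k : ℕ) ≠ i := by have := k.2; omega
  simp [trunc, direction, this]

lemma isRep_coord (i : ℕ) : IsRep (Ω := Ω) (fun j => j.1.2.2 i) i fun p => p.2.2 (Fin.last i) :=
  ⟨ContDiff.contDiffOn (by fun_prop), fun _ => rfl⟩

/-- The jet coordinate `u_{ix}`. -/
def coord (Ω : Set JetInf) (i : ℕ) : JetFun Ω := ⟨fun j => j.1.2.2 i, _, _, isRep_coord i⟩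

lemma dir_coord (hΩ : IsOpen Ω) (v : JetInf) (i : ℕ) (j : Ω) :
    dir v (coord Ω i : Ω → ℝ) j = v.2.2 i := by
  refine (dir_eq hΩ (isRep_coord i) v j).trans ?_
  let L : Jet i →L[ℝ] ℝ := (ContinuousLinearMap.proj (Fin.last i)).comp
    ((ContinuousLinearMap.snd ℝ ℝ _).comp (ContinuousLinearMap.snd ℝ ℝ _))
  change fderiv ℝ L (trunc i j) (trunc i v) = _
  rw [ContinuousLinearMap.fderiv]
  rfl

lemma isUnit_of_forall_ne {f : JetFun Ω} (h : ∀ j, (f : Ω → ℝ) j ≠ 0) : IsUnit f := by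
  obtain ⟨n, g, hg⟩ := f.2
  have hinv : IsRep (fun j => ((f : Ω → ℝ) j)⁻¹) n fun p => (g p)⁻¹ := by
    refine ⟨hg.1.inv ?_, fun j => by simp only [hg.2]⟩
    rintro _ ⟨j, hj, rfl⟩
    rw [← hg.2 ⟨j, hj⟩]
    exact h _
  refine IsUnit.of_mul_eq_one ⟨_, n, _, hinv⟩ (Subtype.ext (funext fun j => ?_))
  exact mul_inv_cancel₀ (h j)

lemma ne_zero_of_isUnit {f : JetFun Ω} (h : IsUnit f) (j : Ω) : (f : Ω → ℝ) j ≠ 0 := by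
  obtain ⟨g, hg⟩ := h.exists_right_inv
  have h1 := congrArg (fun f : JetFun Ω => (f : Ω → ℝ) j) hg
  exact left_ne_zero_of_mul_eq_one h1

/-- The function (y^2)^(c/2) = |y|^c is smooth where y has no zeros, so that neither a sign nor
connectedness of the domain has to be discussed. -/
lemma exists_rpow (hΩ : IsOpen Ω) {y : JetFun Ω} (hy : IsUnit y) (c : ℝ) :
    ∃ g, IsUnit g ∧ ∀ v, y * derivation hΩ v g = c • (g * derivation hΩ v y) := by
  have hne := ne_zero_of_isUnit hy
  obtain ⟨n, g, hg⟩ := y.2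
  have hrep : IsRep (fun j => ((y : Ω → ℝ) j ^ 2) ^ (c / 2)) n fun p => (g p ^ 2) ^ (c / 2) := by
    refine ⟨(hg.1.pow 2).rpow_const_of_ne ?_, fun j => by simp only [hg.2]⟩
    rintro _ ⟨j, hj, rfl⟩
    rw [← hg.2 ⟨j, hj⟩]
    exact pow_ne_zero 2 (hne _)
  refine ⟨⟨_, n, _, hrep⟩, isUnit_of_forall_ne fun j => ?_,
    fun v => Subtype.ext (funext fun j => ?_)⟩
  · exact (Real.rpow_pos_of_pos (by have := hne j; positivity) _).ne'
  · have hy' := hasDerivAt_of_isRep hΩ hg (fun j => ext_of_mem y j.2) v j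
    rw [← dir_eq hΩ hg] at hy'
    have e0 : ext (y : Ω → ℝ) ((j : JetInf) + (0 : ℝ) • v) = (y : Ω → ℝ) j := by
      rw [zero_smul, add_zero, ext_of_mem _ j.2]
    have h1 := (hy'.pow 2).rpow_const (p := c / 2) (Or.inl (by
      simp only [Pi.pow_apply, e0]
      exact pow_ne_zero 2 (hne j)))
    have h2 := (h1.congr_of_eventuallyEq (f₁ := fun s : ℝ =>
        ext (fun j => ((y : Ω → ℝ) j ^ 2) ^ (c / 2)) ((j : JetInf) + s • v)) (by
      filter_upwards [eventually_mem hΩ j v] with s hs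
      simp only [Pi.pow_apply]
      rw [ext_of_mem _ hs, ext_of_mem _ hs])).deriv
    change (y : Ω → ℝ) j * dir v (fun j => ((y : Ω → ℝ) j ^ 2) ^ (c / 2)) j =
      c * (((y : Ω → ℝ) j ^ 2) ^ (c / 2) * dir v y j)
    rw [dir, h2]
    simp only [Pi.pow_apply, e0]
    rw [Real.rpow_sub_one (pow_ne_zero 2 (hne j))]
    have := hne j
    field_simp
    ring

/-- The differential functions on an open set of jets form a jet algebra. -/
def jetAlgebra (hΩ : IsOpen Ω) : JetAlgebra (JetFun Ω) where
  d e := derivation hΩ (direction e)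
  u := coord Ω
  d_comm a b f := Subtype.ext (dir_comm hΩ f.2 _ _)
  dx_u j := Subtype.ext (funext fun p => dir_coord hΩ _ j p)
  dt_u j := Subtype.ext (funext fun p => dir_coord hΩ _ j p)
  du_u i j := Subtype.ext (funext fun p => (dir_coord hΩ _ j p).trans (by
    by_cases h : i = j
    · subst h; simp [direction]
    · rw [if_neg h]; simp [direction, Ne.symm h]))
  finite f := by
    obtain ⟨n, g, h⟩ := f.2
    refine ⟨n + 1, fun i hi => Subtype.ext (funext fun p => (dir_eq hΩ h _ p).trans ?_)⟩
    rw [trunc_direction_u_of_lt (by omega), map_zero]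
    rfl
  rpow y hy c := by
    obtain ⟨g, h1, h2⟩ := exists_rpow hΩ hy c
    exact ⟨g, h1, fun a => h2 _⟩

/-- Evaluation at a jet. -/
def evalAt (j : Ω) : JetFun Ω →+* ℝ :=
  (Pi.evalRingHom (fun _ : Ω => ℝ) j).comp (JetFun Ω).val.toRingHom

lemma evalAt_apply (j : Ω) (f : JetFun Ω) : evalAt j f = (f : Ω → ℝ) j := rfl

/-- `F` restricts to `f` on `Ω`. -/
def Agrees (F : JetInf → ℝ) (f : JetFun Ω) : Prop := ∀ j : Ω, F j = evalAt j f

section Agrees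

variable {F H : JetInf → ℝ} {f h : JetFun Ω}

lemma Agrees.hasDerivAt (hΩ : IsOpen Ω) (hF : Agrees F f) (e : JetIndex) (j : Ω) :
    HasDerivAt (fun s : ℝ => F (j + s • direction e)) (evalAt j ((jetAlgebra hΩ).d e f)) 0 := by
  obtain ⟨n, g, hg⟩ := f.2
  have := hasDerivAt_of_isRep hΩ hg hF (direction e) j
  rwa [← dir_eq hΩ hg] at this

lemma Agrees.partialX (hΩ : IsOpen Ω) (hF : Agrees F f) (j : Ω) :
    partialX F j = evalAt j ((jetAlgebra hΩ).d .x f) := by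
  have h := hF.hasDerivAt hΩ .x j
  rw [← sub_self (j : JetInf).1] at h
  refine (HasDerivAt.congr_of_eventuallyEq (h.comp_sub_const _ _)
    (Filter.Eventually.of_forall fun s => ?_)).deriv
  congr 1
  refine Prod.ext ?_ (Prod.ext ?_ ?_) <;> simp [direction]

lemma Agrees.partialT (hΩ : IsOpen Ω) (hF : Agrees F f) (j : Ω) :
    partialT F j = evalAt j ((jetAlgebra hΩ).d .t f) := by
  have h := hF.hasDerivAt hΩ .t j
  rw [← sub_self (j : JetInf).2.1] at h
  refine (HasDerivAt.congr_of_eventuallyEq (h.comp_sub_const _ _)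
    (Filter.Eventually.of_forall fun s => ?_)).deriv
  congr 1
  refine Prod.ext ?_ (Prod.ext ?_ ?_) <;> simp [direction]

lemma Agrees.partialU (hΩ : IsOpen Ω) (hF : Agrees F f) (k : ℕ) (j : Ω) :
    partialU k F j = evalAt j ((jetAlgebra hΩ).du k f) := by
  have h := hF.hasDerivAt hΩ (.u k) j
  rw [← sub_self ((j : JetInf).2.2 k)] at h
  refine (HasDerivAt.congr_of_eventuallyEq (h.comp_sub_const _ _)
    (Filter.Eventually.of_forall fun s => ?_)).deriv
  congr 1
  refine Prod.ext ?_ (Prod.ext ?_ (funext fun i => ?_))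
  · simp [direction]
  · simp [direction]
  · by_cases hi : i = k
    · subst hi; simp [direction]
    · simp [direction, hi]

lemma Agrees.finsum_partialU (hΩ : IsOpen Ω) (hF : Agrees F f) (j : Ω) {c : ℕ → ℝ}
    {c' : ℕ → JetFun Ω}
    (hc : ∀ k, c k = evalAt j (c' k)) :
    ∑ᶠ k, c k * _root_.partialU k F j = evalAt j ((jetAlgebra hΩ).field c' f) := by
  obtain ⟨N, hN⟩ := (jetAlgebra hΩ).finite f
  rw [(jetAlgebra hΩ).field_eq_sum c' hN, map_sum,
    finsum_eq_sum_of_support_subset (s := Finset.range N)]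
  · exact Finset.sum_congr rfl fun k _ => by rw [map_mul, hc, hF.partialU hΩ]
  · intro k hk
    by_contra h
    simp only [Finset.coe_range, Set.mem_Iio, not_lt] at h
    refine hk ?_
    simp only [hF.partialU hΩ]
    change c k * evalAt j ((jetAlgebra hΩ).d (.u k) f) = 0
    rw [hN k h, map_zero, mul_zero]

lemma Agrees.totalX (hΩ : IsOpen Ω) (hF : Agrees F f) : Agrees (totalX F) ((jetAlgebra hΩ).D f) :=
    fun j => by
  rw [_root_.totalX, hF.partialX hΩ, hF.finsum_partialU hΩ j
    (c := fun k => (j : JetInf).2.2 (k + 1))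
    (c' := fun k => coord Ω (k + 1)) (fun k => rfl), ← map_add]
  congr 1
  change _ = (1 : JetFun Ω) * _ + (0 : JetFun Ω) * _ + (jetAlgebra hΩ).field _ f
  rw [one_mul, zero_mul, add_zero]
  rfl

lemma Agrees.iterate_totalX (hΩ : IsOpen Ω) (hF : Agrees F f) (k : ℕ) :
    Agrees (_root_.totalX^[k] F) ((⇑(jetAlgebra hΩ).D)^[k] f) := by
  induction k with
  | zero => exact hF
  | succ k ih =>
    rw [Function.iterate_succ_apply', Function.iterate_succ_apply']
    exact ih.totalX hΩ

lemma Agrees.linearization (hΩ : IsOpen Ω) (hF : Agrees F f) (hH : Agrees H h) :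
    Agrees (linearization F H) ((jetAlgebra hΩ).evol h f) := fun j => by
  rw [_root_.linearization, finsum_congr fun k => mul_comm _ _,
    hF.finsum_partialU hΩ j (fun k => hH.iterate_totalX hΩ k j)]
  congr 1
  change _ = (0 : JetFun Ω) * _ + (0 : JetFun Ω) * _ + (jetAlgebra hΩ).field _ f
  rw [zero_mul, zero_mul, add_zero, zero_add]

lemma Agrees.totalT (hΩ : IsOpen Ω) (hF : Agrees F f) (hH : Agrees H h) :
    Agrees (totalT H F) ((jetAlgebra hΩ).Dt h f) := fun j => by
  rw [_root_.totalT, hF.partialT hΩ, hF.linearization hΩ hH j, ← map_add, JetAlgebra.Dt_eq]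

end Agrees

end JetFun
end

/-! ### Differentiation with respect to a parameter, and polynomials with prescribed jets. -/

noncomputable section

open scoped ContDiff Topology

/-! ### Differentiation with respect to a parameter -/

lemma hasDerivAt_fst {W : ℝ × ℝ → ℝ} {c x : ℝ} (h : DifferentiableAt ℝ W (c, x)) :
    HasDerivAt (fun c => W (c, x)) (fderiv ℝ W (c, x) (1, 0)) c :=
  h.hasFDerivAt.comp_hasDerivAt c ((hasDerivAt_id c).prodMk (hasDerivAt_const c x))

lemma hasDerivAt_snd {W : ℝ × ℝ → ℝ} {c x : ℝ} (h : DifferentiableAt ℝ W (c, x)) :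
    HasDerivAt (fun x => W (c, x)) (fderiv ℝ W (c, x) (0, 1)) x :=
  h.hasFDerivAt.comp_hasDerivAt x ((hasDerivAt_const x c).prodMk (hasDerivAt_id x))

/-- Derivatives with respect to a parameter commute with iterated derivatives. -/
lemma hasDerivAt_iteratedDeriv (i : ℕ) {W : ℝ × ℝ → ℝ} {c₀ x₀ : ℝ}
    (hW : ContDiffAt ℝ ∞ W (c₀, x₀)) :
    HasDerivAt (fun c => iteratedDeriv i (fun x => W (c, x)) x₀)
      (iteratedDeriv i (fun x => deriv (fun c => W (c, x)) c₀) x₀) c₀ := by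
  induction i generalizing W with
  | zero =>
    simp only [iteratedDeriv_zero]
    exact (hasDerivAt_fst (hW.differentiableAt (by simp))).differentiableAt.hasDerivAt
  | succ i ih =>
    have hev : ∀ᶠ q in 𝓝 (c₀, x₀), ContDiffAt ℝ 2 W q :=
      (hW.of_le (by norm_cast)).eventually (by simp)
    have hfd : ∀ {q}, ContDiffAt ℝ 2 W q → DifferentiableAt ℝ (fderiv ℝ W) q := fun h =>
      (h.fderiv_right (m := 1) (by norm_num)).differentiableAt (by simp)
    have h2 : ∀ {q : ℝ × ℝ}, (∀ᶠ q in 𝓝 q, ContDiffAt ℝ 2 W q) →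
        (fun q : ℝ × ℝ => deriv (fun x => W (q.1, x)) q.2) =ᶠ[𝓝 q]
          fun q => fderiv ℝ W q (0, 1) := fun h => by
      filter_upwards [h] with q hq
      exact (hasDerivAt_snd (hq.differentiableAt (by simp))).deriv
    have h1 : ∀ {q : ℝ × ℝ}, (∀ᶠ q in 𝓝 q, ContDiffAt ℝ 2 W q) →
        (fun q : ℝ × ℝ => deriv (fun c => W (c, q.2)) q.1) =ᶠ[𝓝 q]
          fun q => fderiv ℝ W q (1, 0) := fun h => by
      filter_upwards [h] with q hq
      exact (hasDerivAt_fst (hq.differentiableAt (by simp))).deriv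
    -- The induction hypothesis is applied to ∂W/∂x; what remains is the symmetry of the second
    -- derivatives of W near the base point.
    have hW1 : ContDiffAt ℝ ∞ (fun q : ℝ × ℝ => deriv (fun x => W (q.1, x)) q.2) (c₀, x₀) :=
      ((hW.fderiv_right (m := ∞) (by simp)).clm_apply contDiffAt_const).congr_of_eventuallyEq
        (h2 hev)
    have key := ih hW1
    simp only [iteratedDeriv_succ']
    convert key using 1
    refine Filter.EventuallyEq.iteratedDeriv_eq i ?_
    have hev2 : ∀ᶠ x in 𝓝 x₀, ∀ᶠ q in 𝓝 (c₀, x), ContDiffAt ℝ 2 W q :=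
      (Continuous.continuousAt (by fun_prop : Continuous fun x : ℝ => (c₀, x))).eventually
        hev.eventually_nhds
    filter_upwards [hev2] with x hx
    have hq := hx.self_of_nhds
    have e1 := (hasDerivAt_fst (W := fun q => fderiv ℝ W q (0, 1)) (c := c₀) (x := x)
      ((hfd hq).clm_apply (differentiableAt_const _))).congr_of_eventuallyEq
      ((Continuous.continuousAt (by fun_prop : Continuous fun c : ℝ => (c, x))).eventually (h2 hx))
    have e2 := (hasDerivAt_snd (W := fun q => fderiv ℝ W q (1, 0)) (c := c₀) (x := x)
      ((hfd hq).clm_apply (differentiableAt_const _))).congr_of_eventuallyEq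
      ((Continuous.continuousAt (by fun_prop : Continuous fun x : ℝ => (c₀, x))).eventually (h1 hx))
    refine e2.deriv.trans (Eq.trans ?_ e1.deriv.symm)
    rw [fderiv_clm_apply (hfd hq) (differentiableAt_const _),
      fderiv_clm_apply (hfd hq) (differentiableAt_const _)]
    simpa using (hq.isSymmSndFDerivAt (by simp)).eq _ _

/-! ### Polynomial test functions -/

open Polynomial in
/-- The polynomial with the given derivatives at `0`. -/
def jetPoly {n : ℕ} (y : Fin (n + 1) → ℝ) : ℝ[X] :=
  ∑ i : Fin (n + 1), monomial (i : ℕ) (y i / (i : ℕ).factorial)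

lemma coeff_jetPoly {n : ℕ} (y : Fin (n + 1) → ℝ) (i : Fin (n + 1)) :
    (jetPoly y).coeff i = y i / (i : ℕ).factorial := by
  simp [jetPoly, Polynomial.finsetSum_coeff, Polynomial.coeff_monomial, Fin.val_inj]

lemma iteratedDeriv_eval (P : Polynomial ℝ) (x₀ : ℝ) (i : ℕ) :
    iteratedDeriv i (fun x => P.eval (x - x₀)) x₀ = i.factorial * P.coeff i := by
  have h : iteratedDeriv i (fun x => P.eval (x - x₀)) = fun x =>
      (Polynomial.derivative^[i] P).eval (x - x₀) := by
    induction i with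
    | zero => simp
    | succ i ih =>
      rw [iteratedDeriv_succ, ih, Function.iterate_succ_apply']
      funext x
      exact ((Polynomial.hasDerivAt _ _).comp_sub_const x x₀).deriv
  rw [h]
  simp only [sub_self]
  rw [← Polynomial.coeff_zero_eq_eval_zero, Polynomial.coeff_iterate_derivative]
  simp [Nat.descFactorial_self]
end

/-! ### Finite projective transformations of the right-hand side. -/

noncomputable section

open scoped ContDiff Topology

lemma moebius_inv_apply (B : Matrix.SpecialLinearGroup (Fin 2) ℝ) (x : ℝ) :
    moebius B⁻¹ x = (B.1 1 1 * x - B.1 0 1) / (-B.1 1 0 * x + B.1 0 0) := by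
  rw [moebius, Matrix.SpecialLinearGroup.SL2_inv_expl]
  simp [sub_eq_add_neg]

lemma denom_inv_ne_zero {B : Matrix.SpecialLinearGroup (Fin 2) ℝ} {x : ℝ}
    (h : B.1 1 0 * x + B.1 1 1 ≠ 0)
    (hx : moebius B x = x) : -B.1 1 0 * x + B.1 0 0 ≠ 0 := by
  have hdet := B.det_coe
  rw [Matrix.det_fin_two] at hdet
  rw [moebius, div_eq_iff h] at hx
  intro h0
  have : (1 : ℝ) = 0 := by
    rw [← hdet]
    linear_combination (B.1 1 0 * x + B.1 1 1) * h0 - B.1 1 0 * hx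
  exact one_ne_zero this

lemma moebius_inv_of_fixed {B : Matrix.SpecialLinearGroup (Fin 2) ℝ} {x : ℝ}
    (h : B.1 1 0 * x + B.1 1 1 ≠ 0)
    (hx : moebius B x = x) : moebius B⁻¹ x = x := by
  have h1 := denom_inv_ne_zero h hx
  rw [moebius_inv_apply, div_eq_iff h1]
  rw [moebius, div_eq_iff h] at hx
  linear_combination -hx

lemma contDiff_eval (P : Polynomial ℝ) : ContDiff ℝ ∞ fun x : ℝ => P.eval x := by
  have h := P.contDiff_aeval (𝕜 := ℝ) ∞
  simpa only [Polynomial.coe_aeval_eq_eval] using h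

namespace EvolutionEquation

variable {p : ℕ} (E : EvolutionEquation p)

/-- A function with a given jet that satisfies the equation at one point. -/
def testFunction (q : Jet p) (x t : ℝ) : ℝ := (jetPoly q.2.2).eval (x - q.1) + (t - q.2.1) * E.rhs q

lemma contDiff_testFunction (q : Jet p) :
    ContDiff ℝ ∞ fun z : ℝ × ℝ => E.testFunction q z.1 z.2 := by
  have h1 : ContDiff ℝ ∞ fun z : ℝ × ℝ => (jetPoly q.2.2).eval (z.1 - q.1) :=
    (contDiff_eval _).comp (contDiff_fst.sub contDiff_const)
  exact h1.add ((contDiff_snd.sub contDiff_const).mul contDiff_const)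

lemma jetOf_testFunction (q : Jet p) : jetOf p (E.testFunction q) q.1 q.2.1 = q := by
  refine Prod.ext rfl (Prod.ext rfl (funext fun i => ?_))
  simp only [jetOf, testFunction, sub_self, zero_mul, add_zero]
  rw [iteratedDeriv_eval, coeff_jetPoly]
  field_simp

lemma holdsAt_testFunction {q : Jet p} (hq : q ∈ E.dom) :
    E.HoldsAt (E.testFunction q) q.1 q.2.1 := by
  refine ⟨by rwa [jetOf_testFunction], ?_⟩
  rw [jetOf_testFunction]
  simp only [testFunction]
  simp

lemma testFunction_self (q : Jet p) : E.testFunction q q.1 q.2.1 = q.2.2 0 := by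
  have h := congrArg (fun q : Jet p => q.2.2 0) (E.jetOf_testFunction q)
  simpa [jetOf] using h

variable {E}

/-- The action of a transformation that fixes the base point. -/
lemma rhs_transform (hE : E.IsProjectivelyInvariant) {q : Jet p} (hq : q ∈ E.dom)
    (A B : Matrix.SpecialLinearGroup (Fin 2) ℝ)
    (hB : B.1 1 0 * q.1 + B.1 1 1 ≠ 0) (hBx : moebius B q.1 = q.1)
    (hA : A.1 1 0 * q.2.2 0 + A.1 1 1 ≠ 0) {W : ℝ → ℝ}
    (hW : ∀ x, W x = moebius A ((jetPoly q.2.2).eval (moebius B x - q.1)))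
    (hdom : ((q.1, q.2.1, fun i => iteratedDeriv i W q.1) : Jet p) ∈ E.dom) :
    E.rhs (q.1, q.2.1, fun i => iteratedDeriv i W q.1) =
      E.rhs q * ((A.1 1 0 * q.2.2 0 + A.1 1 1) ^ 2)⁻¹ := by
  have hx := moebius_inv_of_fixed hB hBx
  -- The inverse of B is used so that the transformed function is composed with B itself.
  have hj : jetOf p (transformed A B⁻¹ 0 (E.testFunction q)) q.1 q.2.1 =
      ((q.1, q.2.1, fun i => iteratedDeriv i W q.1) : Jet p) := by
    refine Prod.ext rfl (Prod.ext rfl (funext fun i => ?_))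
    simp only [jetOf, transformed, inv_inv, testFunction, sub_zero, sub_self, zero_mul, add_zero,
      ← hW]
  have h := hE A B⁻¹ 0 (E.testFunction q) q.1 q.2.1 (E.contDiff_testFunction q).contDiffAt
    (by
      have := denom_inv_ne_zero hB hBx
      rw [Matrix.SpecialLinearGroup.SL2_inv_expl]
      simpa using this)
    (by rwa [testFunction_self]) (E.holdsAt_testFunction hq)
    (by rwa [hx, add_zero, hj])
  rw [hx, add_zero] at h
  rw [← hj, ← h.2]
  have h0 : (jetPoly q.2.2).eval 0 = q.2.2 0 := by
    have := E.testFunction_self q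
    simpa [testFunction] using this
  have hdet := A.det_coe
  rw [Matrix.det_fin_two] at hdet
  have hd : HasDerivAt (fun s : ℝ => q.2.2 0 + (s - q.2.1) * E.rhs q) (E.rhs q) q.2.1 := by
    simpa using (((hasDerivAt_id q.2.1).sub_const q.2.1).mul_const (E.rhs q)).const_add (q.2.2 0)
  have hd2 := ((hd.const_mul (A.1 0 0)).add_const (A.1 0 1)).div
    ((hd.const_mul (A.1 1 0)).add_const (A.1 1 1)) (by simpa using hA)
  have hfun : (fun s => transformed A B⁻¹ 0 (E.testFunction q) q.1 s) = fun s : ℝ =>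
      (A.1 0 0 * (q.2.2 0 + (s - q.2.1) * E.rhs q) + A.1 0 1) /
        (A.1 1 0 * (q.2.2 0 + (s - q.2.1) * E.rhs q) + A.1 1 1) := by
    funext s
    simp only [transformed, inv_inv, testFunction, sub_zero, hBx, sub_self, h0]
    rfl
  rw [hfun]
  refine hd2.deriv.trans ?_
  simp only [sub_self, zero_mul, add_zero]
  -- The factor is the derivative of the fractional linear map A at u, whose numerator is the
  -- determinant.
  rw [div_eq_mul_inv]
  congr 1
  linear_combination E.rhs q * hdet

lemma rhs_translate (hE : E.IsProjectivelyInvariant) {q : Jet p} (hq : q ∈ E.dom) (a b : ℝ)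
    (hdom : (q.1 + a, q.2.1 + b, q.2.2) ∈ E.dom) :
    E.rhs (q.1 + a, q.2.1 + b, q.2.2) = E.rhs q := by
  let B : Matrix.SpecialLinearGroup (Fin 2) ℝ := ⟨!![1, a; 0, 1], by simp [Matrix.det_fin_two]⟩
  have hB : moebius B q.1 = q.1 + a := by simp [moebius, B]
  have hB' : ∀ x, moebius B⁻¹ x = x - a := fun x => by rw [moebius_inv_apply]; simp [B]
  have h1 : ∀ x, moebius 1 x = x := fun x => by simp [moebius]
  have hj : jetOf p (transformed 1 B b (E.testFunction q)) (q.1 + a) (q.2.1 + b) =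
      ((q.1 + a, q.2.1 + b, q.2.2) : Jet p) := by
    refine Prod.ext rfl (Prod.ext rfl (funext fun i => ?_))
    have h := congrArg (fun q : Jet p => q.2.2 i) (E.jetOf_testFunction q)
    simp only [jetOf] at h
    simp only [jetOf, transformed, h1, hB', add_sub_cancel_right]
    rw [iteratedDeriv_comp_sub_const i (fun s => E.testFunction q s q.2.1) a]
    simp only [add_sub_cancel_right]
    exact h
  have h := hE 1 B b (E.testFunction q) q.1 q.2.1 (E.contDiff_testFunction q).contDiffAt
    (by simp [B]) (by simp) (E.holdsAt_testFunction hq) (by rwa [hB, hj])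
  rw [hB] at h
  rw [← hj, ← h.2]
  simp only [transformed, h1, hB', add_sub_cancel_right]
  have h2 := (E.holdsAt_testFunction hq).2
  rw [jetOf_testFunction] at h2
  rw [← h2]
  have := deriv_comp_sub_const (f := fun s => E.testFunction q q.1 s) (a := b) (x := q.2.1 + b)
  simpa using this

lemma differentiableAt_rhs {q : Jet p} (hq : q ∈ E.dom) : DifferentiableAt ℝ E.rhs q :=
  (E.smooth_rhs.contDiffAt (E.isOpen_dom.mem_nhds hq)).differentiableAt (by simp)

/-- The derivative of the right-hand side with respect to a jet coordinate. -/
def rhsDeriv (E : EvolutionEquation p) (q : Jet p) (i : Fin (p + 1)) : ℝ :=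
  fderiv ℝ E.rhs q (0, 0, Pi.single i 1)

lemma fderiv_rhs_eq_sum (q : Jet p) (y : Fin (p + 1) → ℝ) :
    fderiv ℝ E.rhs q (0, 0, y) = ∑ i, y i * E.rhsDeriv q i := by
  have h : ((0, 0, y) : Jet p) = ∑ i, y i • ((0, 0, Pi.single i 1) : Jet p) := by
    refine Prod.ext ?_ (Prod.ext ?_ (funext fun k => ?_))
    · simp [Prod.fst_sum]
    · simp [Prod.fst_sum, Prod.snd_sum]
    · simp [Prod.snd_sum, Finset.sum_apply, Pi.single_apply]
  rw [h, map_sum]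
  exact Finset.sum_congr rfl fun i _ => by rw [map_smul, smul_eq_mul, rhsDeriv]

/-- The infinitesimal invariance under a one-parameter family of transformations that fixes the
base point. -/
lemma sum_rhsDeriv (hE : E.IsProjectivelyInvariant) {q : Jet p} (hq : q ∈ E.dom)
    {A B : ℝ → Matrix.SpecialLinearGroup (Fin 2) ℝ}
    {W : ℝ × ℝ → ℝ} {R : Polynomial ℝ} {m : ℝ}
    (hB : ∀ᶠ c in 𝓝 (0 : ℝ), (B c).1 1 0 * q.1 + (B c).1 1 1 ≠ 0 ∧ moebius (B c) q.1 = q.1)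
    (hW : ∀ c x, W (c, x) = moebius (A c) ((jetPoly q.2.2).eval (moebius (B c) x - q.1)))
    (hsm : ContDiffAt ℝ ∞ W (0, q.1))
    (hW0 : ∀ x, W (0, x) = (jetPoly q.2.2).eval (x - q.1))
    (hR : ∀ᶠ x in 𝓝 q.1, HasDerivAt (fun c => W (c, x)) (R.eval (x - q.1)) 0)
    (hA : (A 0).1 1 0 * q.2.2 0 + (A 0).1 1 1 = 1)
    (hm : HasDerivAt (fun c => (A c).1 1 0 * q.2.2 0 + (A c).1 1 1) m 0) :
    ∑ i : Fin (p + 1), (i : ℕ).factorial * R.coeff i * E.rhsDeriv q i = -2 * m * E.rhs q := by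
  -- Invariance determines Ψ along this curve of transformed jets as Ψ times the power -2 of the
  -- denominator of A. The derivative at 0, where that denominator is 1, produces the factor -2 m.
  set γ : ℝ → Jet p := fun c => (q.1, q.2.1, fun i => iteratedDeriv i (fun x => W (c, x)) q.1)
    with hγ
  have hγ0 : γ 0 = q := by
    refine Prod.ext rfl (Prod.ext rfl (funext fun i => ?_))
    simp only [hγ, hW0, iteratedDeriv_eval, coeff_jetPoly]
    field_simp
  have hd : HasDerivAt γ (0, 0, fun i : Fin (p + 1) => (i : ℕ).factorial * R.coeff i) 0 := by
    refine (hasDerivAt_const _ _).prodMk ((hasDerivAt_const _ _).prodMk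
      (hasDerivAt_pi.2 fun i => ?_))
    have h := hasDerivAt_iteratedDeriv (i : ℕ) hsm
    have e : (fun x => deriv (fun c => W (c, x)) 0) =ᶠ[𝓝 q.1] fun x => R.eval (x - q.1) := by
      filter_upwards [hR] with x hx
      exact hx.deriv
    rwa [e.iteratedDeriv_eq, iteratedDeriv_eval] at h
  have hdom : ∀ᶠ c in 𝓝 (0 : ℝ), γ c ∈ E.dom :=
    hd.continuousAt.eventually_mem (by rw [hγ0]; exact E.isOpen_dom.mem_nhds hq)
  have hA' : ∀ᶠ c in 𝓝 (0 : ℝ), (A c).1 1 0 * q.2.2 0 + (A c).1 1 1 ≠ 0 :=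
    hm.continuousAt.eventually_ne (by rw [hA]; exact one_ne_zero)
  have hr : HasFDerivAt E.rhs (fderiv ℝ E.rhs q) (γ 0) := by
    rw [hγ0]; exact (differentiableAt_rhs hq).hasFDerivAt
  have h1 := hr.comp_hasDerivAt 0 hd
  have h2 := ((hm.pow 2).inv (by simp [hA])).const_mul (E.rhs q)
  have h3 : E.rhs ∘ γ =ᶠ[𝓝 0] fun c =>
      E.rhs q * (((A c).1 1 0 * q.2.2 0 + (A c).1 1 1) ^ 2)⁻¹ := by
    filter_upwards [hdom, hA', hB] with c h1 h2 h3
    exact rhs_transform hE hq (A c) (B c) h3.1 h3.2 h2 (hW c) h1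
  have h4 := h1.unique (h2.congr_of_eventuallyEq h3)
  rw [fderiv_rhs_eq_sum] at h4
  rw [h4]
  simp [hA]
  ring

end EvolutionEquation
end

/-! ### The infinitesimal generators of the projective group. -/

noncomputable section

open scoped ContDiff Topology

namespace EvolutionEquation

open Polynomial

variable {p : ℕ} {E : EvolutionEquation p}

lemma coeff_jetPoly_trunc (j : JetInf) {k : ℕ} (hk : k ≤ p) :
    (jetPoly (trunc p j).2.2).coeff k = j.2.2 k / k.factorial :=
  coeff_jetPoly (trunc p j).2.2 ⟨k, by omega⟩

lemma contDiffAt_eval {n : ℕ} (y : Fin (n + 1) → ℝ) {f : ℝ × ℝ → ℝ} {z : ℝ × ℝ}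
    (hf : ContDiffAt ℝ ∞ f z) : ContDiffAt ℝ ∞ (fun z => (jetPoly y).eval (f z)) z :=
  (contDiff_eval _).contDiffAt.comp z hf

variable {j : JetInf}

/-- From the translations u ↦ u + c. -/
lemma rhsDeriv_zero (hE : E.IsProjectivelyInvariant) (hj : trunc p j ∈ E.dom) :
     E.rhsDeriv (trunc p j) 0 = 0 := by
  have h := sum_rhsDeriv hE hj (A := fun c => ⟨!![1, c; 0, 1], by simp [Matrix.det_fin_two]⟩)
    (B := fun _ => 1) (W := fun z => (jetPoly (trunc p j).2.2).eval (z.2 - (trunc p j).1) + z.1)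
    (R := 1) (m := 0) (by simp [moebius]) (fun c x => by simp [moebius])
    ((contDiffAt_eval _ (by fun_prop)).add contDiffAt_fst) (fun x => by simp)
    (Filter.Eventually.of_forall fun x => by
      simpa using (hasDerivAt_id (0 : ℝ)).const_add
        ((jetPoly (trunc p j).2.2).eval (x - (trunc p j).1)))
    (by simp) (by simpa using hasDerivAt_const (0 : ℝ) (1 : ℝ))
  rw [Fin.sum_univ_succ, Finset.sum_eq_zero] at h
  · simpa using h
  · intro i _
    simp [coeff_one]

/-- From the scalings u ↦ e^(2c) u; the factor 2 appears on both sides and is divided out. -/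
lemma sum_scale_u (hE : E.IsProjectivelyInvariant) (hj : trunc p j ∈ E.dom) :
    ∑ i : Fin (p + 1), j.2.2 i * E.rhsDeriv (trunc p j) i = E.rhs (trunc p j) := by
  have h := sum_rhsDeriv hE hj (A := fun c => ⟨!![Real.exp c, 0; 0, Real.exp (-c)], by
      simp [Matrix.det_fin_two, ← Real.exp_add]⟩)
    (B := fun _ => 1)
    (W := fun z => Real.exp (2 * z.1) * (jetPoly (trunc p j).2.2).eval (z.2 - (trunc p j).1))
    (R := 2 * jetPoly (trunc p j).2.2) (m := -1) (by simp [moebius]) (fun c x => by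
      simp [moebius, Real.exp_neg, two_mul, Real.exp_add]
      ring)
    (ContDiffAt.mul (by fun_prop) (contDiffAt_eval _ (by fun_prop))) (fun x => by simp)
    (Filter.Eventually.of_forall fun x => by
      simpa using (((hasDerivAt_id (0 : ℝ)).const_mul 2).exp).mul_const
        ((jetPoly (trunc p j).2.2).eval (x - (trunc p j).1)))
    (by simp) (by simpa using (hasDerivAt_neg (0 : ℝ)).exp)
  have h2 : ∀ i : Fin (p + 1), ((i : ℕ).factorial : ℝ) * (2 * jetPoly (trunc p j).2.2).coeff i *
      E.rhsDeriv (trunc p j) i = 2 * (j.2.2 i * E.rhsDeriv (trunc p j) i) := fun i => by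
    rw [← C_ofNat, coeff_C_mul, coeff_jetPoly_trunc j (by omega)]
    field_simp
  simp only [h2, ← Finset.mul_sum] at h
  linarith

/-- From u ↦ u / (c u + 1), whose generator is -u^2; the inner sums are the Leibniz rule for u^2. -/
lemma sum_special_u (hE : E.IsProjectivelyInvariant) (hj : trunc p j ∈ E.dom) :
    ∑ i : Fin (p + 1), (∑ k ∈ Finset.range ((i : ℕ) + 1),
    ((i : ℕ).choose k : ℝ) * j.2.2 k * j.2.2 ((i : ℕ) - k)) * E.rhsDeriv (trunc p j) i =
      2 * j.2.2 0 * E.rhs (trunc p j) := by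
  set P := jetPoly (trunc p j).2.2 with hP
  have h := sum_rhsDeriv hE hj (A := fun c => ⟨!![1, 0; c, 1], by simp [Matrix.det_fin_two]⟩)
    (B := fun _ => 1)
    (W := fun z => P.eval (z.2 - (trunc p j).1) / (z.1 * P.eval (z.2 - (trunc p j).1) + 1))
    (R := -P ^ 2) (m := j.2.2 0) (by simp [moebius]) (fun c x => by simp [moebius, hP])
    (ContDiffAt.div (contDiffAt_eval _ (by fun_prop)) ((contDiffAt_fst.mul
      (contDiffAt_eval _ (by fun_prop))).add contDiffAt_const) (by simp)) (fun x => by simp [hP])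
    (Filter.Eventually.of_forall fun x => by
      have := (hasDerivAt_const (0 : ℝ) (P.eval (x - (trunc p j).1))).div
        (((hasDerivAt_id (0 : ℝ)).mul_const (P.eval (x - (trunc p j).1))).add_const 1) (by simp)
      refine this.congr_deriv ?_
      simp
      ring)
    (by simp) (by
      have := ((hasDerivAt_id (0 : ℝ)).mul_const (j.2.2 0)).add_const 1
      simpa [trunc] using this)
  have h2 : ∀ i : Fin (p + 1), ((i : ℕ).factorial : ℝ) * (-P ^ 2).coeff i =
      -∑ k ∈ Finset.range ((i : ℕ) + 1),
        ((i : ℕ).choose k : ℝ) * j.2.2 k * j.2.2 ((i : ℕ) - k) := fun i => by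
    rw [coeff_neg, sq, coeff_mul, Finset.Nat.sum_antidiagonal_eq_sum_range_succ
      (fun a b => P.coeff a * P.coeff b), mul_neg, Finset.mul_sum]
    congr 1
    refine Finset.sum_congr rfl fun k hk => ?_
    have hk' : k ≤ i := by simpa [Nat.lt_succ_iff] using hk
    rw [hP, coeff_jetPoly_trunc j (by omega), coeff_jetPoly_trunc j (by omega),
      Nat.cast_choose ℝ hk']
    field_simp
  simp only [h2, neg_mul, Finset.sum_neg_distrib] at h
  linarith

/-- From the dilations x - a ↦ e^(2c) (x - a), centred at the base point a so that it stays fixed.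
-/
lemma sum_scale_x (hE : E.IsProjectivelyInvariant) (hj : trunc p j ∈ E.dom) :
    ∑ i : Fin (p + 1), (i : ℕ) * j.2.2 i * E.rhsDeriv (trunc p j) i = 0 := by
  set P := jetPoly (trunc p j).2.2 with hP
  set a := (trunc p j).1 with ha
  have h := sum_rhsDeriv hE hj (A := fun _ => 1)
    (B := fun c => ⟨!![Real.exp c, a * (Real.exp (-c) - Real.exp c); 0, Real.exp (-c)], by
      simp [Matrix.det_fin_two, ← Real.exp_add]⟩)
    (W := fun z => P.eval (Real.exp (2 * z.1) * (z.2 - a)))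
    (R := 2 * (X * derivative P)) (m := 0) (Filter.Eventually.of_forall fun c => by
      have := (Real.exp_pos (-c)).ne'
      simp only [moebius, ← ha]
      constructor
      · simp
      · simp
        field_simp
        ring) (fun c x => by
      simp only [← hP, ← ha]
      have : moebius ⟨!![Real.exp c, a * (Real.exp (-c) - Real.exp c); 0, Real.exp (-c)], by
          simp [Matrix.det_fin_two, ← Real.exp_add]⟩ x - a = Real.exp (2 * c) * (x - a) := by
        simp [moebius, Real.exp_neg, two_mul, Real.exp_add]
        field_simp
        ring
      rw [this]
      simp [moebius])
    (contDiffAt_eval _ (by fun_prop)) (fun x => by simp [hP, ← ha])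
    (Filter.Eventually.of_forall fun x => by
      have h1 := (((hasDerivAt_id (0 : ℝ)).const_mul 2).exp).mul_const (x - a)
      have h2 := (P.hasDerivAt _).comp (0 : ℝ) h1
      refine h2.congr_deriv ?_
      simp [← ha]
      ring)
    (by simp) (by simpa using hasDerivAt_const (0 : ℝ) (1 : ℝ))
  have h2 : ∀ i : Fin (p + 1), ((i : ℕ).factorial : ℝ) * (2 * (X * derivative P)).coeff i *
      E.rhsDeriv (trunc p j) i = 2 * ((i : ℕ) * j.2.2 i * E.rhsDeriv (trunc p j) i) := fun i => by
    rw [← C_ofNat, coeff_C_mul]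
    rcases hi : (i : ℕ) with _ | k
    · simp
    · rw [coeff_X_mul, coeff_derivative, hP, coeff_jetPoly_trunc j (by omega)]
      push_cast
      field_simp
  simp only [h2, ← Finset.mul_sum] at h
  linarith

/-- From y ↦ y / (c y + 1) with y = x - a. The generator is -y^2 ∂_y, whose i-th derivative at y = 0
involves only u_{i-1}. -/
lemma sum_special_x (hE : E.IsProjectivelyInvariant) (hj : trunc p j ∈ E.dom) :
    ∑ i : Fin (p + 1), ((i : ℕ) * ((i : ℕ) - 1) : ℝ) * j.2.2 ((i : ℕ) - 1) *
    E.rhsDeriv (trunc p j) i = 0 := by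
  set P := jetPoly (trunc p j).2.2 with hP
  set a := (trunc p j).1 with ha
  have h := sum_rhsDeriv hE hj (A := fun _ => 1)
    (B := fun c => ⟨!![1 + c * a, -(c * a ^ 2); c, 1 - c * a], by
      simp [Matrix.det_fin_two]; ring⟩)
    (W := fun z => P.eval ((z.2 - a + a * (z.1 * (z.2 - a) + 1)) / (z.1 * (z.2 - a) + 1) - a))
    (R := -(X ^ 2 * derivative P)) (m := 0) (Filter.Eventually.of_forall fun c => by
      simp only [moebius, ← ha]
      constructor
      · simp
      · simp
        ring) (fun c x => by
      simp only [← hP, ← ha]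
      have : moebius ⟨!![1 + c * a, -(c * a ^ 2); c, 1 - c * a], by
          simp [Matrix.det_fin_two]; ring⟩ x =
          (x - a + a * (c * (x - a) + 1)) / (c * (x - a) + 1) := by
        simp only [moebius]
        simp
        congr 1 <;> ring
      rw [this]
      simp [moebius])
    (contDiffAt_eval _ ((ContDiffAt.div (by fun_prop) (by fun_prop) (by simp [← ha])).sub
      contDiffAt_const)) (fun x => by simp [hP, ← ha])
    (Filter.Eventually.of_forall fun x => by
      have h0 := ((hasDerivAt_id (0 : ℝ)).mul_const (x - a)).add_const 1
      have h1 := (((h0.const_mul a).const_add (x - a)).div h0 (by simp)).sub_const a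
      have h2 := (P.hasDerivAt _).comp (0 : ℝ) h1
      refine h2.congr_deriv ?_
      simp [← ha]
      ring)
    (by simp) (by simpa using hasDerivAt_const (0 : ℝ) (1 : ℝ))
  have h2 : ∀ i : Fin (p + 1), ((i : ℕ).factorial : ℝ) * (-(X ^ 2 * derivative P)).coeff i *
      E.rhsDeriv (trunc p j) i = -(((i : ℕ) * ((i : ℕ) - 1) : ℝ) * j.2.2 ((i : ℕ) - 1) *
        E.rhsDeriv (trunc p j) i) := fun i => by
    rw [coeff_neg]
    rcases hi : (i : ℕ) with _ | _ | k
    · simp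
    · simp [coeff_X_pow_mul']
    · rw [coeff_X_pow_mul, coeff_derivative, hP, coeff_jetPoly_trunc j (by omega)]
      rw [Nat.factorial_succ (k + 1)]
      push_cast
      field_simp
      ring
  simp only [h2, Finset.sum_neg_distrib] at h
  linarith

/-- Translations move the base point, so they are treated separately: Ψ is constant along the curve
of translated jets. -/
lemma deriv_translate (hE : E.IsProjectivelyInvariant) (hj : trunc p j ∈ E.dom)
    (a b : ℝ) : fderiv ℝ E.rhs (trunc p j) (a, b, 0) = 0 := by
  have hd : HasDerivAt (fun c : ℝ => trunc p j + c • ((a, b, 0) : Jet p)) (a, b, 0) 0 := by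
    simpa using ((hasDerivAt_id (0 : ℝ)).smul_const ((a, b, 0) : Jet p)).const_add (trunc p j)
  have hr : HasFDerivAt E.rhs (fderiv ℝ E.rhs (trunc p j))
      (trunc p j + (0 : ℝ) • ((a, b, 0) : Jet p)) := by
    rw [zero_smul, add_zero]; exact (differentiableAt_rhs hj).hasFDerivAt
  have h1 := hr.comp_hasDerivAt 0 hd
  have hdom : ∀ᶠ c in 𝓝 (0 : ℝ), trunc p j + c • ((a, b, 0) : Jet p) ∈ E.dom :=
    hd.continuousAt.eventually_mem (by
      rw [zero_smul, add_zero]; exact E.isOpen_dom.mem_nhds hj)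
  refine h1.unique ((hasDerivAt_const (0 : ℝ) (E.rhs (trunc p j))).congr_of_eventuallyEq ?_)
  filter_upwards [hdom] with c hc
  have e : trunc p j + c • ((a, b, 0) : Jet p) =
      ((trunc p j).1 + c * a, (trunc p j).2.1 + c * b, (trunc p j).2.2) := by
    refine Prod.ext ?_ (Prod.ext ?_ ?_) <;> simp
  simp only [Function.comp_apply]
  rw [e] at hc ⊢
  exact rhs_translate hE hj _ _ hc

end EvolutionEquation
end

/-! ### Passage from the jet algebra to symmetries on open sets of jets. -/

noncomputable section

open scoped ContDiff Topology

namespace JetFun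

variable {Ω : Set JetInf}

lemma ext_evalAt {f g : JetFun Ω} (h : ∀ j, evalAt j f = evalAt j g) : f = g :=
  Subtype.ext (funext h)

/-- A differential function on `Ω` as an element of the algebra. -/
def ofIsDiffFunction {n : ℕ} {F : JetInf → ℝ} (h : IsDiffFunction Ω n F) : JetFun Ω :=
  ⟨fun j => F j, n, h.choose, h.choose_spec.1, fun j => h.choose_spec.2 j.2⟩

lemma agrees_ofIsDiffFunction {n : ℕ} {F : JetInf → ℝ} (h : IsDiffFunction Ω n F) :
    Agrees F (ofIsDiffFunction h) := fun _ => rfl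

lemma ordLE_of_isRep (hΩ : IsOpen Ω) {f : JetFun Ω} {n : ℕ} {g : Jet n → ℝ}
    (h : IsRep (f : Ω → ℝ) n g) :
    (jetAlgebra hΩ).OrdLE f n := fun i hi => by
  refine ext_evalAt fun j => (dir_eq hΩ h _ j).trans ?_
  rw [trunc_direction_u_of_lt hi, map_zero, map_zero]

lemma ordLE_ofIsDiffFunction (hΩ : IsOpen Ω) {n : ℕ} {F : JetInf → ℝ} (h : IsDiffFunction Ω n F) :
    (jetAlgebra hΩ).OrdLE (ofIsDiffFunction h) n :=
  ordLE_of_isRep (f := ofIsDiffFunction h) hΩ ⟨h.choose_spec.1, fun j => h.choose_spec.2 j.2⟩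

lemma isOpen_setOf_ne (hΩ : IsOpen Ω) (f : JetFun Ω) :
    IsOpen {j | ∃ h : j ∈ Ω, evalAt ⟨j, h⟩ f ≠ 0} := by
  obtain ⟨n, g, hg⟩ := f.2
  have hc : Continuous (f : Ω → ℝ) := by
    rw [show (f : Ω → ℝ) = fun j : Ω => g (trunc n j) from funext hg.2]
    exact hg.1.continuousOn.comp_continuous ((truncL n).continuous.comp continuous_subtype_val)
      fun j => ⟨j, j.2, rfl⟩
  convert hΩ.isOpenMap_subtype_val _ (isOpen_ne_fun hc (continuous_const (y := (0 : ℝ)))) using 1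
  ext j
  simp [evalAt_apply]

lemma nontrivial_of_nonempty (h : Ω.Nonempty) : Nontrivial (JetFun Ω) := by
  obtain ⟨j, hj⟩ := h
  exact (evalAt (⟨j, hj⟩ : Ω)).domain_nontrivial

/-- The first derivative and the Schwarzian derivative do not vanish at a generic jet. -/
lemma exists_generic (hΩ : IsOpen Ω) (h : Ω.Nonempty) :
    ∃ j : Ω, evalAt j (coord Ω 1 * (2 * coord Ω 3 * coord Ω 1 - 3 * coord Ω 2 ^ 2)) ≠ 0 := by
  by_contra! h0
  set J := jetAlgebra hΩ
  have h1 : J.u 1 * (2 * J.u 3 * J.u 1 - 3 * J.u 2 ^ 2) = 0 := ext_evalAt fun j => by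
    rw [map_zero]
    exact h0 j
  have hn : ∀ (i k : ℕ) [k.AtLeastTwo], J.du i (OfNat.ofNat k : JetFun Ω) = 0 := fun i k _ => by
    rw [← Nat.cast_ofNat, Derivation.map_natCast]
  -- If the polynomial vanished on Ω, so would its derivative once in u_3 and twice in u_1, which is
  -- the constant 4.
  have h2 := congrArg (J.du 1) (congrArg (J.du 1) (congrArg (J.du 3) h1))
  simp [JetAlgebra.du_u, Derivation.leibniz, Derivation.leibniz_pow, hn] at h2
  have h3 := congrArg (evalAt ⟨h.some, h.some_mem⟩) h2
  rw [map_add, map_ofNat, map_zero] at h3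
  norm_num at h3

end JetFun

namespace EvolutionEquation

variable {p : ℕ} {E : EvolutionEquation p} {Ω : Set JetInf}

open JetFun

lemma isDiffFunction_rhsInf (hdom : ∀ j ∈ Ω, trunc p j ∈ E.dom) : IsDiffFunction Ω p E.rhsInf :=
  ⟨E.rhs, E.smooth_rhs.mono (by rintro _ ⟨j, hj, rfl⟩; exact hdom j hj), fun _ _ => rfl⟩

/-- The right-hand side of the equation as a differential function. -/
def rhsFun (hdom : ∀ j ∈ Ω, trunc p j ∈ E.dom) : JetFun Ω :=
  ofIsDiffFunction (isDiffFunction_rhsInf hdom)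

lemma agrees_rhsFun (hdom : ∀ j ∈ Ω, trunc p j ∈ E.dom) : Agrees E.rhsInf (rhsFun hdom) :=
  fun _ => rfl

lemma evalAt_d_rhsFun (hΩ : IsOpen Ω) (hdom : ∀ j ∈ Ω, trunc p j ∈ E.dom) (e : JetIndex) (j : Ω) :
    evalAt j ((jetAlgebra hΩ).d e (rhsFun hdom)) =
      fderiv ℝ E.rhs (trunc p j) (trunc p (direction e)) :=
  dir_eq hΩ (g := E.rhs) ⟨E.smooth_rhs.mono (by rintro _ ⟨j, hj, rfl⟩; exact hdom j hj),
    fun _ => rfl⟩ _ j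

lemma evalAt_du_rhsFun (hΩ : IsOpen Ω) (hdom : ∀ j ∈ Ω, trunc p j ∈ E.dom) (i : Fin (p + 1))
    (j : Ω) : evalAt j ((jetAlgebra hΩ).du i (rhsFun hdom)) = E.rhsDeriv (trunc p j) i := by
  rw [evalAt_d_rhsFun, rhsDeriv]
  congr 1
  refine Prod.ext rfl (Prod.ext rfl (funext fun k => ?_))
  simp [trunc, direction, Pi.single_apply, Fin.ext_iff]

lemma evalAt_u (hΩ : IsOpen Ω) (i : ℕ) (j : Ω) :
    evalAt j ((jetAlgebra hΩ).u i) = j.1.2.2 i := rfl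

lemma infinitesimallyInvariant {E : EvolutionEquation 6} (hE : E.IsProjectivelyInvariant)
    (hΩ : IsOpen Ω) (hdom : ∀ j ∈ Ω, trunc 6 j ∈ E.dom) :
    (jetAlgebra hΩ).InfinitesimallyInvariant (rhsFun hdom) where
  ord := ordLE_ofIsDiffFunction hΩ _
  dx := ext_evalAt fun j => by
    rw [evalAt_d_rhsFun, map_zero]
    exact deriv_translate hE (hdom j j.2) 1 0
  dt := ext_evalAt fun j => by
    rw [evalAt_d_rhsFun, map_zero]
    exact deriv_translate hE (hdom j j.2) 0 1
  du_zero := ext_evalAt fun j => by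
    rw [map_zero, ← rhsDeriv_zero hE (hdom j j.2), ← evalAt_du_rhsFun hΩ]
    rfl
  scale_u := ext_evalAt fun j => by
    rw [Finset.sum_range]
    simp only [map_sum, map_mul, evalAt_du_rhsFun, evalAt_u]
    exact sum_scale_u hE (hdom j j.2)
  scale_x := ext_evalAt fun j => by
    rw [Finset.sum_range]
    simp only [map_sum, map_mul, map_natCast, evalAt_du_rhsFun, evalAt_u, map_zero]
    exact sum_scale_x hE (hdom j j.2)
  special_x := ext_evalAt fun j => by
    rw [Finset.sum_range]
    simp only [map_sum, map_mul, map_sub, map_one, map_natCast, evalAt_du_rhsFun, evalAt_u,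
      map_zero]
    exact sum_special_x hE (hdom j j.2)
  special_u := ext_evalAt fun j => by
    rw [Finset.sum_range (n := 7)]
    simp only [map_sum, map_mul, map_natCast, map_ofNat, evalAt_du_rhsFun, evalAt_u]
    exact sum_special_u hE (hdom j j.2)

/-- On an open set of jets where the equation is defined, its separant does not vanish
identically. -/
lemma exists_separant_ne (hΩ : IsOpen Ω) (hne : Ω.Nonempty) (hdom : ∀ j ∈ Ω, trunc p j ∈ E.dom) :
    ∃ j : Ω, evalAt j ((jetAlgebra hΩ).du p (rhsFun hdom)) ≠ 0 := by
  obtain ⟨j, hj⟩ := hne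
  obtain ⟨_, ⟨i, hi, rfl⟩, -, h⟩ := mem_closure_iff.1 (E.order_rhs (hdom j hj)) _
    (isOpenMap_trunc p Ω hΩ) ⟨j, hj, rfl⟩
  refine ⟨⟨i, hi⟩, ?_⟩
  rw [← (agrees_rhsFun hdom).partialU hΩ]
  convert h using 1
  simp only [partialU, rhsInf]
  congr 1
  funext s
  congr 1
  refine Prod.ext rfl (Prod.ext rfl (funext fun k => ?_))
  simp [trunc, Function.update_apply, Fin.ext_iff]

/-- Where the four functions have no zeros they are units of the algebra, and the abstract theorem
applies. -/
lemma not_symmetry_of_forall_ne {E : EvolutionEquation 6} (hE : E.IsProjectivelyInvariant)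
    (hΩ : IsOpen Ω) (hne : Ω.Nonempty) (hdom : ∀ j ∈ Ω, trunc 6 j ∈ E.dom)
    (h1 : ∀ j ∈ Ω, j.2.2 1 * (2 * j.2.2 3 * j.2.2 1 - 3 * j.2.2 2 ^ 2) ≠ 0)
    (h6 : ∀ j ∈ Ω, partialU 6 E.rhsInf j ≠ 0)
    {n : ℕ} (hn : 7 ≤ n) {Q : JetInf → ℝ} (hQ : IsDiffFunction Ω n Q)
    (hQn : ∀ j ∈ Ω, partialU n Q j ≠ 0)
    (hinv : ∀ j ∈ Ω, totalT E.rhsInf Q j = linearization E.rhsInf Q j) : False := by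
  have := nontrivial_of_nonempty hne
  have hΨ := agrees_rhsFun hdom
  have hQ' := agrees_ofIsDiffFunction hQ
  set J := jetAlgebra hΩ
  have hu1 : IsUnit (J.u 1) := isUnit_of_forall_ne fun j => left_ne_zero_of_mul (h1 j j.2)
  refine J.not_symmetry (infinitesimallyInvariant hE hΩ hdom) hu1 (fun v hv => ?_)
    (isUnit_of_forall_ne fun j => ?_) hn (ordLE_ofIsDiffFunction hΩ hQ)
    (isUnit_of_forall_ne fun j => ?_) (ext_evalAt fun j => ?_)
  · have hw : IsUnit (2 * J.u 3 * J.u 1 - 3 * J.u 2 ^ 2) :=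
      isUnit_of_forall_ne fun j => right_ne_zero_of_mul (h1 j j.2)
    have hvu : IsUnit v := IsUnit.of_mul_eq_one_right _ hv
    convert (hvu.mul hvu).mul hw using 1
    rw [JetAlgebra.schwarzian]
    linear_combination (-2 * J.u 3 * v) * hv
  · simpa [hΨ.partialU hΩ 6 j, evalAt_apply] using h6 j j.2
  · simpa [hQ'.partialU hΩ n j, evalAt_apply] using hQn j j.2
  · rw [← hQ'.totalT hΩ hΨ j, ← hΨ.linearization hΩ hQ' j]
    exact hinv j j.2

/-- The domain is shrunk in turn to where ∂Q/∂u_n, then the separant, then u_x and the Schwarzian do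
not vanish. Each set is open, and nonempty by genericity on the previous one; the symmetry condition
restricts to it. -/
theorem not_isLieBacklundSymmetryOfOrder {E : EvolutionEquation 6}
    (hE : E.IsProjectivelyInvariant) {n : ℕ} (hn : 7 ≤ n) {Q : JetInf → ℝ} :
    ¬ E.IsLieBacklundSymmetryOfOrder Ω n Q := by
  rintro ⟨⟨hΩ, hdom, -, hinv⟩, hQ, i₀, hi₀, hi⟩
  have hQ' := agrees_ofIsDiffFunction hQ
  rw [hQ'.partialU hΩ n ⟨i₀, hi₀⟩] at hi
  set Ω₁ := {j | ∃ h : j ∈ Ω, evalAt ⟨j, h⟩ ((jetAlgebra hΩ).du n (ofIsDiffFunction hQ)) ≠ 0}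
    with hΩ₁
  have o₁ : IsOpen Ω₁ := isOpen_setOf_ne hΩ _
  obtain ⟨⟨i₁, hi₁⟩, h₁⟩ := exists_separant_ne (E := E) o₁ ⟨i₀, hi₀, hi⟩ fun j hj => hdom j hj.1
  set Ω₂ := {j | ∃ h : j ∈ Ω₁, evalAt ⟨j, h⟩ ((jetAlgebra o₁).du 6
    (rhsFun (E := E) fun j hj => hdom j hj.1)) ≠ 0} with hΩ₂
  have o₂ : IsOpen Ω₂ := isOpen_setOf_ne o₁ _
  obtain ⟨⟨i₂, hi₂⟩, h₂⟩ := exists_generic o₂ ⟨i₁, hi₁, h₁⟩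
  have o₃ := isOpen_setOf_ne o₂ (coord Ω₂ 1 * (2 * coord Ω₂ 3 * coord Ω₂ 1 - 3 * coord Ω₂ 2 ^ 2))
  refine not_symmetry_of_forall_ne hE o₃ ⟨i₂, hi₂, h₂⟩ (fun j hj => hdom j hj.1.1.1)
    (fun j hj => ?_) (fun j hj => ?_) hn (Q := Q) ?_ (fun j hj => ?_) fun j hj => hinv j hj.1.1.1
  · exact hj.2
  · obtain ⟨⟨h, h'⟩, -⟩ := hj
    rwa [← (agrees_rhsFun _).partialU o₁ 6 ⟨j, h⟩] at h'
  · obtain ⟨g, hg, he⟩ := hQ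
    exact ⟨g, hg.mono (Set.image_mono fun j hj => hj.1.1.1), fun j hj => he hj.1.1.1⟩
  · obtain ⟨⟨⟨h, h'⟩, -⟩, -⟩ := hj
    rwa [← hQ'.partialU hΩ n ⟨j, h⟩] at h'

end EvolutionEquation
end

theorem proposition3 (E : EvolutionEquation 6) (hE : E.IsProjectivelyInvariant) :
    (∀ n : ℕ, 7 ≤ n → ¬ ∃ (Ω : Set JetInf) (Q : JetInf → ℝ),
      E.IsLieBacklundSymmetryOfOrder Ω n Q) ∧
    ¬ E.IsSymmetryIntegrable := by
  refine ⟨fun n hn ⟨Ω, Q, h⟩ => EvolutionEquation.not_isLieBacklundSymmetryOfOrder hE hn h, ?_⟩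
  rintro ⟨Ω, R, Q, -, -, -, h⟩
  -- Symmetries of arbitrarily high order include one of order above six.
  obtain ⟨n, hn, i, hi⟩ := h 6
  exact EvolutionEquation.not_isLieBacklundSymmetryOfOrder hE hn hi
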